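/- Theorem. All graphs are finite and simple, and graph embeddings in the real projective plane $\mathbb{R}P^2$ are piecewise linear: vertices are distinct points, edges are piecewise linear simple arcs joining their ends, no edge passes through a vertex other than its ends, and two edges meet at most in a common end. A cycle $C$ of an embedded graph is *0-homologous* if it bounds a closed disk in $\mathbb{R}P^2$. An embedding of $G$ in $\mathbb{R}P^2$ is *separating* if there are a 0-homologous cycle $C$ of $G$ and two vertices of $G$ not on $C$ that lie in different connected components of $\mathbb{R}P^2\setminus C$. A graph is *nonseparating projective planar* if it has an embedding in $\mathbb{R}P^2$ that is not separating. Let $G$ be a nonseparating projective planar graph and let $v_0$ be a vertex of $G$ with exactly three neighbours $v_1,v_2,v_3$. Let $G'$ be the graph obtained from $G$ by the Y-$\Delta$ exchange at $v_0$: delete $v_0$ together with its three edges, and add each of the edges $v_1v_2$, $v_1v_3$, $v_2v_3$ that is not already present. Then $G'$ is nonseparating projective planar. -/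

import Mathlib

open Set

/-- The real projective plane: the lines through the origin of `ℝ³`. -/
abbrev RP2 : Type := Projectivization ℝ (Fin 3 → ℝ)

/-- The quotient topology from `ℝ³ ∖ {0}`. -/
noncomputable instance RP2.instTopologicalSpace : TopologicalSpace RP2 :=
  TopologicalSpace.coinduced
    (fun v : {v : Fin 3 → ℝ // v ≠ 0} => Projectivization.mk ℝ v.1 v.2) inferInstance

/-- The polygonal curve in `ℝ³` with corners `x 0, x 1, x 2, …`, which runs through the
segment from `x k` to `x (k + 1)` affinely while `t` runs through `[k, k + 1]`. -/
noncomputable def polygonalCurve (x : ℕ → Fin 3 → ℝ) (t : ℝ) : Fin 3 → ℝ :=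
  AffineMap.lineMap (x ⌊t⌋₊) (x (⌊t⌋₊ + 1)) (Int.fract t)

/-- `A` is a piecewise linear (simple) arc in the projective plane from `p` to `q`: the injective
image in `RP2` of a polygonal curve of `ℝ³ ∖ {0}` with finitely many corners `x 0, …, x n`.
Piecewise linearity refers to the standard piecewise linear structure of the projective plane
(the boundary of an octahedron modulo its antipodal map), whose pieces are projective segments. -/
def IsPLArc (p q : RP2) (A : Set RP2) : Prop :=
  ∃ (n : ℕ) (x : ℕ → Fin 3 → ℝ) (hx : ∀ t : Icc (0 : ℝ) n, polygonalCurve x t ≠ 0)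
    (γ : Icc (0 : ℝ) n → RP2),
    (∀ t, γ t = Projectivization.mk ℝ (polygonalCurve x t) (hx t)) ∧
    Function.Injective γ ∧ range γ = A ∧
    γ ⟨0, le_refl _, Nat.cast_nonneg n⟩ = p ∧ γ ⟨n, Nat.cast_nonneg n, le_refl _⟩ = q

/-- A piecewise linear embedding of a graph in the projective plane. -/
structure ProjectivePlanarEmbedding {V : Type*} (G : SimpleGraph V) where
  /-- the points that represent the vertices -/
  point : V → RP2
  /-- the arcs that represent the edges (without meaning on pairs that are not edges) -/
  arc : Sym2 V → Set RP2
  point_injective : Function.Injective point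
  isPLArc : ∀ u v : V, G.Adj u v → IsPLArc (point u) (point v) (arc s(u, v))
  /-- an edge passes through no vertex other than its ends -/
  mem_of_point_mem_arc : ∀ e ∈ G.edgeSet, ∀ v : V, point v ∈ arc e → v ∈ e
  /-- two edges meet at most in a common end -/
  arc_inter_arc : ∀ e ∈ G.edgeSet, ∀ e' ∈ G.edgeSet, e ≠ e' →
    ∀ p ∈ arc e ∩ arc e', ∃ v : V, v ∈ e ∧ v ∈ e' ∧ p = point v

/-- The subset of the projective plane that represents the edges of a walk (for a cycle, this is
the simple closed curve that represents it). -/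
def ProjectivePlanarEmbedding.carrier {V : Type*} {G : SimpleGraph V}
    (f : ProjectivePlanarEmbedding G) {u v : V} (w : G.Walk u v) : Set RP2 :=
  {p | ∃ e ∈ w.edges, p ∈ f.arc e}

/-- A subset of the projective plane is 0-homologous if it bounds a disk: it is the image of the
boundary circle under an embedding of the closed unit disk. -/
def BoundsDisk (C : Set RP2) : Prop :=
  ∃ D : Metric.closedBall (0 : EuclideanSpace ℝ (Fin 2)) 1 → RP2,
    Topology.IsEmbedding D ∧
    D '' {z | (z : EuclideanSpace ℝ (Fin 2)) ∈ Metric.sphere 0 1} = C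

/-- An embedding is separating if some 0-homologous cycle `C` of the graph has two vertices off
`C` in different connected components of the complement of `C`. -/
def ProjectivePlanarEmbedding.IsSeparating {V : Type*} {G : SimpleGraph V}
    (f : ProjectivePlanarEmbedding G) : Prop :=
  ∃ (u : V) (C : G.Walk u u), C.IsCycle ∧ BoundsDisk (f.carrier C) ∧
    ∃ a b : V, a ∉ C.support ∧ b ∉ C.support ∧
      connectedComponentIn (f.carrier C)ᶜ (f.point a) ≠
        connectedComponentIn (f.carrier C)ᶜ (f.point b)

/-- A graph is nonseparating projective planar if it has a projective planar embedding that is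
not separating. -/
def IsNonseparatingProjectivePlanar {V : Type*} (G : SimpleGraph V) : Prop :=
  ∃ f : ProjectivePlanarEmbedding G, ¬ f.IsSeparating

/-- The Y-Δ exchange at `v₀` (meant for a vertex with exactly three neighbours): delete `v₀` and
the edges at it, and join its neighbours pairwise, where they are not yet joined. -/
def yDeltaExchange {V : Type*} (G : SimpleGraph V) (v₀ : V) : SimpleGraph {v : V // v ≠ v₀} where
  Adj a b := G.Adj a b ∨ (a ≠ b ∧ G.Adj v₀ a ∧ G.Adj v₀ b)
  symm := ⟨by
    rintro a b (h | ⟨h, ha, hb⟩)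
    · exact Or.inl h.symm
    · exact Or.inr ⟨h.symm, hb, ha⟩⟩
  loopless := ⟨by
    rintro a (h | ⟨h, -⟩)
    · exact G.loopless.irrefl _ h
    · exact h rfl⟩

/-!
The exchange is carried out inside a small triangle. A nonseparating embedding of `G` is first
normalized by piecewise linear homeomorphisms of the projective plane, which do not affect the
property of being nonseparating: the three edges at `v₀` become the straight segments from the
centre of a projective triangle to its corners, and the rest of the graph meets the triangle in the
corners only (`ProjectivePlanarEmbedding.exists_isStandard`). For this the edges at `v₀` are
retracted to segments (`exists_shrink`), the segments are spread out by linear algebra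
(`StraightTripod.hasStandardPosition`), and the triangle is folded into thin neighbourhoods of the
segments, which the other edges avoid (`exists_fold_all`). Then `v₀` is removed and the three sides
are drawn as polygonal arcs in the triangle (`deltaEmbedding`), also when they are edges of `G`
already.

The new embedding is nonseparating because its cycles, with one exception, are images of cycles of
the old one. If a cycle of the new graph contains one or two of the sides, then replacing them by a
path through `v₀` gives a cycle of `G`, and a homeomorphism carries the second cycle to the first
and fixes the two vertices in question (`exists_homeomorph_bend`,
`exists_homeomorph_bend_union_bend`). A homeomorphism respects both the property of bounding a disk
and the components of the complement, so that the hypothesis on `G` applies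
(`IsDelta.component_eq`). A cycle without sides is a cycle of `G` with the same carrier, and the
cycle of all three sides lies in the triangle, whose complement is connected and contains all other
vertices (`isPreconnected_compl_tri`). As everything is done by explicit homeomorphisms, neither the
Jordan curve theorem nor the Schoenflies theorem is needed.

All homeomorphisms are compositions of one elementary move (`IsConeMove`): it moves an interior
point of a projective triangle to another one, is linear on the cones over the three triangles which
the point spans with the sides, and is the identity outside. In homogeneous coordinates it is given
by a formula (`coneMap`) whose inverse has the same form. Piecewise linear arcs are treated as
unions of projective segments that are attached one after the other (`PolyArc`).
-/

/-! ### Points, segments and triangles of the projective plane -/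

/-- Vectors of `ℝ³`, the homogeneous coordinates of the points of the projective plane. -/
abbrev Vec : Type := Fin 3 → ℝ

/-- The point with homogeneous coordinates `v`; a junk point for `v = 0`. -/
noncomputable def pt (v : Vec) : RP2 :=
  if h : v ≠ 0 then Projectivization.mk ℝ v h else Projectivization.mk ℝ 1 one_ne_zero

lemma pt_eq_mk {v : Vec} (h : v ≠ 0) : pt v = Projectivization.mk ℝ v h := by
  simp [pt, h]

lemma pt_eq_pt_iff {v w : Vec} (hv : v ≠ 0) (hw : w ≠ 0) :
    pt v = pt w ↔ ∃ a : ℝ, a ≠ 0 ∧ v = a • w := by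
  rw [pt_eq_mk hv, pt_eq_mk hw, Projectivization.mk_eq_mk_iff']
  constructor
  · rintro ⟨a, rfl⟩
    exact ⟨a, fun h => hv (by simp [h]), rfl⟩
  · rintro ⟨a, -, rfl⟩
    exact ⟨a, rfl⟩

lemma exists_eq_pt (P : RP2) : ∃ v : Vec, v ≠ 0 ∧ P = pt v := by
  induction P using Projectivization.ind with
  | h v h => exact ⟨v, h, (pt_eq_mk h).symm⟩

lemma pt_smul {a : ℝ} (ha : a ≠ 0) (v : Vec) : pt (a • v) = pt v := by
  by_cases hv : v = 0
  · simp [hv]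
  · exact (pt_eq_pt_iff (smul_ne_zero ha hv) hv).2 ⟨a, ha, rfl⟩

lemma pt_neg (v : Vec) : pt (-v) = pt v := by
  simpa using pt_smul (a := -1) (by norm_num) v

/-- The points of the projective plane with homogeneous coordinates in `S`. -/
def proj (S : Set Vec) : Set RP2 := {P | ∃ v ∈ S, v ≠ 0 ∧ P = pt v}

/-- The convex cone spanned by two vectors. -/
def cone2 (x y : Vec) : Set Vec := {v | ∃ s t : ℝ, 0 ≤ s ∧ 0 ≤ t ∧ v = s • x + t • y}

/-- The convex cone spanned by three vectors. -/
def cone3 (x y z : Vec) : Set Vec :=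
  {v | ∃ s t u : ℝ, 0 ≤ s ∧ 0 ≤ t ∧ 0 ≤ u ∧ v = s • x + t • y + u • z}

/-- The projective segment that is covered by the segment from `x` to `y`. -/
def seg (x y : Vec) : Set RP2 := proj (cone2 x y)

/-- The projective triangle that is covered by the triangle with corners `x`, `y`, `z`. -/
def tri (x y z : Vec) : Set RP2 := proj (cone3 x y z)

lemma proj_mono {S T : Set Vec} (h : S ⊆ T) : proj S ⊆ proj T := by
  rintro P ⟨v, hv, hv0, rfl⟩
  exact ⟨v, h hv, hv0, rfl⟩

lemma pt_mem_seg {x y : Vec} {s t : ℝ} (hs : 0 ≤ s) (ht : 0 ≤ t) (h : s • x + t • y ≠ 0) :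
    pt (s • x + t • y) ∈ seg x y :=
  ⟨_, ⟨s, t, hs, ht, rfl⟩, h, rfl⟩

lemma seg_comm (x y : Vec) : seg x y = seg y x := by
  have h : ∀ x y : Vec, cone2 x y ⊆ cone2 y x := by
    rintro x y v ⟨s, t, hs, ht, rfl⟩
    exact ⟨t, s, ht, hs, add_comm _ _⟩
  exact congrArg proj ((h x y).antisymm (h y x))

lemma seg_smul {a b : ℝ} (ha : 0 < a) (hb : 0 < b) (x y : Vec) :
    seg (a • x) (b • y) = seg x y := by
  apply congrArg proj
  ext v
  constructor
  · rintro ⟨s, t, hs, ht, rfl⟩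
    exact ⟨s * a, t * b, by positivity, by positivity, by module⟩
  · rintro ⟨s, t, hs, ht, rfl⟩
    refine ⟨s / a, t / b, by positivity, by positivity, ?_⟩
    rw [smul_smul, smul_smul, div_mul_cancel₀ _ ha.ne', div_mul_cancel₀ _ hb.ne']

lemma seg_neg (x y : Vec) : seg (-x) (-y) = seg x y := by
  have h : ∀ x y : Vec, seg (-x) (-y) ⊆ seg x y := by
    rintro x y P ⟨v, ⟨s, t, hs, ht, rfl⟩, h0, rfl⟩
    have e : s • -x + t • -y = -(s • x + t • y) := by module
    rw [e, pt_neg]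
    exact pt_mem_seg hs ht (by rwa [e, neg_ne_zero] at h0)
  refine (h x y).antisymm ?_
  simpa using h (-x) (-y)

lemma seg_smul_same {a : ℝ} (ha : a ≠ 0) (x y : Vec) : seg (a • x) (a • y) = seg x y := by
  rcases lt_or_gt_of_ne ha with h | h
  · have := seg_smul (neg_pos.2 h) (neg_pos.2 h) x y
    rw [neg_smul, neg_smul, seg_neg] at this
    exact this
  · exact seg_smul h h x y

lemma left_mem_seg {x y : Vec} (hx : x ≠ 0) : pt x ∈ seg x y :=
  ⟨x, ⟨1, 0, zero_le_one, le_rfl, by module⟩, hx, rfl⟩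

lemma right_mem_seg {x y : Vec} (hy : y ≠ 0) : pt y ∈ seg x y :=
  ⟨y, ⟨0, 1, le_rfl, zero_le_one, by module⟩, hy, rfl⟩

/-- Linear independence of two vectors, in coordinates. -/
def Indep2 (x y : Vec) : Prop := ∀ s t : ℝ, s • x + t • y = 0 → s = 0 ∧ t = 0

/-- Linear independence of three vectors, in coordinates. -/
def Indep3 (x y z : Vec) : Prop :=
  ∀ s t u : ℝ, s • x + t • y + u • z = 0 → s = 0 ∧ t = 0 ∧ u = 0

namespace Indep2
variable {x y : Vec}

lemma symm (h : Indep2 x y) : Indep2 y x := fun s t e => by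
  have := h t s (by rw [add_comm]; exact e)
  exact ⟨this.2, this.1⟩

lemma ne_zero (h : Indep2 x y) {s t : ℝ} (hst : s ≠ 0 ∨ t ≠ 0) : s • x + t • y ≠ 0 := fun e => by
  have := h s t e
  tauto

lemma left_ne_zero (h : Indep2 x y) : x ≠ 0 := by
  have := h.ne_zero (s := 1) (t := 0) (by simp)
  simpa using this

lemma right_ne_zero (h : Indep2 x y) : y ≠ 0 := h.symm.left_ne_zero

lemma eq_of_eq (h : Indep2 x y) {s t s' t' : ℝ} (e : s • x + t • y = s' • x + t' • y) :
    s = s' ∧ t = t' := by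
  have := h (s - s') (t - t') (by
    have : (s - s') • x + (t - t') • y = (s • x + t • y) - (s' • x + t' • y) := by module
    rw [this, e, sub_self])
  constructor <;> linarith [this.1, this.2]

lemma pt_ne (h : Indep2 x y) : pt x ≠ pt y := fun e => by
  obtain ⟨a, ha, rfl⟩ := (pt_eq_pt_iff h.left_ne_zero h.right_ne_zero).1 e
  exact one_ne_zero (h 1 (-a) (by module)).1

lemma of_pt_ne (hx : x ≠ 0) (hy : y ≠ 0) (h : pt x ≠ pt y) : Indep2 x y := by
  intro s t e
  by_cases hs : s = 0
  · subst hs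
    refine ⟨rfl, ?_⟩
    simpa [hy] using e
  · exfalso
    have ht : t ≠ 0 := by
      rintro rfl
      simp [hs, hx] at e
    refine h ((pt_eq_pt_iff hx hy).2 ⟨-t / s, by simp [hs, ht], ?_⟩)
    have : x = s⁻¹ • (s • x + t • y) + (-t / s) • y := by
      rw [smul_add, smul_smul, smul_smul, inv_mul_cancel₀ hs, div_eq_inv_mul]; module
    rw [e] at this
    simpa using this

end Indep2

namespace Indep3
variable {x y z : Vec}

lemma ne_zero (h : Indep3 x y z) {s t u : ℝ} (hst : s ≠ 0 ∨ t ≠ 0 ∨ u ≠ 0) :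
    s • x + t • y + u • z ≠ 0 := fun e => by
  have := h s t u e
  tauto

lemma rotate (h : Indep3 x y z) : Indep3 y z x := fun s t u e => by
  have := h u s t (by rw [← e]; module)
  tauto

lemma swap (h : Indep3 x y z) : Indep3 y x z := fun s t u e => by
  have := h t s u (by rw [← e]; module)
  tauto

lemma swap' (h : Indep3 x y z) : Indep3 x z y := h.rotate.swap.rotate.rotate

lemma indep2 (h : Indep3 x y z) : Indep2 x y := fun s t e => by
  have := h s t 0 (by rw [← e]; module)
  tauto

lemma eq_of_eq (h : Indep3 x y z) {s t u s' t' u' : ℝ}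
    (e : s • x + t • y + u • z = s' • x + t' • y + u' • z) : s = s' ∧ t = t' ∧ u = u' := by
  have := h (s - s') (t - t') (u - u') (by
    have : (s - s') • x + (t - t') • y + (u - u') • z
      = (s • x + t • y + u • z) - (s' • x + t' • y + u' • z) := by module
    rw [this, e, sub_self])
  refine ⟨?_, ?_, ?_⟩ <;> linarith [this.1, this.2.1, this.2.2]

lemma linearIndependent (h : Indep3 x y z) : LinearIndependent ℝ ![x, y, z] := by
  rw [Fintype.linearIndependent_iff]
  intro g hg
  have := h (g 0) (g 1) (g 2) (by simpa [Fin.sum_univ_three] using hg)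
  intro i
  fin_cases i <;> simp [this]

/-- The basis formed by three independent vectors. -/
noncomputable def basis (h : Indep3 x y z) : Module.Basis (Fin 3) ℝ Vec :=
  basisOfLinearIndependentOfCardEqFinrank h.linearIndependent (by simp)

lemma basis_equivFun_symm (h : Indep3 x y z) (c : Vec) :
    h.basis.equivFun.symm c = c 0 • x + c 1 • y + c 2 • z := by
  simp [basis, Module.Basis.equivFun_symm_apply, Fin.sum_univ_three]

lemma exists_coord (h : Indep3 x y z) (v : Vec) :
    ∃ s t u : ℝ, v = s • x + t • y + u • z := by
  refine ⟨h.basis.equivFun v 0, h.basis.equivFun v 1, h.basis.equivFun v 2, ?_⟩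
  rw [← h.basis_equivFun_symm, LinearEquiv.symm_apply_apply]

end Indep3

lemma Indep2.exists_indep3 {x y : Vec} (h : Indep2 x y) : ∃ z, Indep3 x y z := by
  by_contra! hc
  have key : ∀ z, ∃ s t : ℝ, z = s • x + t • y := by
    intro z
    have := hc z
    unfold Indep3 at this
    push Not at this
    obtain ⟨s, t, u, e, hn⟩ := this
    by_cases hu : u = 0
    · subst hu
      have := h s t (by rw [← e]; module)
      tauto
    · refine ⟨-s / u, -t / u, ?_⟩
      have : z = u⁻¹ • (s • x + t • y + u • z) + ((-s / u) • x + (-t / u) • y) := by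
        simp only [smul_add, smul_smul, inv_mul_cancel₀ hu, div_eq_inv_mul]; module
      rw [e] at this
      simpa using this
  have hspan : ⊤ ≤ Submodule.span ℝ (Set.range ![x, y]) := by
    intro z _
    obtain ⟨s, t, rfl⟩ := key z
    refine Submodule.add_mem _ (Submodule.smul_mem _ _ (Submodule.subset_span ⟨0, rfl⟩))
      (Submodule.smul_mem _ _ (Submodule.subset_span ⟨1, rfl⟩))
  have h1 := finrank_range_le_card (R := ℝ) ![x, y]
  rw [Set.finrank, top_le_iff.1 hspan] at h1
  simp at h1

lemma Indep3.of_not_mem {x y z : Vec} (h : Indep2 x y) (hz : ∀ s t : ℝ, z ≠ s • x + t • y) :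
    Indep3 x y z := by
  intro s t u e
  by_cases hu : u = 0
  · subst hu
    have := h s t (by rw [← e]; module)
    tauto
  · exfalso
    refine hz (-s / u) (-t / u) ?_
    have : z = u⁻¹ • (s • x + t • y + u • z) + ((-s / u) • x + (-t / u) • y) := by
      simp only [smul_add, smul_smul, inv_mul_cancel₀ hu, div_eq_inv_mul]; module
    rw [e] at this
    simpa using this

/-! ### Closed sets of the projective plane -/

lemma isOpen_coord_compl {F : Set RP2} (hF : IsClosed F) :
    IsOpen {v : Vec | v ≠ 0 ∧ pt v ∉ F} := by
  have h1 : IsOpen ((fun v : {v : Vec // v ≠ 0} => Projectivization.mk ℝ v.1 v.2) ⁻¹' Fᶜ) :=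
    isOpen_coinduced.1 hF.isOpen_compl
  have h2 : IsOpen {v : Vec | v ≠ 0} := isOpen_ne
  have h3 := h2.isOpenMap_subtype_val _ h1
  convert h3 using 1
  ext v
  constructor
  · rintro ⟨hv, h⟩
    exact ⟨⟨v, hv⟩, by simpa [pt_eq_mk hv] using h, rfl⟩
  · rintro ⟨⟨w, hw⟩, h, rfl⟩
    exact ⟨hw, by simpa [pt_eq_mk hw] using h⟩

/-- The projection of a compact set of nonzero vectors is closed: proportionality to `v` is a
closed condition on pairs of vectors, and one projects it along the compact set. -/
lemma isClosed_proj_of_isCompact {S : Set Vec} (hS : IsCompact S) (h0 : (0 : Vec) ∉ S) :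
    IsClosed (proj S) := by
  have : CompactSpace S := isCompact_iff_compactSpace.1 hS
  have h1 : IsClosed {p : S × Vec | ∀ i j, p.1.1 i * p.2 j = p.1.1 j * p.2 i} := by
    simp only [Set.ofPred_forall]
    have hc : ∀ i j, Continuous fun p : S × Vec => p.1.1 i * p.2 j := fun i j =>
      ((continuous_apply i).comp (continuous_subtype_val.comp continuous_fst)).mul
        ((continuous_apply j).comp continuous_snd)
    exact isClosed_iInter fun i => isClosed_iInter fun j => isClosed_eq (hc i j) (hc j i)
  have h2 := isClosedMap_snd_of_compactSpace _ h1
  rw [← isOpen_compl_iff, isOpen_coinduced, ← preimage_compl.symm, isOpen_compl_iff]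
  convert h2.preimage continuous_subtype_val using 1
  ext ⟨v, hv⟩
  simp only [mem_preimage, mem_image, mem_ofPred_eq, Prod.exists, exists_eq_right, Subtype.exists]
  constructor
  · rintro ⟨w, hw, hw0, h⟩
    rw [← pt_eq_mk hv] at h
    obtain ⟨a, ha, rfl⟩ := (pt_eq_pt_iff hv hw0).1 h
    exact ⟨w, hw, fun i j => by simp; ring⟩
  · rintro ⟨w, hw, h⟩
    have hw0 : w ≠ 0 := fun e => h0 (e ▸ hw)
    refine ⟨w, hw, hw0, ?_⟩
    rw [← pt_eq_mk hv]
    obtain ⟨j, hj⟩ := Function.ne_iff.1 hw0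
    have e : v = (v j / w j) • w := by
      ext i
      have := h i j
      simp only [Pi.smul_apply, smul_eq_mul, Pi.zero_apply] at hj ⊢
      field_simp
      linarith
    refine (pt_eq_pt_iff hv hw0).2 ⟨_, fun h0 => hv ?_, e⟩
    rw [e, h0, zero_smul]

lemma isClosed_singleton_pt (P : RP2) : IsClosed ({P} : Set RP2) := by
  obtain ⟨v, hv, rfl⟩ := exists_eq_pt P
  convert isClosed_proj_of_isCompact (S := {v}) isCompact_singleton (by simpa using hv.symm) using 1
  ext Q
  constructor
  · rintro rfl
    exact ⟨v, rfl, hv, rfl⟩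
  · rintro ⟨w, rfl, -, h⟩
    exact h

lemma seg_eq_image {x y : Vec} (h : Indep2 x y) :
    seg x y = (fun t : ℝ => pt ((1 - t) • x + t • y)) '' Icc 0 1 := by
  apply Subset.antisymm
  · rintro P ⟨v, ⟨s, t, hs, ht, rfl⟩, hv, rfl⟩
    have hst : 0 < s + t := by
      by_contra hn
      have h1 : s = 0 := by linarith
      have h2 : t = 0 := by linarith
      simp [h1, h2] at hv
    refine ⟨t / (s + t), ⟨by positivity, ?_⟩, ?_⟩
    · rw [div_le_one hst]; linarith
    · have e1 : 1 - t / (s + t) = (s + t)⁻¹ * s := by field_simp; ring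
      have e2 : t / (s + t) = (s + t)⁻¹ * t := by field_simp
      simp only [e1]
      rw [e2, ← pt_smul (a := (s + t)⁻¹) (by positivity) (s • x + t • y), smul_add, smul_smul,
        smul_smul]
  · rintro P ⟨t, ⟨ht0, ht1⟩, rfl⟩
    refine pt_mem_seg (by linarith) ht0 fun e => ?_
    have := h _ _ e
    linarith [this.1, this.2]

lemma isClosed_seg {x y : Vec} (h : Indep2 x y) : IsClosed (seg x y) := by
  have hc : IsCompact ((fun t : ℝ => (1 - t) • x + t • y) '' Icc 0 1) :=
    isCompact_Icc.image (by fun_prop)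
  have hne : ∀ t : ℝ, (1 - t) • x + t • y ≠ 0 := fun t e => by
    have := h _ _ e
    linarith [this.1, this.2]
  convert isClosed_proj_of_isCompact hc (fun ⟨t, _, e⟩ => hne t e) using 1
  rw [seg_eq_image h]
  ext P
  constructor
  · rintro ⟨t, ht, rfl⟩
    exact ⟨_, ⟨t, ht, rfl⟩, hne t, rfl⟩
  · rintro ⟨_, ⟨t, ht, rfl⟩, -, rfl⟩
    exact ⟨t, ht, rfl⟩

/-- A triangle that avoids a closed set still avoids it after a small perturbation of its corners;
the triangle may be degenerate. -/
lemma exists_delta_avoid {F : Set RP2} (hF : IsClosed F) (a b c : Vec)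
    (h : ∀ s t u : ℝ, 0 ≤ s → 0 ≤ t → 0 ≤ u → s + t + u = 1 →
      s • a + t • b + u • c ≠ 0 ∧ pt (s • a + t • b + u • c) ∉ F) :
    ∃ δ > 0, ∀ a' b' c' : Vec, dist a' a < δ → dist b' b < δ → dist c' c < δ →
      ∀ s t u : ℝ, 0 ≤ s → 0 ≤ t → 0 ≤ u → s • a' + t • b' + u • c' ≠ 0 →
        pt (s • a' + t • b' + u • c') ∉ F := by
  have hK : IsCompact ((fun w : Fin 3 → ℝ => w 0 • a + w 1 • b + w 2 • c) ''
      stdSimplex ℝ (Fin 3)) := (isCompact_stdSimplex ℝ (Fin 3)).image (by fun_prop)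
  have hsub : ((fun w : Fin 3 → ℝ => w 0 • a + w 1 • b + w 2 • c) '' stdSimplex ℝ (Fin 3)) ⊆
      {v : Vec | v ≠ 0 ∧ pt v ∉ F} := by
    rintro v ⟨w, ⟨hw, hw1⟩, rfl⟩
    exact h _ _ _ (hw 0) (hw 1) (hw 2) (by simpa [Fin.sum_univ_three] using hw1)
  obtain ⟨δ, hδ, hsub'⟩ := hK.exists_thickening_subset_open (isOpen_coord_compl hF) hsub
  refine ⟨δ, hδ, fun a' b' c' ha hb hc s t u hs ht hu h0 => ?_⟩
  have hp : 0 < s + t + u := by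
    by_contra hn
    have h1 : s = 0 := by linarith
    have h2 : t = 0 := by linarith
    have h3 : u = 0 := by linarith
    simp [h1, h2, h3] at h0
  set r := (s + t + u)⁻¹ with hr
  have hr0 : 0 < r := inv_pos.2 hp
  have hr1 : r * s + r * t + r * u = 1 := by rw [hr]; field_simp
  rw [← pt_smul hr0.ne']
  refine (hsub' (Metric.mem_thickening_iff.2
    ⟨(r * s) • a + (r * t) • b + (r * u) • c, ⟨![r * s, r * t, r * u], ⟨?_, ?_⟩, ?_⟩, ?_⟩)).2
  · intro i
    fin_cases i <;> simp <;> positivity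
  · simpa [Fin.sum_univ_three] using hr1
  · simp
  · rw [dist_eq_norm] at ha hb hc ⊢
    have e : r • (s • a' + t • b' + u • c') - ((r * s) • a + (r * t) • b + (r * u) • c) =
      (r * s) • (a' - a) + (r * t) • (b' - b) + (r * u) • (c' - c) := by module
    rw [e]
    have n1 : ‖(r * s) • (a' - a) + (r * t) • (b' - b) + (r * u) • (c' - c)‖ ≤
        (r * s) * ‖a' - a‖ + (r * t) * ‖b' - b‖ + (r * u) * ‖c' - c‖ := by
      refine (norm_add₃_le).trans_eq ?_
      simp only [norm_smul, Real.norm_eq_abs, abs_of_nonneg (mul_nonneg hr0.le hs),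
        abs_of_nonneg (mul_nonneg hr0.le ht), abs_of_nonneg (mul_nonneg hr0.le hu)]
    set m := max ‖a' - a‖ (max ‖b' - b‖ ‖c' - c‖)
    have hm : m < δ := max_lt ha (max_lt hb hc)
    have m1 : ‖a' - a‖ ≤ m := le_max_left _ _
    have m2 : ‖b' - b‖ ≤ m := (le_max_left _ _).trans (le_max_right _ _)
    have m3 : ‖c' - c‖ ≤ m := (le_max_right _ _).trans (le_max_right _ _)
    have : (r * s) * ‖a' - a‖ + (r * t) * ‖b' - b‖ + (r * u) * ‖c' - c‖ ≤ m := by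
      calc _ ≤ (r * s) * m + (r * t) * m + (r * u) * m := by gcongr
        _ = (r * s + r * t + r * u) * m := by ring
        _ = m := by rw [hr1, one_mul]
    linarith

/-! ### Polygonal arcs -/

/-- Polygonal arcs from `p` to `q` with underlying set `A`, generated by attaching segments. -/
inductive PolyArc (p : RP2) : RP2 → Set RP2 → Prop
  | single (x y : Vec) (h : Indep2 x y) (hp : p = pt x) : PolyArc p (pt y) (seg x y)
  | snoc (x y : Vec) (A : Set RP2) (h : Indep2 x y) (hA : PolyArc p (pt x) A)
      (hi : A ∩ seg x y ⊆ {pt x}) : PolyArc p (pt y) (A ∪ seg x y)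

namespace PolyArc
variable {p q r : RP2} {A B : Set RP2}

lemma start_mem (h : PolyArc p q A) : p ∈ A := by
  induction h with
  | single x y h hp => exact hp ▸ left_mem_seg h.left_ne_zero
  | snoc x y A h hA hi ih => exact Or.inl ih

lemma end_mem (h : PolyArc p q A) : q ∈ A := by
  cases h with
  | single x y h hp => exact right_mem_seg h.right_ne_zero
  | snoc x y A h hA hi => exact Or.inr (right_mem_seg h.right_ne_zero)

lemma ne (h : PolyArc p q A) : p ≠ q := by
  cases h with
  | single x y h hp => exact hp ▸ h.pt_ne
  | snoc x y A h hA hi =>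
    rintro rfl
    exact h.pt_ne (hi ⟨hA.start_mem, right_mem_seg h.right_ne_zero⟩).symm

lemma isClosed (h : PolyArc p q A) : IsClosed A := by
  induction h with
  | single x y h hp => exact isClosed_seg h
  | snoc x y A h hA hi ih => exact ih.union (isClosed_seg h)

lemma exists_first (h : PolyArc p q A) : ∃ x y F, Indep2 x y ∧ p = pt x ∧ IsClosed F ∧ p ∉ F ∧
    A = seg x y ∪ F := by
  induction h with
  | single x y h hp => exact ⟨x, y, ∅, h, hp, isClosed_empty, by simp, by simp⟩
  | snoc x y A h hA hi ih =>
    obtain ⟨x', y', F, h', hp, hF, hpF, rfl⟩ := ih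
    refine ⟨x', y', F ∪ seg x y, h', hp, hF.union (isClosed_seg h), ?_, union_assoc _ _ _⟩
    rintro (hh | hh)
    · exact hpF hh
    · exact hA.ne (hi ⟨hA.start_mem, hh⟩)

lemma exists_last (h : PolyArc p q A) : ∃ x y F, Indep2 x y ∧ q = pt y ∧ IsClosed F ∧ q ∉ F ∧
    A = F ∪ seg x y := by
  cases h with
  | single x y h hp => exact ⟨x, y, ∅, h, rfl, isClosed_empty, by simp, by simp⟩
  | snoc x y A h hA hi =>
    exact ⟨x, y, A, h, rfl, hA.isClosed, fun hh =>
      h.pt_ne (hi ⟨hh, right_mem_seg h.right_ne_zero⟩).symm, rfl⟩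

lemma glue (hA : PolyArc p q A) (hB : PolyArc q r B) (hi : A ∩ B ⊆ {q}) :
    PolyArc p r (A ∪ B) := by
  induction hB with
  | single x y h hp =>
    subst hp
    exact snoc x y A h hA hi
  | snoc x y B h hB hi' ih =>
    rw [← union_assoc]
    refine snoc x y _ h (ih fun P hP => hi ⟨hP.1, Or.inl hP.2⟩) ?_
    rintro P ⟨hP | hP, hP'⟩
    · have hPq : P = q := hi ⟨hP, Or.inr hP'⟩
      exact hi' ⟨hPq ▸ hB.start_mem, hP'⟩
    · exact hi' ⟨hP, hP'⟩

end PolyArc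

lemma polygonalCurve_eq (x : ℕ → Fin 3 → ℝ) (k : ℕ) {t : ℝ} (h1 : (k : ℝ) ≤ t)
    (h2 : t ≤ (k + 1 : ℕ)) :
    polygonalCurve x t = (1 - (t - k)) • x k + (t - k) • x (k + 1) := by
  rcases h2.eq_or_lt with rfl | h2
  · have e : Int.fract (((k + 1 : ℕ) : ℝ)) = 0 := Int.fract_natCast _
    have e' : ⌊((k + 1 : ℕ) : ℝ)⌋₊ = k + 1 := Nat.floor_natCast _
    rw [polygonalCurve, e, e', AffineMap.lineMap_apply_zero]
    push_cast
    simp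
  · have e' : ⌊t⌋₊ = k := (Nat.floor_eq_iff (k.cast_nonneg.trans h1)).2 ⟨h1, by
      push_cast at h2; exact h2⟩
    have e : Int.fract t = t - k := by
      rw [← e', Int.fract, natCast_floor_eq_intCast_floor (k.cast_nonneg.trans h1)]
    rw [polygonalCurve, e, e', AffineMap.lineMap_apply_module]

lemma polygonalCurve_natCast (x : ℕ → Fin 3 → ℝ) (k : ℕ) : polygonalCurve x k = x k := by
  rw [polygonalCurve_eq x k le_rfl (by simp)]
  simp

lemma polygonalCurve_congr {x y : ℕ → Fin 3 → ℝ} {n : ℕ} (h : ∀ k ≤ n, x k = y k) {t : ℝ}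
    (ht : t ∈ Icc (0 : ℝ) n) : polygonalCurve x t = polygonalCurve y t := by
  rcases ht.2.eq_or_lt with rfl | h2
  · rw [polygonalCurve_natCast, polygonalCurve_natCast, h n le_rfl]
  · have hk : ⌊t⌋₊ < n := (Nat.floor_lt ht.1).2 h2
    rw [polygonalCurve, polygonalCurve, h _ hk.le, h _ hk]

lemma polygonalCurve_image_piece (x : ℕ → Fin 3 → ℝ) (k : ℕ) (h : Indep2 (x k) (x (k + 1))) :
    (fun t => pt (polygonalCurve x t)) '' Icc (k : ℝ) ((k + 1 : ℕ) : ℝ) =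
      seg (x k) (x (k + 1)) := by
  rw [seg_eq_image h]
  ext P
  constructor
  · rintro ⟨t, ⟨h1, h2⟩, rfl⟩
    refine ⟨t - k, ⟨by linarith, ?_⟩, ?_⟩
    · push_cast at h2; linarith
    · simp only [polygonalCurve_eq x k h1 h2]
  · rintro ⟨t, ⟨h1, h2⟩, rfl⟩
    refine ⟨t + k, ⟨by linarith, by push_cast; linarith⟩, ?_⟩
    simp only [polygonalCurve_eq x k (t := t + k) (by linarith) (by push_cast; linarith),
      add_sub_cancel_right]

lemma polyArc_of_polygonalCurve (x : ℕ → Fin 3 → ℝ) (n : ℕ)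
    (h0 : ∀ t ∈ Icc (0 : ℝ) ((n + 1 : ℕ) : ℝ), polygonalCurve x t ≠ 0)
    (hinj : InjOn (fun t => pt (polygonalCurve x t)) (Icc (0 : ℝ) ((n + 1 : ℕ) : ℝ))) :
    PolyArc (pt (x 0)) (pt (x (n + 1)))
      ((fun t => pt (polygonalCurve x t)) '' Icc (0 : ℝ) ((n + 1 : ℕ) : ℝ)) := by
  have hind : ∀ m : ℕ, (∀ t ∈ Icc (0 : ℝ) ((m + 1 : ℕ) : ℝ), polygonalCurve x t ≠ 0) →
      InjOn (fun t => pt (polygonalCurve x t)) (Icc (0 : ℝ) ((m + 1 : ℕ) : ℝ)) →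
      Indep2 (x m) (x (m + 1)) := by
    intro m h0 hinj
    have m1 : (m : ℝ) ∈ Icc (0 : ℝ) ((m + 1 : ℕ) : ℝ) := ⟨m.cast_nonneg, by simp⟩
    have m2 : ((m + 1 : ℕ) : ℝ) ∈ Icc (0 : ℝ) ((m + 1 : ℕ) : ℝ) := ⟨by positivity, le_rfl⟩
    have e1 := polygonalCurve_natCast x m
    have e2 := polygonalCurve_natCast x (m + 1)
    refine Indep2.of_pt_ne (e1 ▸ h0 _ m1) (e2 ▸ h0 _ m2) fun e => ?_
    have := hinj m1 m2 (by simp only [e1, e2]; exact e)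
    simp at this
  induction n with
  | zero =>
    have := polygonalCurve_image_piece x 0 (hind 0 h0 hinj)
    simp only [Nat.cast_zero] at this
    rw [this]
    exact .single _ _ (hind 0 h0 hinj) rfl
  | succ n ih =>
    have hle : ((n + 1 : ℕ) : ℝ) ≤ ((n + 1 + 1 : ℕ) : ℝ) := by push_cast; linarith
    have hsub : Icc (0 : ℝ) ((n + 1 : ℕ) : ℝ) ⊆ Icc (0 : ℝ) ((n + 1 + 1 : ℕ) : ℝ) :=
      Icc_subset_Icc_right hle
    have hsub' : Icc ((n + 1 : ℕ) : ℝ) ((n + 1 + 1 : ℕ) : ℝ) ⊆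
        Icc (0 : ℝ) ((n + 1 + 1 : ℕ) : ℝ) := Icc_subset_Icc_left (by positivity)
    have hu := Icc_union_Icc_eq_Icc (a := (0 : ℝ)) (by positivity) hle
    rw [← hu, image_union, polygonalCurve_image_piece x (n + 1) (hind _ h0 hinj)]
    refine .snoc _ _ _ (hind _ h0 hinj)
      (ih (fun t ht => h0 t (hsub ht)) (hinj.mono hsub)) ?_
    rw [← polygonalCurve_image_piece x (n + 1) (hind _ h0 hinj)]
    rintro P ⟨⟨s, hs, rfl⟩, ⟨t, ht, e⟩⟩
    have := hinj (hsub' ht) (hsub hs) e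
    subst this
    have : t = ((n + 1 : ℕ) : ℝ) := le_antisymm hs.2 ht.1
    rw [this, mem_singleton_iff]
    simp only [polygonalCurve_natCast]

lemma PolyArc.exists_polygonalCurve {p q : RP2} {A : Set RP2} (h : PolyArc p q A) :
    ∃ (n : ℕ) (x : ℕ → Fin 3 → ℝ), (∀ t ∈ Icc (0 : ℝ) n, polygonalCurve x t ≠ 0) ∧
      InjOn (fun t => pt (polygonalCurve x t)) (Icc (0 : ℝ) n) ∧
      (fun t => pt (polygonalCurve x t)) '' Icc (0 : ℝ) n = A ∧ pt (x 0) = p ∧ pt (x n) = q := by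
  induction h with
  | single x y h hp =>
    set X : ℕ → Fin 3 → ℝ := fun k => if k = 0 then x else y with hX
    have him := polygonalCurve_image_piece X 0 (by simpa [hX] using h)
    have hval : ∀ t ∈ Icc (0 : ℝ) (1 : ℕ), polygonalCurve X t = (1 - t) • x + t • y := by
      intro t ht
      rw [polygonalCurve_eq X 0 (by simpa using ht.1) (by simpa using ht.2)]
      simp [hX]
    have hne : ∀ t : ℝ, (1 - t) • x + t • y ≠ 0 := fun t e => by
      have := h _ _ e
      linarith [this.1, this.2]
    refine ⟨1, X, ?_, ?_, ?_, ?_, ?_⟩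
    · intro t ht
      rw [hval t ht]
      exact hne t
    · intro t ht t' ht' e
      simp only [hval t ht, hval t' ht'] at e
      obtain ⟨a, ha, e⟩ := (pt_eq_pt_iff (hne _) (hne _)).1 e
      have := h.eq_of_eq (s := 1 - t) (t := t) (s' := a * (1 - t')) (t' := a * t')
        (by rw [e]; module)
      have ha1 : a = 1 := by linarith [this.1, this.2]
      rw [this.2, ha1, one_mul]
    · simpa [hX] using him
    · simpa [hX] using hp.symm
    · simp [hX]
  | snoc x y A h hA hi ih =>
    obtain ⟨n, X, h0, hinj, him, hp, hq⟩ := ih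
    have hXn : X n ≠ 0 := by
      have := h0 n ⟨n.cast_nonneg, le_rfl⟩
      rwa [polygonalCurve_natCast] at this
    obtain ⟨a, ha, hxa⟩ := (pt_eq_pt_iff hXn h.left_ne_zero).1 hq
    set Y : ℕ → Fin 3 → ℝ := fun k => if k ≤ n then X k else a • y with hY
    have hYX : ∀ t ∈ Icc (0 : ℝ) n, polygonalCurve Y t = polygonalCurve X t := fun t ht =>
      polygonalCurve_congr (fun k hk => by simp [hY, hk]) ht
    have hYn : Y n = a • x := by simp [hY, hxa]
    have hYn1 : Y (n + 1) = a • y := by simp [hY]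
    have hind : Indep2 (Y n) (Y (n + 1)) := by
      rw [hYn, hYn1]
      intro s t e
      have := h (s * a) (t * a) (by rw [← e]; module)
      simpa [ha] using this
    have hpc := polygonalCurve_image_piece Y n hind
    rw [hYn, hYn1, seg_smul_same ha] at hpc
    have hval : ∀ t ∈ Icc (n : ℝ) ((n + 1 : ℕ) : ℝ), polygonalCurve Y t =
        (1 - (t - n)) • Y n + (t - n) • Y (n + 1) := fun t ht => polygonalCurve_eq Y n ht.1 ht.2
    have hne : ∀ t : ℝ, (1 - (t - n)) • Y n + (t - n) • Y (n + 1) ≠ 0 := fun t e => by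
      have := hind _ _ e
      linarith [this.1, this.2]
    have hle : (n : ℝ) ≤ ((n + 1 : ℕ) : ℝ) := by push_cast; linarith
    have hu := Icc_union_Icc_eq_Icc (a := (0 : ℝ)) n.cast_nonneg hle
    have hinj2 : InjOn (fun t => pt (polygonalCurve Y t)) (Icc (n : ℝ) ((n + 1 : ℕ) : ℝ)) := by
      intro t ht t' ht' e
      simp only [hval t ht, hval t' ht'] at e
      obtain ⟨c, hc, e⟩ := (pt_eq_pt_iff (hne _) (hne _)).1 e
      have := hind.eq_of_eq (s := 1 - (t - n)) (t := t - n) (s' := c * (1 - (t' - n)))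
        (t' := c * (t' - n)) (by rw [e]; module)
      have hc1 : c = 1 := by linarith [this.1, this.2]
      have := this.2
      rw [hc1] at this
      linarith
    have hinj1 : InjOn (fun t => pt (polygonalCurve Y t)) (Icc (0 : ℝ) n) := by
      intro t ht t' ht' e
      simp only [hYX t ht, hYX t' ht'] at e
      exact hinj ht ht' e
    have him1 : (fun t => pt (polygonalCurve Y t)) '' Icc (0 : ℝ) n = A := by
      rw [← him]
      exact image_congr fun t ht => by simp only [hYX t ht]
    -- a common point of the two pieces is the corner where they meet
    have hmix : ∀ t ∈ Icc (0 : ℝ) n, ∀ t' ∈ Icc (n : ℝ) ((n + 1 : ℕ) : ℝ),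
        pt (polygonalCurve Y t) = pt (polygonalCurve Y t') → t = t' := by
      intro t ht t' ht' e
      have m1 : pt (polygonalCurve Y t) ∈ A := him1 ▸ mem_image_of_mem _ ht
      have m2 : pt (polygonalCurve Y t) ∈ seg x y := by
        rw [e, ← hpc]
        exact mem_image_of_mem (fun t => pt (polygonalCurve Y t)) ht'
      have m3 : pt (polygonalCurve Y t) = pt (polygonalCurve Y n) := by
        rw [polygonalCurve_natCast, hYn, pt_smul ha]
        exact hi ⟨m1, m2⟩
      have e1 : t = n := hinj1 ht ⟨n.cast_nonneg, le_rfl⟩ m3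
      have e2 : t' = n := hinj2 ht' ⟨le_rfl, hle⟩ (e.symm.trans m3)
      rw [e1, e2]
    refine ⟨n + 1, Y, ?_, ?_, ?_, ?_, ?_⟩
    · rw [← hu]
      rintro t (ht | ht)
      · rw [hYX t ht]; exact h0 t ht
      · rw [hval t ht]; exact hne t
    · rw [← hu]
      rintro t (ht | ht) t' (ht' | ht') e
      · exact hinj1 ht ht' e
      · exact hmix t ht t' ht' e
      · exact (hmix t' ht' t ht e.symm).symm
      · exact hinj2 ht ht' e
    · rw [← hu, image_union, him1, hpc]
    · simpa [hY] using hp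
    · rw [hYn1, pt_smul ha]

/-- Arcs with distinct ends are the same as arcs generated by attaching segments; the latter allow
induction. -/
lemma isPLArc_iff_polyArc {p q : RP2} {A : Set RP2} (hpq : p ≠ q) :
    IsPLArc p q A ↔ PolyArc p q A := by
  constructor
  · rintro ⟨n, x, hx, γ, hγ, hinj, rfl, rfl, rfl⟩
    have hγ' : ∀ t, γ t = pt (polygonalCurve x t) := fun t => by rw [hγ, pt_eq_mk (hx t)]
    rcases n with _ | n
    · exact absurd (congrArg γ (Subtype.ext (by simp))) hpq
    · have h := polyArc_of_polygonalCurve x n (fun t ht => hx ⟨t, ht⟩) (by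
        intro t ht t' ht' e
        have := @hinj ⟨t, ht⟩ ⟨t', ht'⟩ (by rw [hγ', hγ']; exact e)
        exact congrArg Subtype.val this)
      convert h using 1
      · rw [hγ']
        have := polygonalCurve_natCast x 0
        simp only [Nat.cast_zero] at this
        rw [this]
      · rw [hγ', polygonalCurve_natCast]
      · ext P
        constructor
        · rintro ⟨t, rfl⟩
          exact ⟨t, t.2, (hγ' t).symm⟩
        · rintro ⟨t, ht, rfl⟩
          exact ⟨⟨t, ht⟩, hγ' _⟩
  · intro h
    obtain ⟨n, x, h0, hinj, rfl, rfl, rfl⟩ := h.exists_polygonalCurve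
    refine ⟨n, x, fun t => h0 t t.2, fun t => pt (polygonalCurve x t),
      fun t => pt_eq_mk _, fun t t' e => Subtype.ext (hinj t.2 t'.2 e), ?_, ?_, ?_⟩
    · ext P
      constructor
      · rintro ⟨t, rfl⟩
        exact ⟨t, t.2, rfl⟩
      · rintro ⟨t, ht, rfl⟩
        exact ⟨⟨t, ht⟩, rfl⟩
    · have := polygonalCurve_natCast x 0
      simp only [Nat.cast_zero] at this
      simp only [this]
    · simp only [polygonalCurve_natCast]

lemma seg_split {x y : Vec} {s t : ℝ} (hs : 0 < s) (ht : 0 < t) :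
    seg x y = seg x (s • x + t • y) ∪ seg (s • x + t • y) y := by
  apply Subset.antisymm
  · rintro P ⟨v, ⟨a, b, ha, hb, rfl⟩, hv, rfl⟩
    rcases le_total (b * s) (a * t) with h | h
    · refine Or.inl ⟨_, ⟨a - b * s / t, b / t, ?_, by positivity, ?_⟩, hv, rfl⟩
      · rw [sub_nonneg, div_le_iff₀ ht]; exact h
      · have : b = b / t * t := by field_simp
        have e : b * s / t = b / t * s := by ring
        rw [e]
        nth_rw 1 [this]
        module
    · refine Or.inr ⟨_, ⟨a / s, b - a * t / s, by positivity, ?_, ?_⟩, hv, rfl⟩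
      · rw [sub_nonneg, div_le_iff₀ hs]; exact h
      · have : a = a / s * s := by field_simp
        have e : a * t / s = a / s * t := by ring
        rw [e]
        nth_rw 1 [this]
        module
  · rintro P (⟨v, ⟨a, b, ha, hb, rfl⟩, hv, rfl⟩ | ⟨v, ⟨a, b, ha, hb, rfl⟩, hv, rfl⟩)
    · exact ⟨_, ⟨a + b * s, b * t, by positivity, by positivity, by module⟩, hv, rfl⟩
    · exact ⟨_, ⟨a * s, b + a * t, by positivity, by positivity, by module⟩, hv, rfl⟩

lemma Indep2.combo_right {x y : Vec} (h : Indep2 x y) {s t : ℝ} (ht : t ≠ 0) :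
    Indep2 x (s • x + t • y) := by
  intro a b e
  have := h (a + b * s) (b * t) (by rw [← e]; module)
  have hb : b = 0 := by simpa [ht] using this.2
  subst hb
  simpa using this.1

lemma Indep2.combo_left {x y : Vec} (h : Indep2 x y) {s t : ℝ} (hs : s ≠ 0) :
    Indep2 (s • x + t • y) y := by
  have := (h.symm.combo_right (s := t) (t := s) hs).symm
  rwa [add_comm] at this

lemma seg_split_inter {x y : Vec} (h : Indep2 x y) {s t : ℝ} (hs : 0 < s) (ht : 0 < t) :
    seg x (s • x + t • y) ∩ seg (s • x + t • y) y ⊆ {pt (s • x + t • y)} := by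
  rintro P ⟨⟨v, ⟨a, b, ha, hb, rfl⟩, hv, rfl⟩, ⟨w, ⟨a', b', ha', hb', rfl⟩, hw, e⟩⟩
  obtain ⟨r, hr, e⟩ := (pt_eq_pt_iff hv hw).1 e
  obtain ⟨e1, e2⟩ := h.eq_of_eq (s := a + b * s) (t := b * t) (s' := r * (a' * s))
    (t' := r * (a' * t + b')) (by
      have : (a + b * s) • x + (b * t) • y = a • x + b • (s • x + t • y) := by module
      rw [this, e]; module)
  have hb0 : 0 < b ∨ b = 0 := by rcases hb.eq_or_lt with h | h <;> simp [h]
  have ha0 : a = 0 := by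
    by_contra hne
    have hapos : 0 < a := lt_of_le_of_ne ha (Ne.symm hne)
    have h1 : 0 < r * (a' * s) := by rw [← e1]; positivity
    have hrpos : 0 < r := by
      by_contra hn
      have : r * (a' * s) ≤ 0 := mul_nonpos_of_nonpos_of_nonneg (not_lt.1 hn) (by positivity)
      linarith
    have h2 : b * t * s = r * (a' * s) * t + r * b' * s := by rw [e2]; ring
    rw [← e1] at h2
    nlinarith [mul_nonneg (mul_nonneg hrpos.le hb') hs.le, mul_pos hapos ht]
  subst ha0
  have hbne : b ≠ 0 := by rintro rfl; simp at hv
  rw [zero_smul, zero_add, pt_smul hbne]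
  rfl

/-! ### Piecewise linear homeomorphisms -/

/-- The homeomorphism maps polygonal arcs onto polygonal arcs. -/
def PreservesPolyArcs (h : RP2 ≃ₜ RP2) : Prop :=
  ∀ p q A, PolyArc p q A → PolyArc (h p) (h q) (h '' A)

/-- The homeomorphism and its inverse map polygonal arcs onto polygonal arcs. -/
def IsPL (h : RP2 ≃ₜ RP2) : Prop := PreservesPolyArcs h ∧ PreservesPolyArcs h.symm

lemma IsPL.refl : IsPL (Homeomorph.refl RP2) := by
  constructor <;> intro p q A h <;> simpa using h

lemma IsPL.symm {h : RP2 ≃ₜ RP2} (hh : IsPL h) : IsPL h.symm := ⟨hh.2, hh.1⟩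

lemma IsPL.trans {g h : RP2 ≃ₜ RP2} (hg : IsPL g) (hh : IsPL h) : IsPL (g.trans h) := by
  constructor
  · intro p q A hA
    have := hh.1 _ _ _ (hg.1 _ _ _ hA)
    rwa [image_image] at this
  · intro p q A hA
    have := hg.2 _ _ _ (hh.2 _ _ _ hA)
    rwa [image_image] at this

/-- It suffices to check segments, since injectivity lets the images of the pieces be glued. -/
lemma preservesPolyArcs_of_seg {h : RP2 ≃ₜ RP2}
    (hs : ∀ x y, Indep2 x y → PolyArc (h (pt x)) (h (pt y)) (h '' seg x y)) :
    PreservesPolyArcs h := by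
  intro p q A hA
  induction hA with
  | single x y h hp => exact hp ▸ hs x y h
  | snoc x y A h hA hi ih =>
    rw [image_union]
    refine ih.glue (hs x y h) ?_
    rw [← image_inter (Homeomorph.injective _)]
    rintro _ ⟨P, hP, rfl⟩
    rw [hi hP]
    rfl

lemma pt_apply_rep {H : Vec → Vec} (sH : ∀ (c : ℝ) v, H (c • v) = c • H v) {v : Vec}
    (hv : v ≠ 0) : pt (H (Projectivization.rep (pt v))) = pt (H v) := by
  have h1 : pt (Projectivization.rep (pt v)) = pt v := by
    rw [pt_eq_mk (Projectivization.rep_nonzero _), Projectivization.mk_rep]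
  obtain ⟨a, ha, e⟩ := (pt_eq_pt_iff (Projectivization.rep_nonzero _) hv).1 h1
  rw [e, sH, pt_smul ha]

/-- The homeomorphism of the projective plane that is induced by a homogeneous homeomorphism
of `ℝ³`. -/
noncomputable def liftHomeo (H G : Vec → Vec) (hH : Continuous H) (hG : Continuous G)
    (sH : ∀ (c : ℝ) v, H (c • v) = c • H v) (sG : ∀ (c : ℝ) v, G (c • v) = c • G v)
    (hGH : ∀ v, G (H v) = v) (hHG : ∀ v, H (G v) = v) : RP2 ≃ₜ RP2 :=
  have zero : ∀ (H : Vec → Vec), (∀ (c : ℝ) v, H (c • v) = c • H v) → H 0 = 0 := fun H sH => by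
    simpa using sH 0 0
  have ne : ∀ (H G : Vec → Vec), (∀ (c : ℝ) v, G (c • v) = c • G v) → (∀ v, G (H v) = v) →
      ∀ v, v ≠ 0 → H v ≠ 0 := fun H G sG hGH v hv e => hv (by rw [← hGH v, e, zero G sG])
  have cont : ∀ (H G : Vec → Vec), Continuous H → (∀ (c : ℝ) v, H (c • v) = c • H v) →
      (∀ (c : ℝ) v, G (c • v) = c • G v) → (∀ v, G (H v) = v) →
      Continuous fun P : RP2 => pt (H P.rep) := fun H G hH sH sG hGH => by
    refine continuous_coinduced_dom.2 ?_
    have h1 : Continuous fun v : {v : Vec // v ≠ 0} =>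
        (⟨H v, ne H G sG hGH v v.2⟩ : {v : Vec // v ≠ 0}) :=
      (hH.comp continuous_subtype_val).subtype_mk _
    have h2 : Continuous (fun v : {v : Vec // v ≠ 0} => Projectivization.mk ℝ v.1 v.2) :=
      continuous_coinduced_rng
    convert h2.comp h1 using 1
    ext v
    simp only [Function.comp]
    rw [← pt_eq_mk v.2, pt_apply_rep sH v.2, pt_eq_mk]
  { toFun := fun P => pt (H P.rep)
    invFun := fun P => pt (G P.rep)
    left_inv := fun P => by
      obtain ⟨v, hv, rfl⟩ := exists_eq_pt P
      beta_reduce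
      rw [pt_apply_rep sH hv, pt_apply_rep sG (ne H G sG hGH v hv), hGH]
    right_inv := fun P => by
      obtain ⟨v, hv, rfl⟩ := exists_eq_pt P
      beta_reduce
      rw [pt_apply_rep sG hv, pt_apply_rep sH (ne G H sH hHG v hv), hHG]
    continuous_toFun := cont H G hH sH sG hGH
    continuous_invFun := cont G H hG sG sH hHG }

lemma liftHomeo_pt {H G : Vec → Vec} (hH : Continuous H) (hG : Continuous G)
    (sH : ∀ (c : ℝ) v, H (c • v) = c • H v) (sG : ∀ (c : ℝ) v, G (c • v) = c • G v)
    (hGH : ∀ v, G (H v) = v) (hHG : ∀ v, H (G v) = v) {v : Vec} (hv : v ≠ 0) :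
    liftHomeo H G hH hG sH sG hGH hHG (pt v) = pt (H v) :=
  pt_apply_rep sH hv

/-- A homeomorphism with a lift that is linear on every cone over a segment none of whose points
is separated from another one by finitely many given planes preserves polygonal arcs: every
segment is cut by these planes into pieces that are mapped onto segments. -/
lemma preservesPolyArcs_of_lift {h : RP2 ≃ₜ RP2} {H : Vec → Vec} (hne : ∀ v, v ≠ 0 → H v ≠ 0)
    (hpt : ∀ v, v ≠ 0 → h (pt v) = pt (H v)) (Φ : List (Vec →ₗ[ℝ] ℝ))
    (hlin : ∀ x y, (∀ φ ∈ Φ, 0 ≤ φ x * φ y) → ∀ s t : ℝ, 0 ≤ s → 0 ≤ t →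
      H (s • x + t • y) = s • H x + t • H y) : PreservesPolyArcs h := by
  refine preservesPolyArcs_of_seg ?_
  suffices key : ∀ Ψ : List (Vec →ₗ[ℝ] ℝ), ∀ x y, Indep2 x y →
      (∀ φ ∈ Φ, φ ∉ Ψ → 0 ≤ φ x * φ y) → PolyArc (h (pt x)) (h (pt y)) (h '' seg x y) from
    fun x y hxy => key Φ x y hxy fun φ h1 h2 => absurd h1 h2
  intro Ψ
  induction Ψ with
  | nil =>
    intro x y hxy hΦ
    have hl := hlin x y fun φ hφ => hΦ φ hφ (by simp)
    have e : h '' seg x y = seg (H x) (H y) := by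
      apply Subset.antisymm
      · rintro _ ⟨P, ⟨v, ⟨s, t, hs, ht, rfl⟩, hv, rfl⟩, rfl⟩
        rw [hpt _ hv, hl s t hs ht]
        exact pt_mem_seg hs ht (hl s t hs ht ▸ hne _ hv)
      · rintro P ⟨v, ⟨s, t, hs, ht, rfl⟩, hv, rfl⟩
        rw [← hl s t hs ht] at hv ⊢
        have hv0 : s • x + t • y ≠ 0 := by
          refine hxy.ne_zero ?_
          by_contra! hst
          rw [hl s t hs ht] at hv
          simp [hst.1, hst.2] at hv
        rw [← hpt _ hv0]
        exact mem_image_of_mem _ (pt_mem_seg hs ht hv0)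
    rw [e, hpt _ hxy.left_ne_zero, hpt _ hxy.right_ne_zero]
    refine .single _ _ (Indep2.of_pt_ne (hne _ hxy.left_ne_zero) (hne _ hxy.right_ne_zero) ?_) rfl
    rw [← hpt _ hxy.left_ne_zero, ← hpt _ hxy.right_ne_zero]
    exact fun e => hxy.pt_ne (h.injective e)
  | cons φ Ψ ih =>
    intro x y hxy hΦ
    by_cases hφ : 0 ≤ φ x * φ y
    · refine ih x y hxy fun ψ h1 h2 => ?_
      by_cases e : ψ = φ
      · exact e ▸ hφ
      · exact hΦ ψ h1 (by simp [e, h2])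
    · obtain ⟨s, t, hs, ht, hz⟩ : ∃ s t : ℝ, 0 < s ∧ 0 < t ∧ φ (s • x + t • y) = 0 := by
        rw [not_le] at hφ
        rcases lt_trichotomy (φ x) 0 with hx | hx | hx
        · exact ⟨φ y, -φ x, by nlinarith, by linarith, by simp; ring⟩
        · rw [hx, zero_mul] at hφ; exact absurd hφ (lt_irrefl _)
        · exact ⟨-φ y, φ x, by nlinarith, by linarith, by simp; ring⟩
      have hind1 := hxy.combo_right (s := s) ht.ne'
      have hind2 := hxy.combo_left (t := t) hs.ne'
      rw [seg_split hs ht, image_union]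
      refine (ih _ _ hind1 fun ψ h1 h2 => ?_).glue (ih _ _ hind2 fun ψ h1 h2 => ?_) ?_
      · by_cases e : ψ = φ
        · rw [e, hz, mul_zero]
        · have := hΦ ψ h1 (by simp [e, h2])
          simp only [map_add, map_smul, smul_eq_mul]
          nlinarith [mul_nonneg hs.le (mul_self_nonneg (ψ x)), mul_nonneg ht.le this]
      · by_cases e : ψ = φ
        · rw [e, hz, zero_mul]
        · have := hΦ ψ h1 (by simp [e, h2])
          simp only [map_add, map_smul, smul_eq_mul]
          nlinarith [mul_nonneg ht.le (mul_self_nonneg (ψ y)), mul_nonneg hs.le this]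
      · rw [← image_inter h.injective]
        rintro _ ⟨P, hP, rfl⟩
        rw [seg_split_inter hxy hs ht hP]
        rfl

/-! ### Moving an interior point of a triangle -/

/-- The tent function over the coordinate triangle with apex `p`, extended to an odd homogeneous
function: it vanishes off the positive and the negative octant. -/
noncomputable def tent (p x : Fin 3 → ℝ) : ℝ :=
  max 0 (min (x 0 / p 0) (min (x 1 / p 1) (x 2 / p 2))) +
    min 0 (max (x 0 / p 0) (max (x 1 / p 1) (x 2 / p 2)))

lemma tent_neg (p x : Fin 3 → ℝ) : tent p (-x) = -tent p x := by
  have h1 : ∀ a b c : ℝ, min (-a) (min (-b) (-c)) = -max a (max b c) := fun a b c => by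
    simp only [min_neg_neg]
  have h2 : ∀ a b c : ℝ, max (-a) (max (-b) (-c)) = -min a (min b c) := fun a b c => by
    simp only [max_neg_neg]
  simp only [tent, Pi.neg_apply, neg_div, h1, h2]
  rw [← neg_zero (G := ℝ), max_neg_neg, min_neg_neg, neg_zero]
  ring

lemma tent_eq_of_le {p x : Fin 3 → ℝ} (hp : ∀ i, 0 < p i) {τ : ℝ} (hτ : 0 ≤ τ)
    (h : ∀ i, τ * p i ≤ x i) {i : Fin 3} (hi : x i = τ * p i) : tent p x = τ := by
  have h' : ∀ i, τ ≤ x i / p i := fun i => (le_div_iff₀ (hp i)).2 (h i)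
  have hi' : x i / p i = τ := by rw [hi, mul_div_cancel_right₀ _ (hp i).ne']
  have h3 : min (x 0 / p 0) (min (x 1 / p 1) (x 2 / p 2)) = τ := by
    apply le_antisymm
    · fin_cases i
      · exact (min_le_left _ _).trans hi'.le
      · exact (min_le_right _ _).trans ((min_le_left _ _).trans hi'.le)
      · exact (min_le_right _ _).trans ((min_le_right _ _).trans hi'.le)
    · exact le_min (h' 0) (le_min (h' 1) (h' 2))
  have h4 : 0 ≤ max (x 0 / p 0) (max (x 1 / p 1) (x 2 / p 2)) :=
    hτ.trans ((h' 0).trans (le_max_left _ _))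
  rw [tent, h3, max_eq_right hτ, min_eq_left h4, add_zero]

lemma tent_eq_zero {p x : Fin 3 → ℝ} (hp : ∀ i, 0 < p i) {i j : Fin 3} (hi : x i ≤ 0)
    (hj : 0 ≤ x j) : tent p x = 0 := by
  have hi' : x i / p i ≤ 0 := div_nonpos_of_nonpos_of_nonneg hi (hp i).le
  have hj' : 0 ≤ x j / p j := div_nonneg hj (hp j).le
  have h1 : min (x 0 / p 0) (min (x 1 / p 1) (x 2 / p 2)) ≤ 0 := by
    fin_cases i
    · exact (min_le_left _ _).trans hi'
    · exact (min_le_right _ _).trans ((min_le_left _ _).trans hi')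
    · exact (min_le_right _ _).trans ((min_le_right _ _).trans hi')
  have h2 : 0 ≤ max (x 0 / p 0) (max (x 1 / p 1) (x 2 / p 2)) := by
    fin_cases j
    · exact hj'.trans (le_max_left _ _)
    · exact hj'.trans ((le_max_left _ _).trans (le_max_right _ _))
    · exact hj'.trans ((le_max_right _ _).trans (le_max_right _ _))
  rw [tent, max_eq_left h1, min_eq_left h2, add_zero]

/-- Up to sign, `x` lies in one of the three cones over the triangles which `p` spans with the sides
of the coordinate triangle, or it has coordinates of both signs. -/
lemma tent_cases {p : Fin 3 → ℝ} (hp : ∀ i, 0 < p i) (x : Fin 3 → ℝ) :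
    (∃ τ i, 0 ≤ τ ∧ (∀ j, τ * p j ≤ x j) ∧ x i = τ * p i) ∨
    (∃ τ i, 0 ≤ τ ∧ (∀ j, τ * p j ≤ (-x) j) ∧ (-x) i = τ * p i) ∨
    ∃ i j, x i ≤ 0 ∧ 0 ≤ x j := by
  have key : ∀ x : Fin 3 → ℝ, (∀ i, 0 ≤ x i) →
      ∃ τ i, 0 ≤ τ ∧ (∀ j, τ * p j ≤ x j) ∧ x i = τ * p i := by
    intro x hx
    obtain ⟨i, hi⟩ := Finite.exists_min fun i => x i / p i
    exact ⟨x i / p i, i, div_nonneg (hx i) (hp i).le,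
      fun j => (le_div_iff₀ (hp j)).1 (hi j), (div_mul_cancel₀ _ (hp i).ne').symm⟩
  by_cases h1 : ∀ i, 0 ≤ x i
  · exact Or.inl (key x h1)
  by_cases h2 : ∀ i, 0 ≤ (-x) i
  · exact Or.inr (Or.inl (key _ h2))
  push Not at h1 h2
  obtain ⟨i, hi⟩ := h1
  obtain ⟨j, hj⟩ := h2
  exact Or.inr (Or.inr ⟨i, j, hi.le, by simp at hj; exact hj.le⟩)

lemma tent_smul {p : Fin 3 → ℝ} (hp : ∀ i, 0 < p i) (c : ℝ) (x : Fin 3 → ℝ) :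
    tent p (c • x) = c * tent p x := by
  have key : ∀ (c : ℝ) (x : Fin 3 → ℝ), 0 ≤ c → tent p (c • x) = c * tent p x := by
    intro c x hc
    have pos : ∀ x : Fin 3 → ℝ, (∃ τ i, 0 ≤ τ ∧ (∀ j, τ * p j ≤ x j) ∧ x i = τ * p i) →
        tent p (c • x) = c * tent p x := by
      rintro x ⟨τ, i, hτ, h, hi⟩
      rw [tent_eq_of_le hp hτ h hi]
      refine tent_eq_of_le hp (mul_nonneg hc hτ) (fun j => ?_) (i := i) ?_
      · have := mul_le_mul_of_nonneg_left (h j) hc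
        simp only [Pi.smul_apply, smul_eq_mul]; linarith
      · simp only [Pi.smul_apply, smul_eq_mul, hi]; ring
    rcases tent_cases hp x with h | h | ⟨i, j, hi, hj⟩
    · exact pos x h
    · have := pos (-x) h
      rw [smul_neg, tent_neg, tent_neg] at this
      linarith
    · rw [tent_eq_zero hp hi hj, mul_zero]
      exact tent_eq_zero hp (i := i) (j := j) (mul_nonpos_of_nonneg_of_nonpos hc hi)
        (mul_nonneg hc hj)
  rcases le_total 0 c with hc | hc
  · exact key c x hc
  · have := key (-c) x (by linarith)
    rw [neg_smul, tent_neg] at this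
    linarith

/-- The map that is linear on the cones over the three triangles which `p` spans with the sides
of the coordinate triangle, moves `p` to `q`, and is the identity off the triangle. -/
noncomputable def coneMap (p q x : Fin 3 → ℝ) : Fin 3 → ℝ := x + tent p x • (q - p)

lemma coneMap_neg (p q x : Fin 3 → ℝ) : coneMap p q (-x) = -coneMap p q x := by
  rw [coneMap, tent_neg, coneMap]; module

lemma coneMap_smul {p : Fin 3 → ℝ} (hp : ∀ i, 0 < p i) (q : Fin 3 → ℝ) (c : ℝ)
    (x : Fin 3 → ℝ) : coneMap p q (c • x) = c • coneMap p q x := by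
  rw [coneMap, tent_smul hp, coneMap]; module

lemma continuous_coneMap (p q : Fin 3 → ℝ) : Continuous (coneMap p q) := by
  have : Continuous (tent p) := by unfold tent; fun_prop
  unfold coneMap
  fun_prop

lemma tent_coneMap {p q : Fin 3 → ℝ} (hp : ∀ i, 0 < p i) (hq : ∀ i, 0 < q i)
    (x : Fin 3 → ℝ) : tent q (coneMap p q x) = tent p x := by
  have pos : ∀ x : Fin 3 → ℝ, (∃ τ i, 0 ≤ τ ∧ (∀ j, τ * p j ≤ x j) ∧ x i = τ * p i) →
      tent q (coneMap p q x) = tent p x := by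
    rintro x ⟨τ, i, hτ, h, hi⟩
    have e := tent_eq_of_le hp hτ h hi
    rw [e]
    have hc : ∀ j, coneMap p q x j = x j + τ * (q j - p j) := fun j => by simp [coneMap, e]
    refine tent_eq_of_le hq hτ (fun j => ?_) (i := i) ?_
    · rw [hc]; linarith [h j]
    · rw [hc, hi]; ring
  rcases tent_cases hp x with h | h | ⟨i, j, hi, hj⟩
  · exact pos x h
  · have := pos (-x) h
    rw [coneMap_neg, tent_neg, tent_neg] at this
    linarith
  · have e := tent_eq_zero hp hi hj
    have : coneMap p q x = x := by simp [coneMap, e]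
    rw [this, e, tent_eq_zero hq hi hj]

lemma coneMap_coneMap {p q : Fin 3 → ℝ} (hp : ∀ i, 0 < p i) (hq : ∀ i, 0 < q i)
    (x : Fin 3 → ℝ) : coneMap q p (coneMap p q x) = x := by
  rw [coneMap, tent_coneMap hp hq, coneMap]; module

/-- Wherever the coordinates and the differences of the quotients `x i / p i` have no sign change,
the tent function is linear, because the smallest quotient has a constant index. -/
lemma tent_add {p : Fin 3 → ℝ} (hp : ∀ i, 0 < p i) {x y : Fin 3 → ℝ}
    (h1 : ∀ i, 0 ≤ x i * y i)
    (h2 : ∀ i j, 0 ≤ (x i / p i - x j / p j) * (y i / p i - y j / p j)) {s t : ℝ} (hs : 0 ≤ s)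
    (ht : 0 ≤ t) : tent p (s • x + t • y) = s * tent p x + t * tent p y := by
  have pos : ∀ x y : Fin 3 → ℝ, (∀ i, 0 ≤ x i) → (∀ i, 0 ≤ y i) →
      (∀ i j, 0 ≤ (x i / p i - x j / p j) * (y i / p i - y j / p j)) →
      tent p (s • x + t • y) = s * tent p x + t * tent p y := by
    intro x y hx hy h2
    obtain ⟨i, hi⟩ := Finite.exists_min fun i => x i / p i + y i / p i
    have key : ∀ j, x i / p i ≤ x j / p j ∧ y i / p i ≤ y j / p j := by
      intro j
      have a1 := hi j
      have a2 := h2 i j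
      constructor <;> by_contra! hc <;> nlinarith
    have e : ∀ z : Fin 3 → ℝ, (∀ i, 0 ≤ z i) → (∀ j, z i / p i ≤ z j / p j) →
        tent p z = z i / p i := fun z hz hmin =>
      tent_eq_of_le hp (div_nonneg (hz i) (hp i).le)
        (fun j => (le_div_iff₀ (hp j)).1 (hmin j)) (i := i) (div_mul_cancel₀ _ (hp i).ne').symm
    rw [e x hx fun j => (key j).1, e y hy fun j => (key j).2, e]
    · simp only [Pi.add_apply, Pi.smul_apply, smul_eq_mul]; ring
    · intro j
      have := hx j
      have := hy j
      simp only [Pi.add_apply, Pi.smul_apply, smul_eq_mul]; positivity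
    · intro j
      have a1 := mul_le_mul_of_nonneg_left (key j).1 hs
      have a2 := mul_le_mul_of_nonneg_left (key j).2 ht
      simp only [Pi.add_apply, Pi.smul_apply, smul_eq_mul, add_div, mul_div_assoc]
      linarith
  by_cases hpos : (∀ i, 0 ≤ x i) ∧ (∀ i, 0 ≤ y i)
  · exact pos x y hpos.1 hpos.2 h2
  by_cases hneg : (∀ i, 0 ≤ (-x) i) ∧ (∀ i, 0 ≤ (-y) i)
  · have := pos (-x) (-y) hneg.1 hneg.2 fun i j => by
      have := h2 i j
      simp only [Pi.neg_apply, neg_div]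
      linarith
    have e : s • -x + t • -y = -(s • x + t • y) := by module
    rw [e, tent_neg, tent_neg, tent_neg] at this
    linarith
  -- otherwise there are one coordinate that is nonpositive and one that is nonnegative on both
  have hlo : ∃ i, x i ≤ 0 ∧ y i ≤ 0 := by
    by_contra! hc
    refine hpos ⟨fun i => ?_, fun i => ?_⟩
    · by_contra! hx
      nlinarith [h1 i, hc i hx.le]
    · by_contra! hy
      have hx : 0 < x i := by
        by_contra! hx
        linarith [hc i hx]
      nlinarith [h1 i]
  have hhi : ∃ i, 0 ≤ x i ∧ 0 ≤ y i := by
    by_contra! hc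
    refine hneg ⟨fun i => ?_, fun i => ?_⟩
    · rw [Pi.neg_apply, neg_nonneg]
      by_contra! hx
      nlinarith [h1 i, hc i hx.le]
    · rw [Pi.neg_apply, neg_nonneg]
      by_contra! hy
      have hx : x i < 0 := by
        by_contra! hx
        linarith [hc i hx]
      nlinarith [h1 i]
  obtain ⟨i, hi1, hi2⟩ := hlo
  obtain ⟨j, hj1, hj2⟩ := hhi
  rw [tent_eq_zero hp hi1 hj1, tent_eq_zero hp hi2 hj2, tent_eq_zero hp (i := i) (j := j)]
  · ring
  · simp only [Pi.add_apply, Pi.smul_apply, smul_eq_mul]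
    nlinarith
  · simp only [Pi.add_apply, Pi.smul_apply, smul_eq_mul]
    positivity

/-- `h` is a piecewise linear homeomorphism that is the identity off the interior of the triangle
`a b c`, moves the interior point `p` to the interior point `q`, and is linear on each of the
three cones over the triangles which `p` spans with the sides. -/
structure IsConeMove (h : RP2 ≃ₜ RP2) (a b c p q : Vec) : Prop where
  isPL : IsPL h
  fix_of_notMem : ∀ P, P ∉ tri a b c → h P = P
  fix : ∀ x y z : ℝ, x • a + y • b + z • c ≠ 0 → (x ≤ 0 ∨ y ≤ 0 ∨ z ≤ 0) →
    (0 ≤ x ∨ 0 ≤ y ∨ 0 ≤ z) → h (pt (x • a + y • b + z • c)) = pt (x • a + y • b + z • c)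
  map : ∀ x y z s : ℝ, 0 ≤ x → 0 ≤ y → 0 ≤ z → 0 ≤ s → (x = 0 ∨ y = 0 ∨ z = 0) →
    x • a + y • b + z • c + s • p ≠ 0 →
    h (pt (x • a + y • b + z • c + s • p)) = pt (x • a + y • b + z • c + s • q)

/-- The basic move, from which all homeomorphisms of the proof are composed. -/
theorem exists_isConeMove {a b c p q : Vec} (h : Indep3 a b c)
    (hp : ∃ x y z : ℝ, 0 < x ∧ 0 < y ∧ 0 < z ∧ p = x • a + y • b + z • c)
    (hq : ∃ x y z : ℝ, 0 < x ∧ 0 < y ∧ 0 < z ∧ q = x • a + y • b + z • c) :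
    ∃ g, IsConeMove g a b c p q := by
  obtain ⟨p0, p1, p2, hp0, hp1, hp2, rfl⟩ := hp
  obtain ⟨q0, q1, q2, hq0, hq1, hq2, rfl⟩ := hq
  set e := h.basis.equivFun with he
  have hes : ∀ u, e.symm u = u 0 • a + u 1 • b + u 2 • c := h.basis_equivFun_symm
  set p : Fin 3 → ℝ := ![p0, p1, p2] with hpdef
  set q : Fin 3 → ℝ := ![q0, q1, q2] with hqdef
  have hp : ∀ i, 0 < p i := fun i => by fin_cases i <;> simp [*]
  have hq : ∀ i, 0 < q i := fun i => by fin_cases i <;> simp [*]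
  have hec : Continuous e := e.toLinearMap.continuous_of_finiteDimensional
  have hec' : Continuous e.symm := e.symm.toLinearMap.continuous_of_finiteDimensional
  set M : (Fin 3 → ℝ) → (Fin 3 → ℝ) → Vec → Vec := fun p q v => e.symm (coneMap p q (e v))
    with hM
  have cM : ∀ p q, Continuous (M p q) := fun p q =>
    hec'.comp ((continuous_coneMap p q).comp hec)
  have sM : ∀ p q, (∀ i, 0 < p i) → ∀ (c : ℝ) v, M p q (c • v) = c • M p q v :=
    fun p q hp c v => by simp only [hM, map_smul, coneMap_smul hp]
  have iM : ∀ p q, (∀ i, 0 < p i) → (∀ i, 0 < q i) → ∀ v, M q p (M p q v) = v :=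
    fun p q hp hq v => by simp [hM, coneMap_coneMap hp hq]
  have lM : ∀ p q, (∀ i, 0 < p i) → ∀ Φ, Φ = List.flatten (List.ofFn fun i : Fin 3 =>
        (LinearMap.proj i ∘ₗ e.toLinearMap : Vec →ₗ[ℝ] ℝ) :: List.ofFn fun j : Fin 3 =>
          ((p i)⁻¹ • (LinearMap.proj i ∘ₗ e.toLinearMap : Vec →ₗ[ℝ] ℝ) -
            (p j)⁻¹ • (LinearMap.proj j ∘ₗ e.toLinearMap : Vec →ₗ[ℝ] ℝ))) →
      ∀ x y, (∀ φ ∈ Φ, 0 ≤ φ x * φ y) → ∀ s t : ℝ, 0 ≤ s → 0 ≤ t →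
        M p q (s • x + t • y) = s • M p q x + t • M p q y := by
    rintro p q hp Φ rfl x y hΦ s t hs ht
    have h1 : ∀ i, 0 ≤ e x i * e y i := fun i =>
      hΦ (LinearMap.proj i ∘ₗ e.toLinearMap : Vec →ₗ[ℝ] ℝ)
        (List.mem_flatten.2 ⟨_, List.mem_ofFn.2 ⟨i, rfl⟩, by simp⟩)
    have h2 : ∀ i j, 0 ≤ (e x i / p i - e x j / p j) * (e y i / p i - e y j / p j) := by
      intro i j
      have := hΦ ((p i)⁻¹ • (LinearMap.proj i ∘ₗ e.toLinearMap : Vec →ₗ[ℝ] ℝ) -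
            (p j)⁻¹ • (LinearMap.proj j ∘ₗ e.toLinearMap : Vec →ₗ[ℝ] ℝ))
        (List.mem_flatten.2 ⟨_, List.mem_ofFn.2 ⟨i, rfl⟩,
          List.mem_cons_of_mem _ (List.mem_ofFn.2 ⟨j, rfl⟩)⟩)
      simpa [div_eq_inv_mul] using this
    have := tent_add hp h1 h2 hs ht
    simp only [hM, ← map_smul, ← map_add]
    congr 1
    simp only [coneMap, map_add, map_smul, this]
    module
  set g := liftHomeo (M p q) (M q p) (cM p q) (cM q p) (sM p q hp) (sM q p hq) (iM p q hp hq)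
    (iM q p hq hp) with hg
  have hgpt : ∀ v, v ≠ 0 → g (pt v) = pt (M p q v) := fun v hv => liftHomeo_pt _ _ _ _ _ _ hv
  have hgpt' : ∀ v, v ≠ 0 → g.symm (pt v) = pt (M q p v) := fun v hv =>
    liftHomeo_pt (cM q p) (cM p q) (sM q p hq) (sM p q hp) (iM q p hq hp) (iM p q hp hq) hv
  have nM : ∀ p q, (∀ i, 0 < p i) → (∀ i, 0 < q i) → ∀ v, v ≠ 0 → M p q v ≠ 0 :=
    fun p q hp hq v hv h0 => hv (by
      rw [← iM p q hp hq v, h0]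
      simpa using sM q p hq 0 0)
  have hev : ∀ x y z : ℝ, e (x • a + y • b + z • c) = ![x, y, z] := fun x y z => by
    apply e.symm.injective
    rw [LinearEquiv.symm_apply_apply, hes]
    simp
  have hfix : ∀ x y z : ℝ, x • a + y • b + z • c ≠ 0 → (x ≤ 0 ∨ y ≤ 0 ∨ z ≤ 0) →
      (0 ≤ x ∨ 0 ≤ y ∨ 0 ≤ z) →
      g (pt (x • a + y • b + z • c)) = pt (x • a + y • b + z • c) := by
    intro x y z h0 h1 h2
    have h1' : ∃ i, ![x, y, z] i ≤ 0 := by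
      rcases h1 with h | h | h
      exacts [⟨0, h⟩, ⟨1, h⟩, ⟨2, h⟩]
    have h2' : ∃ i, 0 ≤ ![x, y, z] i := by
      rcases h2 with h | h | h
      exacts [⟨0, h⟩, ⟨1, h⟩, ⟨2, h⟩]
    obtain ⟨i, hi⟩ := h1'
    obtain ⟨j, hj⟩ := h2'
    rw [hgpt _ h0]
    congr 1
    simp only [hM, coneMap, hev, tent_eq_zero hp hi hj, zero_smul, add_zero]
    rw [hes]
    simp
  refine ⟨g, ⟨preservesPolyArcs_of_lift (nM p q hp hq) hgpt _ (lM p q hp _ rfl),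
    preservesPolyArcs_of_lift (nM q p hq hp) hgpt' _ (lM q p hq _ rfl)⟩, ?_, hfix, ?_⟩
  · intro P hP
    obtain ⟨v, hv, rfl⟩ := exists_eq_pt P
    obtain ⟨x, y, z, rfl⟩ := h.exists_coord v
    refine hfix x y z hv ?_ ?_
    · by_contra! hc
      exact hP ⟨_, ⟨x, y, z, hc.1.le, hc.2.1.le, hc.2.2.le, rfl⟩, hv, rfl⟩
    · by_contra! hc
      refine hP ⟨-(x • a + y • b + z • c), ⟨-x, -y, -z, by linarith, by linarith, by linarith,
        by module⟩, neg_ne_zero.2 hv, (pt_neg _).symm⟩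
  · intro x y z s hx hy hz hs h0 hne
    rw [hgpt _ hne]
    congr 1
    have e1 : e (x • a + y • b + z • c + s • (p0 • a + p1 • b + p2 • c)) =
        ![x, y, z] + s • p := by
      rw [map_add, map_smul, hev, hev]
    have e2 : tent p (![x, y, z] + s • p) = s := by
      have key : ∃ i, ![x, y, z] i = 0 := by
        rcases h0 with h | h | h
        exacts [⟨0, h⟩, ⟨1, h⟩, ⟨2, h⟩]
      obtain ⟨i, hi⟩ := key
      refine tent_eq_of_le hp hs (fun j => ?_) (i := i) (by simp [hi])
      have : 0 ≤ ![x, y, z] j := by fin_cases j <;> simp [*]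
      simp only [Pi.add_apply, Pi.smul_apply, smul_eq_mul]
      linarith
    simp only [hM]
    rw [e1, coneMap, e2, hes]
    simp [hpdef, hqdef]
    module

/-! ### Shortening polygonal arcs -/

lemma image_seg_eq {g : RP2 ≃ₜ RP2} {x y x' y' : Vec} (h : Indep2 x y) (h' : Indep2 x' y')
    (H : ∀ s t : ℝ, 0 ≤ s → 0 ≤ t → s • x + t • y ≠ 0 →
      g (pt (s • x + t • y)) = pt (s • x' + t • y')) : g '' seg x y = seg x' y' := by
  apply Subset.antisymm
  · rintro _ ⟨P, ⟨v, ⟨s, t, hs, ht, rfl⟩, hv, rfl⟩, rfl⟩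
    rw [H s t hs ht hv]
    refine pt_mem_seg hs ht (h'.ne_zero ?_)
    by_contra! hc
    simp [hc.1, hc.2] at hv
  · rintro P ⟨v, ⟨s, t, hs, ht, rfl⟩, hv, rfl⟩
    have hv' : s • x + t • y ≠ 0 := by
      refine h.ne_zero ?_
      by_contra! hc
      simp [hc.1, hc.2] at hv
    rw [← H s t hs ht hv']
    exact mem_image_of_mem _ (pt_mem_seg hs ht hv')

lemma image_trans (g h : RP2 ≃ₜ RP2) (A : Set RP2) : g.trans h '' A = h '' (g '' A) :=
  (image_image h g A).symm

lemma image_eq_self {g : RP2 ≃ₜ RP2} {A : Set RP2} (h : ∀ P ∈ A, g P = P) : g '' A = A := by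
  rw [image_congr h, image_id']

lemma seg_subset_tri₁₂ (x y z : Vec) : seg x y ⊆ tri x y z :=
  proj_mono fun v ⟨s, t, hs, ht, e⟩ => ⟨s, t, 0, hs, ht, le_rfl, by rw [e]; module⟩

lemma seg_subset_tri₁₃ (x y z : Vec) : seg x z ⊆ tri x y z :=
  proj_mono fun v ⟨s, t, hs, ht, e⟩ => ⟨s, 0, t, hs, le_rfl, ht, by rw [e]; module⟩

lemma seg_subset_tri₂₃ (x y z : Vec) : seg y z ⊆ tri x y z :=
  proj_mono fun v ⟨s, t, hs, ht, e⟩ => ⟨0, s, t, le_rfl, hs, ht, by rw [e]; module⟩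

lemma eventually_mul_lt (c : ℝ) {d : ℝ} (hd : 0 < d) :
    ∀ᶠ η : ℝ in nhdsWithin 0 (Ioi 0), η * c < d := by
  have h : Filter.Tendsto (fun η : ℝ => η * c) (nhds 0) (nhds (0 * c)) := by
    exact (continuous_id.mul continuous_const).tendsto 0
  rw [zero_mul] at h
  exact (h.mono_left nhdsWithin_le_nhds).eventually (gt_mem_nhds hd)

lemma eventually_dist_lt (u x : Vec) {δ : ℝ} (hδ : 0 < δ) :
    ∀ᶠ η : ℝ in nhdsWithin 0 (Ioi 0), dist (x + η • u) x < δ := by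
  filter_upwards [eventually_mul_lt ‖u‖ hδ, self_mem_nhdsWithin] with η h1 h2
  rw [dist_eq_norm, add_sub_cancel_left, norm_smul, Real.norm_eq_abs, abs_of_pos h2]
  exact h1

/-- The end `y` of the segment `a y` can be pulled back to any interior point of the segment by
moving only points near the segment. The triangle `a (a - κ y) w` lies behind `a`. -/
lemma exists_drag {a y w : Vec} (h : Indep3 a y w) {K : Set RP2} (hK : IsClosed K)
    (hKd : Disjoint K (seg a y)) {κ σ : ℝ} (hκ : 0 ≤ κ) (hσ : 0 < σ) :
    ∃ g : RP2 ≃ₜ RP2, IsPL g ∧ (∀ P ∈ K, g P = P) ∧ (∀ P ∈ tri a (a - κ • y) w, g P = P) ∧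
      ∀ s t : ℝ, 0 ≤ s → 0 ≤ t → s • a + t • y ≠ 0 →
        g (pt (s • a + t • y)) = pt (s • a + t • (a + σ • y)) := by
  obtain ⟨δ, hδ, hav⟩ := exists_delta_avoid hK a y y (by
    intro s t u hs ht hu h1
    have e : s • a + t • y + u • y = s • a + (t + u) • y := by module
    have hne : s • a + t • y + u • y ≠ 0 := by
      rw [e]
      refine h.indep2.ne_zero ?_
      by_contra! hc
      linarith [hc.1, hc.2]
    refine ⟨hne, fun hm => hKd.le_bot ⟨hm, ?_⟩⟩
    rw [e] at hne ⊢
    exact pt_mem_seg hs (by linarith) hne)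
  obtain ⟨η, ⟨⟨h1, h2⟩, h3⟩, (hη : 0 < η)⟩ := (((eventually_dist_lt (y - a + w) y hδ).and
    (eventually_dist_lt (y - a - w) y hδ)).and (eventually_mul_lt κ one_pos)).and
    self_mem_nhdsWithin |>.exists
  have hη1 : 0 < 1 + η := by linarith
  -- the thin triangle with apex `a` and axis `a y` that extends slightly beyond `y`
  set b := y + η • (y - a + w) with hb
  set c := y + η • (y - a - w) with hc
  have hind : Indep3 a b c := by
    intro r s t e
    have := h (r - η * (s + t)) ((1 + η) * (s + t)) (η * (s - t)) (by
      rw [← e, hb, hc]; module)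
    obtain ⟨e1, e2, e3⟩ := this
    have e2' : s + t = 0 := by simpa [hη1.ne'] using e2
    have e3' : s - t = 0 := by simpa [hη.ne'] using e3
    rw [e2', mul_zero, sub_zero] at e1
    exact ⟨e1, by linarith, by linarith⟩
  have ey : y = (η / (1 + η)) • a + (1 / (2 * (1 + η))) • b + (1 / (2 * (1 + η))) • c := by
    have e1 : (1 / (2 * (1 + η))) • b + (1 / (2 * (1 + η))) • c =
        (1 / (2 * (1 + η)) * (2 * (1 + η))) • y - (1 / (2 * (1 + η)) * (2 * η)) • a := by
      rw [hb, hc]; module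
    have e2 : 1 / (2 * (1 + η)) * (2 * (1 + η)) = 1 := by field_simp
    have e3 : 1 / (2 * (1 + η)) * (2 * η) = η / (1 + η) := by field_simp
    rw [add_assoc, e1, e2, e3]
    module
  obtain ⟨g, hg⟩ := exists_isConeMove hind (p := y) (q := a + σ • y)
    ⟨_, _, _, by positivity, by positivity, by positivity, ey⟩
    ⟨1 + σ * (η / (1 + η)), σ * (1 / (2 * (1 + η))), σ * (1 / (2 * (1 + η))), by positivity,
      by positivity, by positivity, by nth_rw 1 [ey]; module⟩
  refine ⟨g, hg.isPL, ?_, ?_, ?_⟩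
  · intro P hP
    refine hg.fix_of_notMem P ?_
    rintro ⟨v, ⟨s, t, u, hs, ht, hu, rfl⟩, hv, rfl⟩
    exact hav a b c (by simpa using hδ) h1 h2 s t u hs ht hu hv hP
  · rintro P ⟨v, ⟨α, β, γ, hα, hβ, hγ, rfl⟩, hv, rfl⟩
    have e : α • a + β • (a - κ • y) + γ • w =
        (α + β - η * (β * κ / (1 + η))) • a +
          ((-(β * κ / (1 + η)) + γ / η) / 2) • b + ((-(β * κ / (1 + η)) - γ / η) / 2) • c := by
      have e1 : ((-(β * κ / (1 + η)) + γ / η) / 2) • b + ((-(β * κ / (1 + η)) - γ / η) / 2) • c =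
        (-(β * κ / (1 + η)) * (1 + η)) • y + (β * κ / (1 + η) * η) • a + (γ / η * η) • w := by
        rw [hb, hc]; module
      have e2 : -(β * κ / (1 + η)) * (1 + η) = -(β * κ) := by field_simp
      have e3 : γ / η * η = γ := by field_simp
      rw [add_assoc ((α + β - η * (β * κ / (1 + η))) • a), e1, e2, e3]
      module
    rw [e] at hv ⊢
    refine hg.fix _ _ _ hv (Or.inr (Or.inr ?_)) (Or.inl ?_)
    · have h4 : 0 ≤ β * κ / (1 + η) := by positivity
      have h5 : 0 ≤ γ / η := by positivity
      linarith
    · have h4 : η * (β * κ / (1 + η)) ≤ β := by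
        rw [← mul_div_assoc, div_le_iff₀ hη1]
        nlinarith
      linarith
  · intro s t hs ht hne
    have e : s • a + t • y = s • a + (0 : ℝ) • b + (0 : ℝ) • c + t • y := by module
    rw [e] at hne ⊢
    rw [hg.map s 0 0 t hs le_rfl le_rfl ht (by simp) hne]
    congr 1
    module

lemma Indep2.of_combo {x y : Vec} (h : Indep2 x y) {a b c d : ℝ} (hd : a * d - b * c ≠ 0) :
    Indep2 (a • x + b • y) (c • x + d • y) := by
  intro s t e
  obtain ⟨e1, e2⟩ := h (s * a + t * c) (s * b + t * d) (by rw [← e]; module)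
  constructor
  · refine (mul_eq_zero.1 (?_ : s * (a * d - b * c) = 0)).resolve_right hd
    linear_combination d * e1 - c * e2
  · refine (mul_eq_zero.1 (?_ : t * (a * d - b * c) = 0)).resolve_right hd
    linear_combination a * e2 - b * e1

lemma PolyArc.exists_last_eq {p : RP2} {x : Vec} {A : Set RP2} (hx : x ≠ 0)
    (h : PolyArc p (pt x) A) : ∃ w F, Indep2 w x ∧ IsClosed F ∧ pt x ∉ F ∧ A = F ∪ seg w x := by
  obtain ⟨w, x', F, hind, e, hF, hxF, rfl⟩ := h.exists_last
  obtain ⟨c, hc, rfl⟩ := (pt_eq_pt_iff hx hind.right_ne_zero).1 e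
  refine ⟨c • w, F, ?_, hF, hxF, by rw [seg_smul_same hc]⟩
  intro s t e
  have := hind (s * c) (t * c) (by rw [← e]; module)
  simpa [hc] using this

/-- Retraction of a last segment that continues the previous segment straight on. -/
lemma exists_retract_straight {w x y : Vec} (hwx : Indep2 w x) {α β : ℝ} (hα : 0 < α)
    (hβ : 0 < β) (hy : y = α • x - β • w) {K : Set RP2} (hK : IsClosed K)
    (hKd : Disjoint K (seg x y)) :
    ∃ g : RP2 ≃ₜ RP2, IsPL g ∧ (∀ P ∈ K, g P = P) ∧ g '' (seg w x ∪ seg x y) = seg w x ∧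
      g (pt y) = pt x := by
  have hxy : Indep2 x y := by
    have := hwx.of_combo (a := 0) (b := 1) (c := -β) (d := α) (by simp [hβ.ne'])
    rw [hy]
    convert this using 1 <;> module
  obtain ⟨c, hc⟩ := hwx.exists_indep3
  obtain ⟨δ, hδ, hav⟩ := exists_delta_avoid hK x y y (by
    intro s t u hs ht hu h1
    have e : s • x + t • y + u • y = s • x + (t + u) • y := by module
    have hne : s • x + t • y + u • y ≠ 0 := by
      rw [e]
      refine hxy.ne_zero ?_
      by_contra! hc
      linarith [hc.1, hc.2]
    refine ⟨hne, fun hm => hKd.le_bot ⟨hm, ?_⟩⟩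
    rw [e] at hne ⊢
    exact pt_mem_seg hs (by linarith) hne)
  obtain ⟨θ, h1, (hθ : 0 < θ)⟩ := ((eventually_dist_lt w x hδ).and self_mem_nhdsWithin).exists
  set a := x + θ • w with ha
  set σ := θ / β with hσ
  have hσ0 : 0 < σ := div_pos hθ hβ
  have hσβ : σ * β = θ := by rw [hσ]; field_simp
  have eσ : a + σ • y = (1 + σ * α) • x := by
    rw [ha, hy, ← hσβ]; module
  have hσα : 0 < 1 + σ * α := by positivity
  have hind : Indep3 a y c := by
    intro r s t e
    obtain ⟨e1, e2, e3⟩ := hc (r * θ - s * β) (r + s * α) t (by rw [← e, ha, hy]; module)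
    have e4 : s * (β + θ * α) = 0 := by linear_combination θ * e2 - e1
    have hs : s = 0 := (mul_eq_zero.1 e4).resolve_right (by positivity)
    subst hs
    exact ⟨by linarith, rfl, e3⟩
  obtain ⟨g, hg, hgK, hgt, hgm⟩ := exists_drag hind hK (κ := 1 / α) (σ := σ) (by
      rw [Set.disjoint_left]
      rintro _ hP ⟨v, ⟨s, t, hs, ht, rfl⟩, hv, rfl⟩
      have e : s • a + t • y = s • a + t • y + (0 : ℝ) • y := by module
      rw [e] at hv hP
      exact hav a y y h1 (by simpa using hδ) (by simpa using hδ) s t 0 hs ht le_rfl hv hP)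
    (by positivity) hσ0
  have hgw : ∀ P ∈ seg w a, g P = P := by
    intro P hP
    refine hgt P ?_
    have e : a - (1 / α) • y = (θ + β / α) • w := by
      have : (1 / α) * α = 1 := by field_simp
      rw [ha, hy, smul_sub, smul_smul, this, smul_smul, div_mul_eq_mul_div, one_mul]; module
    rw [e]
    apply seg_subset_tri₁₂
    rw [seg_comm]
    have := seg_smul (a := θ + β / α) (b := 1) (by positivity) one_pos w a
    rw [one_smul] at this
    rwa [this]
  have s1 : seg w x = seg w a ∪ seg a x := by
    have := seg_split hθ one_pos (x := w) (y := x)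
    rwa [show θ • w + (1 : ℝ) • x = a by rw [ha]; module] at this
  have s2 : seg a y = seg a x ∪ seg x y := by
    have := seg_split (s := (1 + σ * α)⁻¹) (t := (1 + σ * α)⁻¹ * σ) (by positivity)
      (by positivity) (x := a) (y := y)
    rwa [show (1 + σ * α)⁻¹ • a + ((1 + σ * α)⁻¹ * σ) • y = x by
      rw [mul_smul, ← smul_add, eσ, smul_smul, inv_mul_cancel₀ hσα.ne', one_smul]] at this
  have hax : Indep2 a x := by
    have := hwx.of_combo (a := θ) (b := 1) (c := 0) (d := 1) (by simp [hθ.ne'])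
    convert this using 1
    · rw [ha]; module
    · module
  have s3 : g '' seg a y = seg a x := by
    rw [image_seg_eq (x' := a) (y' := a + σ • y) hind.indep2 ?_ hgm]
    · have := seg_smul (a := 1) (b := 1 + σ * α) one_pos hσα a x
      rw [one_smul] at this
      rw [eσ, this]
    · rw [eσ]
      have := hax.combo_right (s := 0) hσα.ne'
      simpa using this
  refine ⟨g, hg, hgK, ?_, ?_⟩
  · have : seg w x ∪ seg x y = seg w a ∪ seg a y := by rw [s1, s2, union_assoc]
    rw [this, image_union, image_eq_self hgw, s3, ← s1]
  · have := hgm 0 1 le_rfl zero_le_one (by simpa using hind.indep2.right_ne_zero)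
    simp only [zero_smul, one_smul, zero_add] at this
    rw [this, eσ, pt_smul hσα.ne']

/-- Retraction of a last segment that forms a corner with the previous segment: the end is pulled
close to the corner, the short remaining piece is turned around the corner until it continues the
previous segment, and then it is pulled back to the corner. -/
lemma exists_retract_corner {w x y : Vec} (h : Indep3 x y w) {K : Set RP2} (hK : IsClosed K)
    (hKd : Disjoint K (seg x y)) :
    ∃ g : RP2 ≃ₜ RP2, IsPL g ∧ (∀ P ∈ K, g P = P) ∧ g '' (seg w x ∪ seg x y) = seg w x ∧
      g (pt y) = pt x := by
  have hxy := h.indep2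
  have hx0 := hxy.left_ne_zero
  have hwx : Indep2 w x := h.rotate.rotate.indep2
  obtain ⟨δ, hδ, hav⟩ := exists_delta_avoid hK x x x (by
    intro s t u hs ht hu h1
    have e : s • x + t • x + u • x = x := by
      rw [← add_smul, ← add_smul, h1, one_smul]
    rw [e]
    exact ⟨hx0, fun hm => hKd.le_bot ⟨hm, left_mem_seg hx0⟩⟩)
  obtain ⟨ρ, ⟨⟨h1, h2⟩, h3, h4⟩, (hρ : 0 < ρ)⟩ :=
      (((eventually_dist_lt ((2 : ℝ) • (2 • y + w)) x hδ).and
    (eventually_dist_lt ((2 : ℝ) • (-y - 2 • w)) x hδ)).and ((eventually_dist_lt w x hδ).and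
    (eventually_dist_lt (-w) x hδ))).and self_mem_nhdsWithin |>.exists
  -- first move: `y` is pulled to `x + ρ y`
  set a := x + (ρ / 2) • y with ha
  have i1 : Indep3 a y w := by
    intro r s t e
    obtain ⟨e1, e2, e3⟩ := h r (r * (ρ / 2) + s) t (by rw [← e, ha]; module)
    subst e1
    exact ⟨rfl, by linarith, e3⟩
  have sa : seg x y = seg x a ∪ seg a y := by
    have := seg_split one_pos (half_pos hρ) (x := x) (y := y)
    rwa [one_smul] at this
  obtain ⟨g₁, hg₁, hK₁, ht₁, hm₁⟩ := exists_drag i1 hK (κ := ρ / 2) (σ := ρ / 2)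
    (hKd.mono_right (sa ▸ subset_union_right)) (by positivity) (by positivity)
  have ex : a - (ρ / 2) • y = x := by rw [ha]; module
  have ep : a + (ρ / 2) • y = x + ρ • y := by rw [ha]; module
  rw [ex] at ht₁
  rw [ep] at hm₁
  have iap : Indep2 a (x + ρ • y) := by
    have := hxy.of_combo (a := 1) (b := ρ / 2) (c := 1) (d := ρ) (by linarith)
    rwa [one_smul] at this
  have r₁ : g₁ '' (seg w x ∪ seg x y) = seg w x ∪ seg x (x + ρ • y) := by
    have s1 : seg x (x + ρ • y) = seg x a ∪ seg a (x + ρ • y) := by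
      have := seg_split (s := 1 / 2) (t := 1 / 2) (by norm_num) (by norm_num) (x := x)
        (y := x + ρ • y)
      rwa [show (1 / 2 : ℝ) • x + (1 / 2 : ℝ) • (x + ρ • y) = a by rw [ha]; module] at this
    rw [sa, s1, image_union, image_union, image_seg_eq i1.indep2 iap hm₁, image_eq_self,
      image_eq_self]
    · intro P hP
      exact ht₁ P (seg_subset_tri₁₂ _ _ _ (by rwa [seg_comm]))
    · intro P hP
      exact ht₁ P (seg_subset_tri₂₃ _ _ _ (by rwa [seg_comm]))
  have e₁ : g₁ (pt y) = pt (x + ρ • y) := by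
    have := hm₁ 0 1 le_rfl zero_le_one (by simpa using hxy.right_ne_zero)
    simpa using this
  -- second move: the segment from `x` to `x + ρ y` is turned to the segment to `x - ρ w`
  set b := x + ρ • (2 : ℝ) • (2 • y + w) with hb
  set c := x + ρ • (2 : ℝ) • (-y - 2 • w) with hc
  have i2 : Indep3 x b c := by
    intro r s t e
    obtain ⟨e1, e2, e3⟩ := h (r + s + t) (ρ * 2 * (2 * s - t)) (ρ * 2 * (s - 2 * t)) (by
      rw [← e, hb, hc]; module)
    have e2' : 2 * s - t = 0 := (mul_eq_zero.1 e2).resolve_left (by positivity)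
    have e3' : s - 2 * t = 0 := (mul_eq_zero.1 e3).resolve_left (by positivity)
    have hs : s = 0 := by linarith
    have ht : t = 0 := by linarith
    exact ⟨by linarith, hs, ht⟩
  obtain ⟨g₂, hg₂⟩ := exists_isConeMove i2 (p := x + ρ • y) (q := x - ρ • w)
    ⟨1 / 2, 1 / 3, 1 / 6, by norm_num, by norm_num, by norm_num, by rw [hb, hc]; module⟩
    ⟨1 / 2, 1 / 6, 1 / 3, by norm_num, by norm_num, by norm_num, by rw [hb, hc]; module⟩
  have hK₂ : ∀ P ∈ K, g₂ P = P := by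
    intro P hP
    refine hg₂.fix_of_notMem P ?_
    rintro ⟨v, ⟨s, t, u, hs, ht, hu, rfl⟩, hv, rfl⟩
    exact hav x b c (by simpa using hδ) h1 h2 s t u hs ht hu hv hP
  have hw₂ : ∀ P ∈ seg w x, g₂ P = P := by
    rintro _ ⟨v, ⟨s, t, hs, ht, rfl⟩, hv, rfl⟩
    have e : s • w + t • x = (t + s / (2 * ρ)) • x + (-(s / (6 * ρ))) • b +
        (-(s / (3 * ρ))) • c := by
      have e1 : s = s / (6 * ρ) * (6 * ρ) := by field_simp
      have e2 : s / (2 * ρ) = 3 * (s / (6 * ρ)) := by field_simp; ring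
      have e3 : s / (3 * ρ) = 2 * (s / (6 * ρ)) := by field_simp; ring
      rw [e2, e3]
      nth_rw 1 [e1]
      rw [hb, hc]
      module
    rw [e] at hv ⊢
    refine hg₂.fix _ _ _ hv (Or.inr (Or.inl ?_)) (Or.inl (by positivity))
    rw [neg_nonpos]
    positivity
  have ixp : Indep2 x (x + ρ • y) := by
    have := hxy.combo_right (s := 1) hρ.ne'
    rwa [one_smul] at this
  have ixq : Indep2 x (x - ρ • w) := by
    have := hwx.symm.combo_right (s := 1) (t := -ρ) (by simpa using hρ.ne')
    convert this using 1
    module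
  have hm₂ : ∀ s t : ℝ, 0 ≤ s → 0 ≤ t → s • x + t • (x + ρ • y) ≠ 0 →
      g₂ (pt (s • x + t • (x + ρ • y))) = pt (s • x + t • (x - ρ • w)) := by
    intro s t hs ht hne
    have e : ∀ v : Vec, s • x + t • v = s • x + (0 : ℝ) • b + (0 : ℝ) • c + t • v :=
      fun v => by module
    rw [e] at hne ⊢
    rw [hg₂.map s 0 0 t hs le_rfl le_rfl ht (by simp) hne, ← e]
  have r₂ : g₂ '' (seg w x ∪ seg x (x + ρ • y)) = seg w x ∪ seg x (x - ρ • w) := by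
    rw [image_union, image_eq_self hw₂, image_seg_eq ixp ixq hm₂]
  have e₂ : g₂ (pt (x + ρ • y)) = pt (x - ρ • w) := by
    have := hm₂ 0 1 le_rfl zero_le_one (by simpa using ixp.right_ne_zero)
    simpa using this
  -- third move: the end `x - ρ w` is pulled back to `x`
  obtain ⟨g₃, hg₃, hK₃, r₃, e₃⟩ := exists_retract_straight hwx one_pos hρ
    (y := x - ρ • w) (by module) hK (by
      rw [Set.disjoint_left]
      rintro _ hP ⟨v, ⟨s, t, hs, ht, rfl⟩, hv, rfl⟩
      have e : s • x + t • (x - ρ • w) = s • x + t • (x + ρ • -w) + (0 : ℝ) • x := by module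
      rw [e] at hv hP
      exact hav x _ x (by simpa using hδ) h4 (by simpa using hδ) s t 0 hs ht le_rfl hv hP)
  refine ⟨g₁.trans (g₂.trans g₃), hg₁.trans (hg₂.isPL.trans hg₃), ?_, ?_, ?_⟩
  · intro P hP
    simp only [Homeomorph.trans_apply]
    rw [hK₁ P hP, hK₂ P hP, hK₃ P hP]
  · rw [image_trans, image_trans, r₁, r₂, r₃]
  · simp only [Homeomorph.trans_apply]
    rw [e₁, e₂, e₃]

/-- A polygonal arc can be mapped onto the arc without its last segment, while a closed set that
meets it at most in its starting point stays fixed. -/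
lemma exists_retract {p : RP2} {x y : Vec} {A K : Set RP2} (hA : PolyArc p (pt x) A)
    (hxy : Indep2 x y) (hi : A ∩ seg x y ⊆ {pt x}) (hK : IsClosed K)
    (hKA : K ∩ (A ∪ seg x y) ⊆ {p}) :
    ∃ g : RP2 ≃ₜ RP2, IsPL g ∧ (∀ P ∈ K, g P = P) ∧ g '' (A ∪ seg x y) = A ∧
      g (pt y) = pt x := by
  obtain ⟨w, F, hwx, hF, hxF, rfl⟩ := hA.exists_last_eq hxy.left_ne_zero
  have hKd : Disjoint (F ∪ K) (seg x y) := by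
    rw [Set.disjoint_left]
    rintro P (hP | hP) hP'
    · have := hi ⟨Or.inl hP, hP'⟩
      rw [mem_singleton_iff] at this
      exact hxF (this ▸ hP)
    · have e : P = p := hKA ⟨hP, Or.inr hP'⟩
      exact hA.ne (hi ⟨hA.start_mem, e ▸ hP'⟩)
  suffices ∃ g : RP2 ≃ₜ RP2, IsPL g ∧ (∀ P ∈ F ∪ K, g P = P) ∧
      g '' (seg w x ∪ seg x y) = seg w x ∧ g (pt y) = pt x by
    obtain ⟨g, hg, h1, h2, h3⟩ := this
    refine ⟨g, hg, fun P hP => h1 P (Or.inr hP), ?_, h3⟩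
    rw [union_assoc, image_union, h2, image_eq_self fun P hP => h1 P (Or.inl hP)]
  by_cases hind : Indep3 x y w
  · exact exists_retract_corner hind (hF.union hK) hKd
  · obtain ⟨s, t, hy⟩ : ∃ s t : ℝ, y = s • w + t • x := by
      by_contra! hc
      exact hind (Indep3.of_not_mem hwx hc).rotate
    -- the segments do not overlap, which determines the signs of the coefficients
    have hs : s < 0 := by
      by_contra! hs
      have e : s • w + (t + |t|) • x = |t| • x + (1 : ℝ) • y := by rw [hy]; module
      have h0 : |t| • x + (1 : ℝ) • y ≠ 0 := hxy.ne_zero (by simp)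
      have m1 : pt (|t| • x + (1 : ℝ) • y) ∈ seg w x := by
        rw [← e] at h0 ⊢
        exact pt_mem_seg hs (by linarith [neg_abs_le t]) h0
      have m2 : pt (|t| • x + (1 : ℝ) • y) ∈ seg x y := pt_mem_seg (abs_nonneg _) zero_le_one h0
      exact (hxy.combo_right (s := |t|) one_ne_zero).pt_ne (hi ⟨Or.inr m1, m2⟩).symm
    have ht : 0 < t := by
      by_contra! ht
      have m1 : pt y ∈ seg w x := by
        have e : -y = (-s) • w + (-t) • x := by rw [hy]; module
        have h0 : -y ≠ 0 := neg_ne_zero.2 hxy.right_ne_zero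
        rw [← pt_neg, e]
        rw [e] at h0
        exact pt_mem_seg (by linarith) (by linarith) h0
      exact hxy.pt_ne (hi ⟨Or.inr m1, right_mem_seg hxy.right_ne_zero⟩).symm
    exact exists_retract_straight hwx ht (neg_pos.2 hs) (by rw [hy]; module) (hF.union hK) hKd

/-- A polygonal arc can be mapped onto a single segment, while a closed set that meets it at most
in its starting point stays fixed. -/
lemma exists_shrink {p q : RP2} {A K : Set RP2} (hA : PolyArc p q A) (hK : IsClosed K)
    (hKA : K ∩ A ⊆ {p}) :
    ∃ (g : RP2 ≃ₜ RP2) (x y : Vec), IsPL g ∧ (∀ P ∈ K, g P = P) ∧ Indep2 x y ∧ pt x = p ∧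
      g q = pt y ∧ g '' A = seg x y := by
  induction hA with
  | single x y h hp =>
    exact ⟨Homeomorph.refl _, x, y, IsPL.refl, fun _ _ => rfl, h, hp.symm, rfl, by simp⟩
  | snoc x y A h hA hi ih =>
    obtain ⟨g₁, hg₁, h1, h2, h3⟩ := exists_retract hA h hi hK hKA
    obtain ⟨g₂, x', y', hg₂, k1, k2, k3, k4, k5⟩ :=
      ih fun P hP => hKA ⟨hP.1, Or.inl hP.2⟩
    refine ⟨g₁.trans g₂, x', y', hg₁.trans hg₂, ?_, k2, k3, ?_, ?_⟩
    · intro P hP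
      rw [Homeomorph.trans_apply, h1 P hP, k1 P hP]
    · rw [Homeomorph.trans_apply, h3, k4]
    · rw [image_trans, h2, k5]

/-! ### Standard position of a tripod -/

/-- Three polygonal arcs that start in `p` and meet in no other point. -/
structure Tripod (p q₁ q₂ q₃ : RP2) (L₁ L₂ L₃ : Set RP2) : Prop where
  arc₁ : PolyArc p q₁ L₁
  arc₂ : PolyArc p q₂ L₂
  arc₃ : PolyArc p q₃ L₃
  inter₁₂ : L₁ ∩ L₂ ⊆ {p}
  inter₁₃ : L₁ ∩ L₃ ⊆ {p}
  inter₂₃ : L₂ ∩ L₃ ⊆ {p}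

namespace Tripod
variable {p q₁ q₂ q₃ : RP2} {L₁ L₂ L₃ : Set RP2}

lemma rotate (h : Tripod p q₁ q₂ q₃ L₁ L₂ L₃) : Tripod p q₂ q₃ q₁ L₂ L₃ L₁ :=
  ⟨h.arc₂, h.arc₃, h.arc₁, h.inter₂₃, by rw [inter_comm]; exact h.inter₁₂,
    by rw [inter_comm]; exact h.inter₁₃⟩

lemma map (h : Tripod p q₁ q₂ q₃ L₁ L₂ L₃) {g : RP2 ≃ₜ RP2} (hg : IsPL g) :
    Tripod (g p) (g q₁) (g q₂) (g q₃) (g '' L₁) (g '' L₂) (g '' L₃) := by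
  have key : ∀ A B : Set RP2, A ∩ B ⊆ {p} → g '' A ∩ g '' B ⊆ {g p} := by
    intro A B hAB
    rw [← image_inter g.injective]
    rintro _ ⟨P, hP, rfl⟩
    rw [hAB hP]
    rfl
  exact ⟨hg.1 _ _ _ h.arc₁, hg.1 _ _ _ h.arc₂, hg.1 _ _ _ h.arc₃, key _ _ h.inter₁₂,
    key _ _ h.inter₁₃, key _ _ h.inter₂₃⟩

lemma exists_shrink_first {z : Vec} (hz : z ≠ 0) (h : Tripod (pt z) q₁ q₂ q₃ L₁ L₂ L₃) :
    ∃ (g : RP2 ≃ₜ RP2) (y : Vec), IsPL g ∧ (∀ P ∈ L₂ ∪ L₃, g P = P) ∧ g '' L₁ = seg z y ∧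
      Tripod (pt z) (pt y) q₂ q₃ (seg z y) L₂ L₃ ∧ g q₁ = pt y := by
  obtain ⟨g, x, y, hg, h1, hind, hx, h2, h3⟩ := exists_shrink h.arc₁
    (h.arc₂.isClosed.union h.arc₃.isClosed) (by
      rintro P ⟨hP | hP, hP'⟩
      · exact h.inter₁₂ ⟨hP', hP⟩
      · exact h.inter₁₃ ⟨hP', hP⟩)
  obtain ⟨c, hc, rfl⟩ := (pt_eq_pt_iff hind.left_ne_zero hz).1 hx
  have e : seg (c • z) y = seg z (c⁻¹ • y) := by
    rw [← seg_smul_same hc z, smul_smul, mul_inv_cancel₀ hc, one_smul]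
  have hm := h.map hg
  rw [h1 _ (Or.inl h.arc₂.start_mem), h1 _ (Or.inl h.arc₂.end_mem),
    h1 _ (Or.inr h.arc₃.end_mem), image_eq_self fun P hP => h1 P (Or.inl hP),
    image_eq_self fun P hP => h1 P (Or.inr hP), h3, h2, e,
    ← pt_smul (inv_ne_zero hc) y] at hm
  exact ⟨g, c⁻¹ • y, hg, h1, by rw [h3, e], hm, by rw [h2, pt_smul (inv_ne_zero hc)]⟩

end Tripod

/-- A tripod that consists of three segments. -/
structure StraightTripod (z y₁ y₂ y₃ : Vec) : Prop where
  indep₁ : Indep2 z y₁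
  indep₂ : Indep2 z y₂
  indep₃ : Indep2 z y₃
  inter₁₂ : seg z y₁ ∩ seg z y₂ ⊆ {pt z}
  inter₁₃ : seg z y₁ ∩ seg z y₃ ⊆ {pt z}
  inter₂₃ : seg z y₂ ∩ seg z y₃ ⊆ {pt z}

lemma Tripod.exists_straight {p q₁ q₂ q₃ : RP2} {L₁ L₂ L₃ : Set RP2}
    (h : Tripod p q₁ q₂ q₃ L₁ L₂ L₃) : ∃ (g : RP2 ≃ₜ RP2) (z y₁ y₂ y₃ : Vec), IsPL g ∧
      StraightTripod z y₁ y₂ y₃ ∧ g p = pt z ∧ g q₁ = pt y₁ ∧ g q₂ = pt y₂ ∧ g q₃ = pt y₃ ∧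
      g '' L₁ = seg z y₁ ∧ g '' L₂ = seg z y₂ ∧ g '' L₃ = seg z y₃ := by
  obtain ⟨z, hz, rfl⟩ := exists_eq_pt p
  obtain ⟨g₁, y₁, hg₁, f₁, i₁, t₁, e₁⟩ := h.exists_shrink_first hz
  obtain ⟨g₂, y₂, hg₂, f₂, i₂, t₂, e₂⟩ := t₁.rotate.exists_shrink_first hz
  obtain ⟨g₃, y₃, hg₃, f₃, i₃, t₃, e₃⟩ := t₂.rotate.exists_shrink_first hz
  have ind : ∀ y, PolyArc (pt z) (pt y) (seg z y) → y ≠ 0 → Indep2 z y := fun y hy h0 =>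
    Indep2.of_pt_ne hz h0 hy.ne
  have hne : ∀ y, PolyArc (pt z) (pt y) (seg z y) → Indep2 z y := by
    intro y hy s t e
    obtain ⟨x', w', h', hx', F⟩ := hy.exists_first
    by_cases h0 : y = 0
    · -- the segment from `z` to `0` is a single point and no arc
      exfalso
      have : pt y ∈ seg z y := hy.end_mem
      obtain ⟨v, ⟨a, b, ha, hb, rfl⟩, hv, e⟩ := this
      have ha0 : a ≠ 0 := by
        rintro rfl
        simp [h0] at hv
      rw [h0, smul_zero, add_zero, pt_smul ha0, ← h0] at e
      exact hy.ne e.symm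
    · exact ind y hy h0 s t e
  refine ⟨g₁.trans (g₂.trans g₃), z, y₁, y₂, y₃, hg₁.trans (hg₂.trans hg₃),
    ⟨hne _ t₃.arc₂, hne _ t₃.arc₃, hne _ t₃.arc₁, t₃.inter₂₃, ?_, ?_⟩, ?_, ?_, ?_, ?_, ?_, ?_, ?_⟩
  · rw [inter_comm]; exact t₃.inter₁₂
  · rw [inter_comm]; exact t₃.inter₁₃
  · rw [Homeomorph.trans_apply, Homeomorph.trans_apply, f₁ _ (Or.inl h.arc₂.start_mem),
      f₂ _ (Or.inr t₁.arc₁.start_mem), f₃ _ (Or.inr t₂.arc₁.start_mem)]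
  · rw [Homeomorph.trans_apply, Homeomorph.trans_apply, e₁, f₂ _ (Or.inr t₁.arc₁.end_mem),
      f₃ _ (Or.inl t₂.arc₃.end_mem)]
  · rw [Homeomorph.trans_apply, Homeomorph.trans_apply, f₁ _ (Or.inl h.arc₂.end_mem),
      e₂, f₃ _ (Or.inr t₂.arc₁.end_mem)]
  · rw [Homeomorph.trans_apply, Homeomorph.trans_apply, f₁ _ (Or.inr h.arc₃.end_mem),
      f₂ _ (Or.inl t₁.arc₃.end_mem), e₃]
  · rw [image_trans, image_trans, i₁, image_eq_self fun P hP => f₂ P (Or.inr hP),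
      image_eq_self fun P hP => f₃ P (Or.inl hP)]
  · rw [image_trans, image_trans, image_eq_self fun P hP => f₁ P (Or.inl hP), i₂,
      image_eq_self fun P hP => f₃ P (Or.inr hP)]
  · rw [image_trans, image_trans, image_eq_self fun P hP => f₁ P (Or.inr hP),
      image_eq_self fun P hP => f₂ P (Or.inl hP), i₃]

/-- A piecewise linear homeomorphism maps the straight tripod to one whose centre is an interior
point of the triangle spanned by its ends. -/
def HasStandardPosition (z y₁ y₂ y₃ : Vec) : Prop :=
  ∃ (g : RP2 ≃ₜ RP2) (x₁ x₂ x₃ : Vec), IsPL g ∧ Indep3 x₁ x₂ x₃ ∧ g (pt z) = pt (x₁ + x₂ + x₃) ∧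
    g (pt y₁) = pt x₁ ∧ g (pt y₂) = pt x₂ ∧ g (pt y₃) = pt x₃ ∧
    g '' seg z y₁ = seg (x₁ + x₂ + x₃) x₁ ∧ g '' seg z y₂ = seg (x₁ + x₂ + x₃) x₂ ∧
    g '' seg z y₃ = seg (x₁ + x₂ + x₃) x₃

namespace HasStandardPosition
variable {z y₁ y₂ y₃ : Vec}

lemma rotate (h : HasStandardPosition z y₁ y₂ y₃) : HasStandardPosition z y₂ y₃ y₁ := by
  obtain ⟨g, x₁, x₂, x₃, hg, hx, h0, h1, h2, h3, h4, h5, h6⟩ := h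
  have e : x₂ + x₃ + x₁ = x₁ + x₂ + x₃ := by abel
  exact ⟨g, x₂, x₃, x₁, hg, hx.rotate, by rw [e, h0], h2, h3, h1, by rw [e, h5], by rw [e, h6],
    by rw [e, h4]⟩

lemma swap (h : HasStandardPosition z y₁ y₂ y₃) : HasStandardPosition z y₂ y₁ y₃ := by
  obtain ⟨g, x₁, x₂, x₃, hg, hx, h0, h1, h2, h3, h4, h5, h6⟩ := h
  have e : x₂ + x₁ + x₃ = x₁ + x₂ + x₃ := by abel
  exact ⟨g, x₂, x₁, x₃, hg, hx.swap, by rw [e, h0], h2, h1, h3, by rw [e, h5], by rw [e, h4],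
    by rw [e, h6]⟩

lemma of_smul {a b c : ℝ} (ha : 0 < a) (hb : 0 < b) (hc : 0 < c)
    (h : HasStandardPosition z (a • y₁) (b • y₂) (c • y₃)) : HasStandardPosition z y₁ y₂ y₃ := by
  have e : ∀ {r : ℝ} (y : Vec), 0 < r → seg z (r • y) = seg z y := fun y hr => by
    have := seg_smul one_pos hr z y
    rwa [one_smul] at this
  unfold HasStandardPosition at h ⊢
  rwa [e _ ha, e _ hb, e _ hc, pt_smul ha.ne', pt_smul hb.ne', pt_smul hc.ne'] at h

end HasStandardPosition

namespace StraightTripod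
variable {z y₁ y₂ y₃ : Vec}

lemma rotate (h : StraightTripod z y₁ y₂ y₃) : StraightTripod z y₂ y₃ y₁ :=
  ⟨h.indep₂, h.indep₃, h.indep₁, h.inter₂₃, by rw [inter_comm]; exact h.inter₁₂,
    by rw [inter_comm]; exact h.inter₁₃⟩

lemma swap (h : StraightTripod z y₁ y₂ y₃) : StraightTripod z y₂ y₁ y₃ :=
  ⟨h.indep₂, h.indep₁, h.indep₃, by rw [inter_comm]; exact h.inter₁₂, h.inter₂₃, h.inter₁₃⟩

lemma smul {a b c : ℝ} (ha : 0 < a) (hb : 0 < b) (hc : 0 < c)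
    (h : StraightTripod z y₁ y₂ y₃) : StraightTripod z (a • y₁) (b • y₂) (c • y₃) := by
  have e : ∀ {r : ℝ} (y : Vec), 0 < r → seg z (r • y) = seg z y := fun y hr => by
    have := seg_smul one_pos hr z y
    rwa [one_smul] at this
  have i : ∀ {r : ℝ} (y : Vec), 0 < r → Indep2 z y → Indep2 z (r • y) := fun y hr hy => by
    have := hy.combo_right (s := 0) hr.ne'
    simpa using this
  exact ⟨i _ ha h.indep₁, i _ hb h.indep₂, i _ hc h.indep₃, by rw [e _ ha, e _ hb]; exact h.inter₁₂,
    by rw [e _ ha, e _ hc]; exact h.inter₁₃, by rw [e _ hb, e _ hc]; exact h.inter₂₃⟩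

/-- Two segments on one projective line leave the centre in opposite directions. -/
lemma coeff_nonpos (h : StraightTripod z y₁ y₂ y₃) {s t : ℝ} (e : y₂ = s • z + t • y₁) :
    t ≤ 0 := by
  by_contra! ht
  have e1 : |s| • z + (1 : ℝ) • y₂ = (|s| + s) • z + t • y₁ := by rw [e]; module
  have h0 : |s| • z + (1 : ℝ) • y₂ ≠ 0 := h.indep₂.ne_zero (by simp)
  have m2 : pt (|s| • z + (1 : ℝ) • y₂) ∈ seg z y₂ := pt_mem_seg (abs_nonneg _) zero_le_one h0
  have m1 : pt (|s| • z + (1 : ℝ) • y₂) ∈ seg z y₁ := by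
    rw [e1] at h0 ⊢
    exact pt_mem_seg (by linarith [neg_abs_le s]) ht.le h0
  exact (h.indep₂.combo_right (s := |s|) one_ne_zero).pt_ne (h.inter₁₂ ⟨m1, m2⟩).symm

/-- The three segments do not lie on one projective line. -/
lemma not_collinear (h : StraightTripod z y₁ y₂ y₃) {s t s' t' : ℝ} (e : y₂ = s • z + t • y₁)
    (e' : y₃ = s' • z + t' • y₁) : False := by
  have h1 := h.coeff_nonpos e
  have h2 := h.rotate.rotate.swap.coeff_nonpos (s := s') (t := t') e'
  have t0 : t < 0 := lt_of_le_of_ne h1 fun h0 => by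
    subst h0
    exact one_ne_zero (h.indep₂ (-s) 1 (by rw [e]; module)).2
  have t0' : t' < 0 := lt_of_le_of_ne h2 fun h0 => by
    subst h0
    exact one_ne_zero (h.indep₃ (-s') 1 (by rw [e']; module)).2
  have et : t' = t' / t * t := (div_mul_cancel₀ _ t0.ne).symm
  have h3 := h.rotate.coeff_nonpos (s := s' - t' / t * s) (t := t' / t) (by
    generalize t' / t = r at et
    rw [e, e', et]
    module)
  have : 0 < t' / t := div_pos_of_neg_of_neg t0' t0
  linarith

lemma indep3_of_add_eq (h : StraightTripod z y₁ y₂ y₃) {ν : ℝ} (e : y₁ + y₂ + y₃ = ν • z) :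
    Indep3 z y₁ y₂ := by
  refine Indep3.of_not_mem h.indep₁ fun s t e2 => ?_
  refine h.not_collinear e2 (s' := ν - s) (t' := -(1 + t)) ?_
  have : y₃ = ν • z - y₁ - y₂ := by rw [← e]; abel
  rw [this, e2]
  module

/-- If the three ends add up to a multiple of the centre, then it is enough to shorten the segments:
this makes the multiple positive. -/
lemma hasStandardPosition_of_add_eq (h : StraightTripod z y₁ y₂ y₃) {ν : ℝ}
    (e : y₁ + y₂ + y₃ = ν • z) : HasStandardPosition z y₁ y₂ y₃ := by
  have hind := h.indep3_of_add_eq e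
  set c := |ν| + 1 with hc
  have hc0 : 0 < c := by positivity
  have hN : 0 < ν + 3 * c := by linarith [neg_abs_le ν, abs_nonneg ν]
  have sp : ∀ y : Vec, seg z y = seg z (y + c • z) ∪ seg (y + c • z) y := fun y => by
    have := seg_split hc0 one_pos (x := z) (y := y)
    rwa [show c • z + (1 : ℝ) • y = y + c • z by module] at this
  have i1 : ∀ y, Indep2 z y → Indep2 z (y + c • z) := fun y hy => by
    have := hy.combo_right (s := c) one_ne_zero
    rwa [show c • z + (1 : ℝ) • y = y + c • z by module] at this
  have i2 : ∀ y, Indep2 z y → Indep2 (y + c • z) y := fun y hy => by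
    have := hy.combo_left (t := 1) hc0.ne'
    rwa [show c • z + (1 : ℝ) • y = y + c • z by module] at this
  have i3 : ∀ y, Indep2 z y → seg z (y + c • z) ∩ seg (y + c • z) y ⊆ {pt (y + c • z)} :=
    fun y hy => by
      have := seg_split_inter hy hc0 one_pos
      rwa [show c • z + (1 : ℝ) • y = y + c • z by module] at this
  -- a segment is shortened to a point from which the centre is a positive combination
  have step : ∀ y K, Indep2 z y → IsClosed K → K ∩ seg z y ⊆ {pt z} → ∃ g : RP2 ≃ₜ RP2,
      IsPL g ∧ (∀ P ∈ K, g P = P) ∧ g '' seg z y = seg z (y + c • z) ∧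
        g (pt y) = pt (y + c • z) := by
    intro y K hy hK hKy
    rw [sp y] at hKy ⊢
    exact exists_retract (.single z _ (i1 y hy) rfl) (i2 y hy) (i3 y hy) hK hKy
  have cl : ∀ y, Indep2 z y → IsClosed (seg z y) := fun y hy => isClosed_seg hy
  obtain ⟨g₁, hg₁, f₁, m₁, e₁⟩ := step y₁ (seg z y₂ ∪ seg z y₃) h.indep₁
    ((cl _ h.indep₂).union (cl _ h.indep₃)) (by
      rintro P ⟨hP | hP, hP'⟩
      · exact h.inter₁₂ ⟨hP', hP⟩
      · exact h.inter₁₃ ⟨hP', hP⟩)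
  obtain ⟨g₂, hg₂, f₂, m₂, e₂⟩ := step y₂ (seg z (y₁ + c • z) ∪ seg z y₃) h.indep₂
    ((cl _ (i1 _ h.indep₁)).union (cl _ h.indep₃)) (by
      rintro P ⟨hP | hP, hP'⟩
      · exact h.inter₁₂ ⟨sp y₁ ▸ Or.inl hP, hP'⟩
      · exact h.inter₂₃ ⟨hP', hP⟩)
  obtain ⟨g₃, hg₃, f₃, m₃, e₃⟩ := step y₃ (seg z (y₁ + c • z) ∪ seg z (y₂ + c • z)) h.indep₃
    ((cl _ (i1 _ h.indep₁)).union (cl _ (i1 _ h.indep₂))) (by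
      rintro P ⟨hP | hP, hP'⟩
      · exact h.inter₁₃ ⟨sp y₁ ▸ Or.inl hP, hP'⟩
      · exact h.inter₂₃ ⟨sp y₂ ▸ Or.inl hP, hP'⟩)
  have ez : (y₁ + c • z) + (y₂ + c • z) + (y₃ + c • z) = (ν + 3 * c) • z := by
    have : (y₁ + c • z) + (y₂ + c • z) + (y₃ + c • z) = (y₁ + y₂ + y₃) + (3 * c) • z := by module
    rw [this, e]; module
  have sz : ∀ y, seg ((ν + 3 * c) • z) y = seg z y := fun y => by
    have := seg_smul hN one_pos z y
    rwa [one_smul] at this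
  have z₂ : pt z ∈ seg z y₂ := left_mem_seg h.indep₁.left_ne_zero
  refine ⟨g₁.trans (g₂.trans g₃), y₁ + c • z, y₂ + c • z, y₃ + c • z, hg₁.trans (hg₂.trans hg₃),
    ?_, ?_, ?_, ?_, ?_, ?_, ?_, ?_⟩
  · intro r s t e0
    have e3 : y₃ = ν • z - y₁ - y₂ := by rw [← e]; abel
    obtain ⟨a1, a2, a3⟩ := hind (r * c + s * c + t * (ν + c)) (r - t) (s - t) (by
      rw [← e0, e3]; module)
    have hr : r = t := by linarith
    have hs : s = t := by linarith
    have ht : t * (ν + 3 * c) = 0 := by rw [← a1, hr, hs]; ring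
    have ht0 : t = 0 := (mul_eq_zero.1 ht).resolve_right hN.ne'
    exact ⟨hr.trans ht0, hs.trans ht0, ht0⟩
  · rw [ez, pt_smul hN.ne', Homeomorph.trans_apply, Homeomorph.trans_apply, f₁ _ (Or.inl z₂),
      f₂ _ (Or.inl (left_mem_seg h.indep₁.left_ne_zero)),
      f₃ _ (Or.inl (left_mem_seg h.indep₁.left_ne_zero))]
  · have m : pt (y₁ + c • z) ∈ seg z (y₁ + c • z) := right_mem_seg (i1 _ h.indep₁).right_ne_zero
    rw [Homeomorph.trans_apply, Homeomorph.trans_apply, e₁, f₂ _ (Or.inl m), f₃ _ (Or.inl m)]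
  · have m : pt (y₂ + c • z) ∈ seg z (y₂ + c • z) := right_mem_seg (i1 _ h.indep₂).right_ne_zero
    rw [Homeomorph.trans_apply, Homeomorph.trans_apply,
      f₁ _ (Or.inl (right_mem_seg h.indep₂.right_ne_zero)), e₂, f₃ _ (Or.inr m)]
  · rw [Homeomorph.trans_apply, Homeomorph.trans_apply,
      f₁ _ (Or.inr (right_mem_seg h.indep₃.right_ne_zero)),
      f₂ _ (Or.inr (right_mem_seg h.indep₃.right_ne_zero)), e₃]
  · rw [ez, sz, image_trans, image_trans, m₁, image_eq_self fun P hP => f₂ P (Or.inl hP),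
      image_eq_self fun P hP => f₃ P (Or.inl hP)]
  · rw [ez, sz, image_trans, image_trans, image_eq_self fun P hP => f₁ P (Or.inl hP), m₂,
      image_eq_self fun P hP => f₃ P (Or.inr hP)]
  · rw [ez, sz, image_trans, image_trans, image_eq_self fun P hP => f₁ P (Or.inr hP),
      image_eq_self fun P hP => f₂ P (Or.inr hP), m₃]

/-- If the segment to `y₁` leaves the centre between the other two segments (within a half plane),
then the centre is moved along this segment until it lies between the others, which are thereby
bent, and these are shortened to their inner pieces. -/
lemma hasStandardPosition_of_between (h : StraightTripod z y₁ y₂ y₃) (hind : Indep3 z y₁ y₂)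
    {μ ν : ℝ} (hμ : 0 ≤ μ) (e : y₂ + y₃ = μ • y₁ + ν • z) : HasStandardPosition z y₁ y₂ y₃ := by
  set c := |ν| + 1 with hc
  have hc0 : 0 < c := by positivity
  set N := ν + 2 * c with hNdef
  have hcN : c ≤ N := by linarith [neg_abs_le ν]
  have hN : 0 < N := by linarith
  set a := y₂ + c • z with ha
  set b := y₃ + c • z with hb
  have eab : a + b = μ • y₁ + N • z := by
    have : a + b = (y₂ + y₃) + (2 * c) • z := by rw [ha, hb]; module
    rw [this, e, hNdef]; module
  have eb : b = μ • y₁ + N • z - a := by rw [← eab]; abel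
  have iab : Indep3 y₁ a b := by
    intro r s t e0
    obtain ⟨a1, a2, a3⟩ := hind (s * c + t * (N - c)) (r + t * μ) (s - t) (by
      rw [← e0, eb, ha]; module)
    have hs : s = t := by linarith
    have ht : t * N = 0 := by rw [hs] at a1; linarith
    have ht0 : t = 0 := (mul_eq_zero.1 ht).resolve_right hN.ne'
    subst ht0
    exact ⟨by linarith, hs, rfl⟩
  set ε := μ + 1 with hε
  have hi : Indep3 y₁ (a - ε • y₁) (b - ε • y₁) := by
    intro r s t e0
    obtain ⟨a1, a2, a3⟩ := iab (r - ε * (s + t)) s t (by rw [← e0]; module)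
    subst a2 a3
    exact ⟨by linarith, rfl, rfl⟩
  set q := y₁ + a + b with hq
  have ez : N • z = (2 * ε - μ) • y₁ + (1 : ℝ) • (a - ε • y₁) + (1 : ℝ) • (b - ε • y₁) := by
    rw [eb]; module
  obtain ⟨g, hg⟩ := exists_isConeMove hi (p := N • z) (q := q)
    ⟨_, _, _, by linarith, one_pos, one_pos, ez⟩
    ⟨2 * ε + 1, 1, 1, by linarith, one_pos, one_pos, by rw [hq]; module⟩
  have sz : ∀ y, seg z y = seg (N • z) y := fun y => by
    have := seg_smul hN one_pos z y
    rw [one_smul] at this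
    exact this.symm
  have iz : ∀ y, Indep2 z y → Indep2 (N • z) y := fun y hy => by
    have := hy.combo_left (t := 0) hN.ne'
    simpa using this
  have sp : ∀ y : Vec, seg z y = seg z (y + c • z) ∪ seg (y + c • z) y := fun y => by
    have := seg_split hc0 one_pos (x := z) (y := y)
    rwa [show c • z + (1 : ℝ) • y = y + c • z by module] at this
  have i1 : ∀ y, Indep2 z y → Indep2 z (y + c • z) := fun y hy => by
    have := hy.combo_right (s := c) one_ne_zero
    rwa [show c • z + (1 : ℝ) • y = y + c • z by module] at this
  have i2 : ∀ y, Indep2 z y → Indep2 (y + c • z) y := fun y hy => by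
    have := hy.combo_left (t := 1) hc0.ne'
    rwa [show c • z + (1 : ℝ) • y = y + c • z by module] at this
  have i3 : ∀ y, Indep2 z y → seg z (y + c • z) ∩ seg (y + c • z) y ⊆ {pt (y + c • z)} :=
    fun y hy => by
      have := seg_split_inter hy hc0 one_pos
      rwa [show c • z + (1 : ℝ) • y = y + c • z by module] at this
  -- the images of the three segments
  have jq₁ : Indep2 q y₁ := fun s t e0 => by
    obtain ⟨a1, a2, a3⟩ := iab (s + t) s s (by rw [← e0, hq]; module)
    exact ⟨a2, by linarith⟩
  have jqa : Indep2 q a := fun s t e0 => by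
    obtain ⟨a1, a2, a3⟩ := iab s (s + t) s (by rw [← e0, hq]; module)
    exact ⟨a1, by linarith⟩
  have jqb : Indep2 q b := fun s t e0 => by
    obtain ⟨a1, a2, a3⟩ := iab s s (s + t) (by rw [← e0, hq]; module)
    exact ⟨a1, by linarith⟩
  have hε0 : 0 ≤ ε := by linarith
  have n₁ : g '' seg z y₁ = seg q y₁ := by
    rw [sz]
    refine image_seg_eq (iz _ h.indep₁) jq₁ fun s t hs ht hne => ?_
    have e1 : ∀ v : Vec, s • v + t • y₁ = t • y₁ + (0 : ℝ) • (a - ε • y₁) +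
      (0 : ℝ) • (b - ε • y₁) + s • v := fun v => by module
    rw [e1] at hne ⊢
    rw [hg.map _ _ _ _ ht le_rfl le_rfl hs (by simp) hne, ← e1]
  have na : g '' seg z a = seg q a := by
    rw [sz]
    refine image_seg_eq (iz _ (i1 _ h.indep₂)) jqa fun s t hs ht hne => ?_
    have e1 : ∀ v : Vec, s • v + t • a = (t * ε) • y₁ + t • (a - ε • y₁) +
      (0 : ℝ) • (b - ε • y₁) + s • v := fun v => by module
    rw [e1] at hne ⊢
    rw [hg.map _ _ _ _ (by positivity) ht le_rfl hs (by simp) hne, ← e1]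
  have nb : g '' seg z b = seg q b := by
    rw [sz]
    refine image_seg_eq (iz _ (i1 _ h.indep₃)) jqb fun s t hs ht hne => ?_
    have e1 : ∀ v : Vec, s • v + t • b = (t * ε) • y₁ + (0 : ℝ) • (a - ε • y₁) +
      t • (b - ε • y₁) + s • v := fun v => by module
    rw [e1] at hne ⊢
    rw [hg.map _ _ _ _ (by positivity) le_rfl ht hs (by simp) hne, ← e1]
  have ez' : z = ((2 * ε - μ) / N) • y₁ + (1 / N) • (a - ε • y₁) + (1 / N) • (b - ε • y₁) := by
    have : z = (1 / N) • (N • z) := by rw [smul_smul, one_div_mul_cancel hN.ne', one_smul]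
    rw [this, ez, smul_add, smul_add, smul_smul, smul_smul, smul_smul, mul_one, one_div_mul_eq_div]
  have fa : ∀ P ∈ seg a y₂, g P = P := by
    rintro _ ⟨v, ⟨s, t, hs, ht, rfl⟩, hv, rfl⟩
    have e1 : s • a + t • y₂ = ((s + t) * ε - t * c * ((2 * ε - μ) / N)) • y₁ +
        ((s + t) - t * (c * (1 / N))) • (a - ε • y₁) + (-(t * c * (1 / N))) • (b - ε • y₁) := by
      have : y₂ = a - c • z := by rw [ha]; abel
      rw [this]
      nth_rw 1 [ez']
      module
    rw [e1] at hv ⊢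
    refine hg.fix _ _ _ hv (Or.inr (Or.inr ?_)) (Or.inr (Or.inl ?_))
    · rw [neg_nonpos]; positivity
    · have : c * (1 / N) ≤ 1 := by rw [mul_one_div, div_le_one hN]; exact hcN
      nlinarith
  have fb : ∀ P ∈ seg b y₃, g P = P := by
    rintro _ ⟨v, ⟨s, t, hs, ht, rfl⟩, hv, rfl⟩
    have e1 : s • b + t • y₃ = ((s + t) * ε - t * c * ((2 * ε - μ) / N)) • y₁ +
        (-(t * c * (1 / N))) • (a - ε • y₁) + ((s + t) - t * (c * (1 / N))) • (b - ε • y₁) := by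
      have : y₃ = b - c • z := by rw [hb]; abel
      rw [this]
      nth_rw 1 [ez']
      module
    rw [e1] at hv ⊢
    refine hg.fix _ _ _ hv (Or.inr (Or.inl ?_)) (Or.inr (Or.inr ?_))
    · rw [neg_nonpos]; positivity
    · have : c * (1 / N) ≤ 1 := by rw [mul_one_div, div_le_one hN]; exact hcN
      nlinarith
  have n₂ : g '' seg z y₂ = seg q a ∪ seg a y₂ := by
    rw [sp y₂, image_union, ← ha, na, image_eq_self fa]
  have n₃ : g '' seg z y₃ = seg q b ∪ seg b y₃ := by
    rw [sp y₃, image_union, ← hb, nb, image_eq_self fb]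
  have gz : g (pt z) = pt q := by
    have e1 : ∀ v : Vec, v = (0 : ℝ) • y₁ + (0 : ℝ) • (a - ε • y₁) + (0 : ℝ) • (b - ε • y₁) +
      (1 : ℝ) • v := fun v => by module
    rw [← pt_smul hN.ne' z, e1 (N • z), hg.map _ _ _ _ le_rfl le_rfl le_rfl zero_le_one (by simp)
      (by rw [← e1]; exact smul_ne_zero hN.ne' h.indep₁.left_ne_zero), ← e1]
  have g1 : g (pt y₁) = pt y₁ := by
    have e1 : y₁ = (1 : ℝ) • y₁ + (0 : ℝ) • (a - ε • y₁) + (0 : ℝ) • (b - ε • y₁) := by module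
    rw [e1]
    exact hg.fix _ _ _ (by rw [← e1]; exact h.indep₁.right_ne_zero) (by simp) (by simp)
  have g2 : g (pt y₂) = pt y₂ := fa _ (right_mem_seg h.indep₂.right_ne_zero)
  have g3 : g (pt y₃) = pt y₃ := fb _ (right_mem_seg h.indep₃.right_ne_zero)
  have key : ∀ {A B C D : Set RP2} {P : Vec}, A ∩ B ⊆ {pt P} → g '' A = C → g '' B = D →
      C ∩ D ⊆ {g (pt P)} := by
    rintro A B _ _ P hAB rfl rfl
    rw [← image_inter g.injective]
    rintro _ ⟨P, hP, rfl⟩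
    rw [hAB hP]
    rfl
  have ga : g (pt a) = pt a := fa _ (left_mem_seg (i1 _ h.indep₂).right_ne_zero)
  have gb : g (pt b) = pt b := fb _ (left_mem_seg (i1 _ h.indep₃).right_ne_zero)
  have k₁₂ := key h.inter₁₂ n₁ n₂
  have k₁₃ := key h.inter₁₃ n₁ n₃
  have k₂₃ := key h.inter₂₃ n₂ n₃
  have ka := key (i3 _ h.indep₂) na (image_eq_self fa)
  have kb := key (i3 _ h.indep₃) nb (image_eq_self fb)
  rw [gz] at k₁₂ k₁₃ k₂₃
  rw [← ha, ga] at ka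
  rw [← hb, gb] at kb
  -- the outer pieces of the bent segments are retracted
  obtain ⟨g', hg', f', m', e'⟩ := exists_retract (K := seg q y₁ ∪ (seg q b ∪ seg b y₃))
    (.single q a jqa rfl) (i2 _ h.indep₂) ka
    ((isClosed_seg jq₁).union ((isClosed_seg jqb).union (isClosed_seg (i2 _ h.indep₃)))) (by
      rintro P ⟨hP | hP, hP'⟩
      · exact k₁₂ ⟨hP, hP'⟩
      · exact k₂₃ ⟨hP', hP⟩)
  obtain ⟨g'', hg'', f'', m'', e''⟩ := exists_retract (K := seg q y₁ ∪ seg q a)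
    (.single q b jqb rfl) (i2 _ h.indep₃) kb ((isClosed_seg jq₁).union (isClosed_seg jqa)) (by
      rintro P ⟨hP | hP, hP'⟩
      · exact k₁₃ ⟨hP, hP'⟩
      · exact k₂₃ ⟨Or.inl hP, hP'⟩)
  have q₁ : pt q ∈ seg q y₁ := left_mem_seg jq₁.left_ne_zero
  have r₁ : pt y₁ ∈ seg q y₁ := right_mem_seg jq₁.right_ne_zero
  refine ⟨g.trans (g'.trans g''), y₁, a, b, hg.isPL.trans (hg'.trans hg''), iab,
    ?_, ?_, ?_, ?_, ?_, ?_, ?_⟩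
  · rw [Homeomorph.trans_apply, Homeomorph.trans_apply, gz, f' _ (Or.inl q₁), f'' _ (Or.inl q₁)]
  · rw [Homeomorph.trans_apply, Homeomorph.trans_apply, g1, f' _ (Or.inl r₁), f'' _ (Or.inl r₁)]
  · rw [Homeomorph.trans_apply, Homeomorph.trans_apply, g2, e',
      f'' _ (Or.inr (right_mem_seg jqa.right_ne_zero))]
  · rw [Homeomorph.trans_apply, Homeomorph.trans_apply, g3,
      f' _ (Or.inr (Or.inr (right_mem_seg h.indep₃.right_ne_zero))), e'']
  · rw [image_trans, image_trans, n₁, image_eq_self fun P hP => f' P (Or.inl hP),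
      image_eq_self fun P hP => f'' P (Or.inl hP)]
  · rw [image_trans, image_trans, n₂, m', image_eq_self fun P hP => f'' P (Or.inr hP)]
  · rw [image_trans, image_trans, n₃, image_eq_self fun P hP => f' P (Or.inr hP), m'']

/-- The linear relation between the centre and the three ends, with its signs, decides whether the
centre lies between the three segments or one of the segments lies between the two others. -/
theorem hasStandardPosition (h : StraightTripod z y₁ y₂ y₃) : HasStandardPosition z y₁ y₂ y₃ := by
  have main : ∀ {y₁ y₂ y₃ : Vec}, StraightTripod z y₁ y₂ y₃ → Indep3 z y₁ y₂ →
      HasStandardPosition z y₁ y₂ y₃ := by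
    intro y₁ y₂ y₃ h hind
    obtain ⟨s, t, u, e⟩ := hind.exists_coord y₃
    rcases lt_or_ge t 0 with ht | ht <;> rcases lt_or_ge u 0 with hu | hu
    · refine .of_smul (neg_pos.2 ht) (neg_pos.2 hu) one_pos
        ((h.smul (neg_pos.2 ht) (neg_pos.2 hu) one_pos).hasStandardPosition_of_add_eq (ν := s) ?_)
      rw [e]; module
    · refine (HasStandardPosition.of_smul one_pos (neg_pos.2 ht) one_pos
        ((h.swap.smul one_pos (neg_pos.2 ht) one_pos).hasStandardPosition_of_between (μ := u)
          (ν := s) ?_ hu ?_)).swap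
      · intro a b c e0
        obtain ⟨a1, a2, a3⟩ := hind a (-t * c) b (by rw [← e0]; module)
        exact ⟨a1, a3, (mul_eq_zero.1 a2).resolve_left (by linarith)⟩
      · rw [e]; module
    · refine HasStandardPosition.of_smul one_pos (neg_pos.2 hu) one_pos
        ((h.smul one_pos (neg_pos.2 hu) one_pos).hasStandardPosition_of_between (μ := t)
          (ν := s) ?_ ht ?_)
      · intro a b c e0
        obtain ⟨a1, a2, a3⟩ := hind a b (-u * c) (by rw [← e0]; module)
        exact ⟨a1, a2, (mul_eq_zero.1 a3).resolve_left (by linarith)⟩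
      · rw [e]; module
    · have ht' : 0 < t := lt_of_le_of_ne ht fun h0 => by
        subst h0
        have h1 := h.rotate.coeff_nonpos (s := s) (t := u) (by rw [e]; module)
        have hu0 : u = 0 := le_antisymm h1 hu
        subst hu0
        exact one_ne_zero (h.indep₃ (-s) 1 (by rw [e]; module)).2
      have hu' : 0 < u := lt_of_le_of_ne hu fun h0 => by
        subst h0
        have h1 := h.rotate.rotate.swap.coeff_nonpos (s := s) (t := t) (by rw [e]; module)
        linarith
      refine (HasStandardPosition.of_smul one_pos ht' hu'
        ((h.rotate.rotate.smul one_pos ht' hu').hasStandardPosition_of_between (μ := 1)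
          (ν := -s) ?_ zero_le_one ?_)).rotate
      · intro a b c e0
        obtain ⟨a1, a2, a3⟩ := hind (a + b * s) (b * t + t * c) (b * u) (by
          rw [← e0, e]; module)
        have hb : b = 0 := (mul_eq_zero.1 a3).resolve_right hu'.ne'
        subst hb
        refine ⟨by linarith, rfl, ?_⟩
        have : t * c = 0 := by linarith
        exact (mul_eq_zero.1 this).resolve_left ht'.ne'
      · rw [e]; module
  by_cases h1 : Indep3 z y₁ y₂
  · exact main h h1
  by_cases h2 : Indep3 z y₁ y₃
  · exact (main h.rotate.rotate.swap h2).swap.rotate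
  exfalso
  obtain ⟨s, t, e⟩ : ∃ s t : ℝ, y₂ = s • z + t • y₁ := by
    by_contra! hc
    exact h1 (Indep3.of_not_mem h.indep₁ hc)
  obtain ⟨s', t', e'⟩ : ∃ s t : ℝ, y₃ = s • z + t • y₁ := by
    by_contra! hc
    exact h2 (Indep3.of_not_mem h.indep₁ hc)
  exact h.not_collinear e e'

end StraightTripod

/-- Every tripod can be mapped to the segments that join the centre `y₁ + y₂ + y₃` of a triangle
to its corners. -/
theorem Tripod.exists_standardPosition {p q₁ q₂ q₃ : RP2} {L₁ L₂ L₃ : Set RP2}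
    (h : Tripod p q₁ q₂ q₃ L₁ L₂ L₃) : ∃ (g : RP2 ≃ₜ RP2) (y₁ y₂ y₃ : Vec), IsPL g ∧
      Indep3 y₁ y₂ y₃ ∧ g p = pt (y₁ + y₂ + y₃) ∧ g q₁ = pt y₁ ∧ g q₂ = pt y₂ ∧ g q₃ = pt y₃ ∧
      g '' L₁ = seg (y₁ + y₂ + y₃) y₁ ∧ g '' L₂ = seg (y₁ + y₂ + y₃) y₂ ∧
      g '' L₃ = seg (y₁ + y₂ + y₃) y₃ := by
  obtain ⟨g, z, y₁, y₂, y₃, hg, hs, e0, e1, e2, e3, m1, m2, m3⟩ := h.exists_straight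
  obtain ⟨g', x₁, x₂, x₃, hg', hx, f0, f1, f2, f3, n1, n2, n3⟩ := hs.hasStandardPosition
  refine ⟨g.trans g', x₁, x₂, x₃, hg.trans hg', hx, ?_, ?_, ?_, ?_, ?_, ?_, ?_⟩
  · rw [Homeomorph.trans_apply, e0, f0]
  · rw [Homeomorph.trans_apply, e1, f1]
  · rw [Homeomorph.trans_apply, e2, f2]
  · rw [Homeomorph.trans_apply, e3, f3]
  · rw [image_trans, m1, n1]
  · rw [image_trans, m2, n2]
  · rw [image_trans, m3, n3]

/-! ### Transport of embeddings -/

lemma BoundsDisk.image {C : Set RP2} (h : BoundsDisk C) (g : RP2 ≃ₜ RP2) :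
    BoundsDisk (g '' C) := by
  obtain ⟨D, hD, rfl⟩ := h
  exact ⟨g ∘ D, g.isEmbedding.comp hD, image_comp g D _⟩

/-- Points that are not separated by `C` have images that are not separated by the image of `C`. -/
lemma connectedComponentIn_compl_image_eq {C : Set RP2} {P Q : RP2} (hP : P ∉ C) (hQ : Q ∉ C)
    (h : connectedComponentIn Cᶜ P = connectedComponentIn Cᶜ Q) (g : RP2 ≃ₜ RP2) :
    connectedComponentIn (g '' C)ᶜ (g P) = connectedComponentIn (g '' C)ᶜ (g Q) := by
  have e : (g '' C)ᶜ = g '' Cᶜ := (image_compl_eq g.bijective).symm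
  rw [e, ← g.image_connectedComponentIn hP, ← g.image_connectedComponentIn hQ, h]

namespace ProjectivePlanarEmbedding
variable {V : Type*} {G : SimpleGraph V} (f : ProjectivePlanarEmbedding G)

lemma polyArc {u v : V} (h : G.Adj u v) : PolyArc (f.point u) (f.point v) (f.arc s(u, v)) :=
  (isPLArc_iff_polyArc (f.point_injective.ne h.ne)).1 (f.isPLArc u v h)

lemma isClosed_arc {e : Sym2 V} (he : e ∈ G.edgeSet) : IsClosed (f.arc e) := by
  induction e with
  | h u v => exact (f.polyArc he).isClosed

lemma mem_support_of_point_mem_carrier {u v : V} (w : G.Walk u v) {a : V}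
    (h : f.point a ∈ f.carrier w) : a ∈ w.support := by
  obtain ⟨e, he, ha⟩ := h
  exact w.mem_support_of_mem_edges he (f.mem_of_point_mem_arc e (w.edges_subset_edgeSet he) a ha)

lemma isPLArc_of_isPL {g : RP2 ≃ₜ RP2} (hg : IsPL g) {p q : RP2} {A : Set RP2} (hpq : p ≠ q)
    (h : IsPLArc p q A) : IsPLArc (g p) (g q) (g '' A) :=
  (isPLArc_iff_polyArc (g.injective.ne hpq)).2 (hg.1 _ _ _ ((isPLArc_iff_polyArc hpq).1 h))

/-- The composition of an embedding with a piecewise linear homeomorphism. -/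
noncomputable def map (g : RP2 ≃ₜ RP2) (hg : IsPL g) : ProjectivePlanarEmbedding G where
  point v := g (f.point v)
  arc e := g '' f.arc e
  point_injective := g.injective.comp f.point_injective
  isPLArc u v h := isPLArc_of_isPL hg (f.point_injective.ne h.ne) (f.isPLArc u v h)
  mem_of_point_mem_arc e he v hv := by
    rw [g.injective.mem_set_image] at hv
    exact f.mem_of_point_mem_arc e he v hv
  arc_inter_arc e he e' he' hne p hp := by
    rw [← image_inter g.injective] at hp
    obtain ⟨P, hP, rfl⟩ := hp
    obtain ⟨v, h1, h2, h3⟩ := f.arc_inter_arc e he e' he' hne P hP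
    exact ⟨v, h1, h2, by rw [h3]⟩

lemma isSeparating_of_map (g : RP2 ≃ₜ RP2) (hg : IsPL g) (h : (f.map g hg).IsSeparating) :
    f.IsSeparating := by
  obtain ⟨u, C, hC, hD, a, b, ha, hb, hne⟩ := h
  have e : (f.map g hg).carrier C = g '' f.carrier C := by
    ext P
    constructor
    · rintro ⟨e, he, Q, hQ, rfl⟩
      exact ⟨Q, ⟨e, he, hQ⟩, rfl⟩
    · rintro ⟨Q, ⟨e, he, hQ⟩, rfl⟩
      exact ⟨e, he, Q, hQ, rfl⟩
  rw [e] at hD hne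
  refine ⟨u, C, hC, ?_, a, b, ha, hb, fun h => hne ?_⟩
  · have := hD.image g.symm
    rwa [← image_comp, g.symm_comp_self, image_id] at this
  · exact connectedComponentIn_compl_image_eq
      (fun h => ha (f.mem_support_of_point_mem_carrier C h))
      (fun h => hb (f.mem_support_of_point_mem_carrier C h)) h g

end ProjectivePlanarEmbedding

/-! ### Clearing the triangle around a tripod -/

/-- A closed set that misses the segment from `z` to `y` misses the thin triangles around it. -/
lemma eventually_wedge_of_isClosed {y z w : Vec} (h : Indep3 y z w) {F : Set RP2}
    (hF : IsClosed F) (hd : Disjoint F (seg z y)) :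
    ∀ᶠ ε : ℝ in nhdsWithin 0 (Ioi 0), Disjoint F (tri y (z + ε • w) (z + ε • -w)) := by
  obtain ⟨δ, hδ, hav⟩ := exists_delta_avoid hF y z z (by
    intro s t u hs ht hu h1
    have e : s • y + t • z + u • z = (t + u) • z + s • y := by module
    have hne : s • y + t • z + u • z ≠ 0 := by
      rw [e]
      refine h.indep2.symm.ne_zero ?_
      by_contra! hc
      linarith [hc.1, hc.2]
    refine ⟨hne, fun hm => hd.le_bot ⟨hm, ?_⟩⟩
    rw [e] at hne ⊢
    exact pt_mem_seg (by linarith) hs hne)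
  filter_upwards [eventually_dist_lt w z hδ, eventually_dist_lt (-w) z hδ] with ε h1 h2
  rw [Set.disjoint_left]
  rintro _ hP ⟨v, ⟨s, t, u, hs, ht, hu, rfl⟩, hv, rfl⟩
  exact hav y _ _ (by simpa using hδ) h1 h2 s t u hs ht hu hv hP

/-- A polygonal arc that starts at `y` and does not meet the segment from `z` to `y` again meets
the thin triangles with apex `y` around this segment only in `y`: its first segment leaves `y` in
another direction. -/
lemma eventually_wedge_of_polyArc {y z w : Vec} (h : Indep3 y z w) {q : RP2} {A : Set RP2}
    (hA : PolyArc (pt y) q A) (hi : A ∩ seg z y ⊆ {pt y}) :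
    ∀ᶠ ε : ℝ in nhdsWithin 0 (Ioi 0), A ∩ tri y (z + ε • w) (z + ε • -w) ⊆ {pt y} := by
  obtain ⟨x, v, F, hxv, hx, hF, hyF, rfl⟩ := hA.exists_first
  have hy0 := h.indep2.left_ne_zero
  obtain ⟨c, hc, rfl⟩ := (pt_eq_pt_iff hxv.left_ne_zero hy0).1 hx.symm
  have es : seg (c • y) v = seg y (c⁻¹ • v) := by
    rw [← seg_smul_same hc y, smul_smul, mul_inv_cancel₀ hc, one_smul]
  rw [es] at hi ⊢
  generalize c⁻¹ • v = v at hi ⊢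
  obtain ⟨α, β, κ, rfl⟩ := h.exists_coord v
  have hFd : Disjoint F (seg z y) := by
    rw [Set.disjoint_left]
    intro P hP hP'
    have : P = pt y := hi ⟨Or.inr hP, hP'⟩
    exact hyF (this ▸ hP)
  have hκ : ∀ᶠ ε : ℝ in nhdsWithin 0 (Ioi 0), κ ≠ 0 → ε * |β| < |κ| := by
    by_cases h0 : κ = 0
    · simp [h0]
    · filter_upwards [eventually_mul_lt |β| (abs_pos.2 h0)] with ε hε _ using hε
  filter_upwards [eventually_wedge_of_isClosed h hF hFd, hκ, self_mem_nhdsWithin]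
    with ε h1 h2 hε
  replace hε : 0 < ε := hε
  rintro P ⟨hP | hP, hP'⟩
  swap
  · exact absurd hP' (Set.disjoint_left.1 h1 hP)
  obtain ⟨_, ⟨a, b, d, ha, hb, hd, rfl⟩, hu, rfl⟩ := hP'
  obtain ⟨_, ⟨s, t, hs, ht, rfl⟩, hu', e⟩ := id hP
  obtain ⟨r, hr, e⟩ := (pt_eq_pt_iff hu hu').1 e
  obtain ⟨e1, e2, e3⟩ := h.eq_of_eq (s := a) (t := b + d) (u := ε * (b - d))
    (s' := r * (s + t * α)) (t' := r * t * β) (u' := r * t * κ) (by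
      have : a • y + (b + d) • z + (ε * (b - d)) • w =
        a • y + b • (z + ε • w) + d • (z + ε • -w) := by module
      rw [this, e]; module)
  by_cases h0 : κ = 0
  · -- the first segment lies on the line through `y` and `z`
    have hbd : b = d := by
      rw [h0, mul_zero] at e3
      have := (mul_eq_zero.1 e3).resolve_left hε.ne'
      linarith
    have ez : a • y + b • (z + ε • w) + d • (z + ε • -w) = (2 * b) • z + a • y := by
      rw [← hbd]; module
    rw [ez] at hu hP ⊢
    exact hi ⟨Or.inl hP, pt_mem_seg (by positivity) ha hu⟩
  · have h3 := h2 h0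
    have h4 : |r * t| * |κ| ≤ |r * t| * (ε * |β|) := by
      calc |r * t| * |κ| = ε * |b - d| := by rw [← abs_mul, ← e3, abs_mul, abs_of_pos hε]
        _ ≤ ε * (b + d) := by
          refine mul_le_mul_of_nonneg_left (abs_le.2 ⟨?_, ?_⟩) hε.le <;> linarith
        _ = ε * |r * t * β| := by rw [← e2, abs_of_nonneg (by linarith)]
        _ = |r * t| * (ε * |β|) := by rw [abs_mul]; ring
    have hrt : |r * t| = 0 := by
      by_contra hne
      have : 0 < |r * t| := lt_of_le_of_ne (abs_nonneg _) (Ne.symm hne)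
      nlinarith
    rw [abs_eq_zero] at hrt
    rw [hrt, zero_mul] at e2
    have hb0 : b = 0 := by linarith
    have hd0 : d = 0 := by linarith
    subst hb0 hd0
    have ha0 : a ≠ 0 := by
      rintro rfl
      simp at hu
    simp only [zero_smul, add_zero, mem_singleton_iff]
    exact pt_smul ha0 y

lemma tri_rotate (x y z : Vec) : tri y z x = tri x y z := by
  apply congrArg proj
  ext v
  constructor
  · rintro ⟨s, t, u, hs, ht, hu, rfl⟩
    exact ⟨u, s, t, hu, hs, ht, by module⟩
  · rintro ⟨s, t, u, hs, ht, hu, rfl⟩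
    exact ⟨t, u, s, ht, hu, hs, by module⟩

lemma tri_swap (x y z : Vec) : tri y x z = tri x y z := by
  apply congrArg proj
  ext v
  constructor <;>
  · rintro ⟨s, t, u, hs, ht, hu, rfl⟩
    exact ⟨t, s, u, ht, hs, hu, by module⟩

/-- The triangle `z y₁ y₂`, where `z = y₁ + y₂ + y₃`, can be folded towards its sides `z y₁` and
`z y₂`, while the other triangles at `z` stay fixed. -/
lemma exists_fold {y₁ y₂ y₃ : Vec} (h : Indep3 y₁ y₂ y₃) {ε : ℝ} (hε : 0 < ε) :
    ∃ g : RP2 ≃ₜ RP2, IsPL g ∧ (∀ P ∈ tri (y₁ + y₂ + y₃) y₁ y₃ ∪ tri (y₁ + y₂ + y₃) y₂ y₃,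
      g P = P) ∧ ∀ P ∈ tri (y₁ + y₂ + y₃) y₁ y₂,
        g P ∈ tri (y₁ + y₂ + y₃) y₁ (y₁ + y₂ + y₃ + ε • (y₁ + y₂)) ∪
          tri (y₁ + y₂ + y₃) y₂ (y₁ + y₂ + y₃ + ε • (y₁ + y₂)) := by
  set z := y₁ + y₂ + y₃ with hz
  -- the triangle is enlarged beyond its side `y₁ y₂`, whose midpoint is then moved inwards
  set a := y₁ - (1 / 4 : ℝ) • z with ha
  set b := y₂ - (1 / 4 : ℝ) • z with hb
  have e3 : y₃ = z - y₁ - y₂ := by rw [hz]; abel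
  have hzab : Indep3 z a b := by
    intro r s t e
    obtain ⟨a1, a2, a3⟩ := h (r + s - (1 / 4) * (s + t)) (r + t - (1 / 4) * (s + t))
      (r - (1 / 4) * (s + t)) (by rw [← e, ha, hb, hz]; module)
    have hs : s = 0 := by linarith
    have ht : t = 0 := by linarith
    subst hs ht
    exact ⟨by linarith, rfl, rfl⟩
  obtain ⟨g, hg⟩ := exists_isConeMove hzab (p := y₁ + y₂) (q := z + ε • (y₁ + y₂))
    ⟨1 / 2, 1, 1, by norm_num, one_pos, one_pos, by rw [ha, hb]; module⟩
    ⟨1 + ε / 2, ε, ε, by positivity, hε, hε, by rw [ha, hb]; module⟩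
  have fix : ∀ s t u : ℝ, 0 ≤ s → 0 ≤ t → 0 ≤ u → (t = 0 ∨ u = 0) →
      s • z + t • y₁ + u • y₂ ≠ 0 → g (pt (s • z + t • y₁ + u • y₂)) =
        pt (s • z + t • y₁ + u • y₂) := by
    intro s t u hs ht hu h0 hne
    have e : s • z + t • y₁ + u • y₂ = (s + (t + u) / 4) • z + t • a + u • b := by
      rw [ha, hb]; module
    rw [e] at hne ⊢
    refine hg.fix _ _ _ hne ?_ (Or.inr (Or.inl ht))
    rcases h0 with h0 | h0
    · exact Or.inr (Or.inl h0.le)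
    · exact Or.inr (Or.inr h0.le)
  refine ⟨g, hg.isPL, ?_, ?_⟩
  · rintro _ (⟨v, ⟨s, t, u, hs, ht, hu, rfl⟩, hv, rfl⟩ | ⟨v, ⟨s, t, u, hs, ht, hu, rfl⟩, hv, rfl⟩)
    · have e : s • z + t • y₁ + u • y₃ = (s + t / 4 + u / 2) • z + (t - u) • a + (-u) • b := by
        rw [e3, ha, hb]; module
      rw [e] at hv ⊢
      exact hg.fix _ _ _ hv (Or.inr (Or.inr (by linarith))) (Or.inl (by positivity))
    · have e : s • z + t • y₂ + u • y₃ = (s + t / 4 + u / 2) • z + (-u) • a + (t - u) • b := by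
        rw [e3, ha, hb]; module
      rw [e] at hv ⊢
      exact hg.fix _ _ _ hv (Or.inr (Or.inl (by linarith))) (Or.inl (by positivity))
  · have hne : ∀ s t u : ℝ, s • z + t • y₁ + u • (z + ε • (y₁ + y₂)) = 0 → s + u = 0 ∧ t = 0 ∧
        u = 0 := by
      intro s t u e
      obtain ⟨a1, a2, a3⟩ := h (s + t + u + u * ε) (s + u + u * ε) (s + u) (by
        rw [← e, hz]; module)
      have h1 : u * ε = 0 := by linarith
      exact ⟨a3, by linarith, (mul_eq_zero.1 h1).resolve_right hε.ne'⟩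
    have hne' : ∀ s t u : ℝ, s • z + t • y₂ + u • (z + ε • (y₁ + y₂)) = 0 → s + u = 0 ∧ t = 0 ∧
        u = 0 := by
      intro s t u e
      obtain ⟨a1, a2, a3⟩ := h (s + u + u * ε) (s + t + u + u * ε) (s + u) (by
        rw [← e, hz]; module)
      have h1 : u * ε = 0 := by linarith
      exact ⟨a3, by linarith, (mul_eq_zero.1 h1).resolve_right hε.ne'⟩
    rintro _ ⟨v, ⟨s, t, u, hs, ht, hu, rfl⟩, hv, rfl⟩
    rcases le_total u t with hut | hut
    · left
      have e : ∀ v : Vec, s • z + (t - u) • y₁ + u • v =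
          (s + (t - u) / 4) • z + (t - u) • a + (0 : ℝ) • b + u • v := fun v => by
        rw [ha]; module
      have e' : s • z + t • y₁ + u • y₂ = s • z + (t - u) • y₁ + u • (y₁ + y₂) := by module
      rw [e', e] at hv ⊢
      rw [hg.map _ _ _ _ (by linarith) (by linarith) le_rfl hu (by simp) hv, ← e]
      refine ⟨_, ⟨s, t - u, u, hs, by linarith, hu, rfl⟩, fun h0 => hv ?_, rfl⟩
      obtain ⟨a1, a2, a3⟩ := hne _ _ _ h0
      rw [← e, a2, a3, show s = 0 by linarith]
      simp
    · right
      have e : ∀ v : Vec, s • z + (u - t) • y₂ + t • v =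
          (s + (u - t) / 4) • z + (0 : ℝ) • a + (u - t) • b + t • v := fun v => by
        rw [hb]; module
      have e' : s • z + t • y₁ + u • y₂ = s • z + (u - t) • y₂ + t • (y₁ + y₂) := by module
      rw [e', e] at hv ⊢
      rw [hg.map _ _ _ _ (by linarith) le_rfl (by linarith) ht (by simp) hv, ← e]
      refine ⟨_, ⟨s, u - t, t, hs, by linarith, ht, rfl⟩, fun h0 => hv ?_, rfl⟩
      obtain ⟨a1, a2, a3⟩ := hne' _ _ _ h0
      rw [← e, a2, a3, show s = 0 by linarith]
      simp

/-- The two parts into which the triangle `z y₁ y₂`, with `z = y₁ + y₂ + y₃`, is folded lie in thin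
triangles around `z y₁` and `z y₂`. This is the part at `y₁`. -/
lemma tri_subset_wedge {y₁ y₂ y₃ : Vec} {ε : ℝ} (hε : 0 < ε) :
    tri (y₁ + y₂ + y₃) y₁ (y₁ + y₂ + y₃ + ε • (y₁ + y₂)) ⊆
      tri y₁ (y₁ + y₂ + y₃ + ε • y₂) (y₁ + y₂ + y₃ + ε • -y₂) := by
  apply proj_mono
  rintro v ⟨a, b, c, ha, hb, hc, rfl⟩
  exact ⟨b + c * ε, (a + 2 * c) / 2, a / 2, by positivity, by positivity, by positivity,
    by module⟩

/-- The same for the part at `y₁` of the folded triangle `z y₁ y₃`. -/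
lemma tri_subset_wedge' {y₁ y₂ y₃ : Vec} {ε : ℝ} (hε : 0 < ε) :
    tri (y₁ + y₂ + y₃) y₁ (y₁ + y₂ + y₃ + ε • (y₁ + y₃)) ⊆
      tri y₁ (y₁ + y₂ + y₃ + ε • y₂) (y₁ + y₂ + y₃ + ε • -y₂) := by
  apply proj_mono
  rintro v ⟨a, b, c, ha, hb, hc, rfl⟩
  exact ⟨b, (a + c * ε) / 2, (a + 2 * c + c * ε) / 2, by positivity, by positivity,
    by positivity, by module⟩

lemma tri_fold_subset {y₁ y₂ y₃ : Vec} {ε : ℝ} (hε : 0 < ε) :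
    tri (y₁ + y₂ + y₃) y₁ (y₁ + y₂ + y₃ + ε • (y₁ + y₂)) ∪
      tri (y₁ + y₂ + y₃) y₂ (y₁ + y₂ + y₃ + ε • (y₁ + y₂)) ⊆ tri (y₁ + y₂ + y₃) y₁ y₂ := by
  refine union_subset ?_ ?_ <;> apply proj_mono
  · rintro v ⟨a, b, c, ha, hb, hc, rfl⟩
    exact ⟨a + c, b + c * ε, c * ε, by positivity, by positivity, by positivity, by module⟩
  · rintro v ⟨a, b, c, ha, hb, hc, rfl⟩
    exact ⟨a + c, c * ε, b + c * ε, by positivity, by positivity, by positivity, by module⟩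

lemma tri_subset_union (y₁ y₂ y₃ : Vec) : tri y₁ y₂ y₃ ⊆
    tri (y₁ + y₂ + y₃) y₁ y₂ ∪ (tri (y₁ + y₂ + y₃) y₂ y₃ ∪ tri (y₁ + y₂ + y₃) y₃ y₁) := by
  rintro P ⟨v, ⟨a, b, c, ha, hb, hc, rfl⟩, hv, rfl⟩
  rcases le_total a b with h1 | h1 <;> rcases le_total b c with h2 | h2 <;>
    rcases le_total a c with h3 | h3
  all_goals first
    | exact Or.inl ⟨_, ⟨c, a - c, b - c, by linarith, by linarith, by linarith, by module⟩, hv, rfl⟩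
    | exact Or.inr (Or.inl
        ⟨_, ⟨a, b - a, c - a, by linarith, by linarith, by linarith, by module⟩, hv, rfl⟩)
    | exact Or.inr (Or.inr
        ⟨_, ⟨b, c - b, a - b, by linarith, by linarith, by linarith, by module⟩, hv, rfl⟩)

/-- The triangle `y₁ y₂ y₃` can be mapped into thin triangles around the three segments that join
its centre `y₁ + y₂ + y₃` to its corners, while these segments stay fixed. -/
lemma exists_fold_all {y₁ y₂ y₃ : Vec} (h : Indep3 y₁ y₂ y₃) {ε : ℝ} (hε : 0 < ε) :
    ∃ g : RP2 ≃ₜ RP2, IsPL g ∧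
      (∀ P ∈ seg (y₁ + y₂ + y₃) y₁ ∪ (seg (y₁ + y₂ + y₃) y₂ ∪ seg (y₁ + y₂ + y₃) y₃), g P = P) ∧
      ∀ P ∈ tri y₁ y₂ y₃,
        g P ∈ tri y₁ (y₁ + y₂ + y₃ + ε • y₂) (y₁ + y₂ + y₃ + ε • -y₂) ∪
          (tri y₂ (y₁ + y₂ + y₃ + ε • y₃) (y₁ + y₂ + y₃ + ε • -y₃) ∪
            tri y₃ (y₁ + y₂ + y₃ + ε • y₁) (y₁ + y₂ + y₃ + ε • -y₁)) := by
  obtain ⟨g₁, hg₁, f₁, m₁⟩ := exists_fold h hε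
  obtain ⟨g₂, hg₂, f₂, m₂⟩ := exists_fold h.rotate hε
  obtain ⟨g₃, hg₃, f₃, m₃⟩ := exists_fold h.rotate.rotate hε
  have s₁ := tri_fold_subset (y₁ := y₁) (y₂ := y₂) (y₃ := y₃) hε
  have s₂ := tri_fold_subset (y₁ := y₂) (y₂ := y₃) (y₃ := y₁) hε
  have w₁ := tri_subset_wedge (y₁ := y₁) (y₂ := y₂) (y₃ := y₃) hε
  have w₂ := tri_subset_wedge (y₁ := y₂) (y₂ := y₃) (y₃ := y₁) hε
  have w₃ := tri_subset_wedge (y₁ := y₃) (y₂ := y₁) (y₃ := y₂) hε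
  have w₁' := tri_subset_wedge' (y₁ := y₁) (y₂ := y₂) (y₃ := y₃) hε
  have w₂' := tri_subset_wedge' (y₁ := y₂) (y₂ := y₃) (y₃ := y₁) hε
  have w₃' := tri_subset_wedge' (y₁ := y₃) (y₂ := y₁) (y₃ := y₂) hε
  have e₂ : y₂ + y₃ + y₁ = y₁ + y₂ + y₃ := by abel
  have e₃ : y₃ + y₁ + y₂ = y₁ + y₂ + y₃ := by abel
  rw [e₂] at f₂ m₂ s₂ w₂ w₂'
  rw [e₃] at f₃ m₃ w₃ w₃'
  have sw : ∀ a b c : Vec, tri a c b = tri a b c := fun a b c => by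
    rw [← tri_rotate, tri_swap, tri_rotate, tri_rotate]
  rw [add_comm y₂ y₁] at w₂'
  rw [add_comm y₃ y₂] at w₃'
  rw [add_comm y₁ y₃] at w₁'
  set z := y₁ + y₂ + y₃ with hz
  refine ⟨g₁.trans (g₂.trans g₃), hg₁.trans (hg₂.trans hg₃), ?_, ?_⟩
  · rintro P (hP | hP | hP) <;> simp only [Homeomorph.trans_apply]
    · rw [f₁ _ (Or.inl (seg_subset_tri₁₂ _ _ _ hP)), f₂ _ (Or.inl (seg_subset_tri₁₃ _ _ _ hP)),
        f₃ _ (Or.inr (seg_subset_tri₁₂ _ _ _ hP))]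
    · rw [f₁ _ (Or.inr (seg_subset_tri₁₂ _ _ _ hP)), f₂ _ (Or.inl (seg_subset_tri₁₂ _ _ _ hP)),
        f₃ _ (Or.inl (seg_subset_tri₁₃ _ _ _ hP))]
    · rw [f₁ _ (Or.inl (seg_subset_tri₁₃ _ _ _ hP)), f₂ _ (Or.inr (seg_subset_tri₁₂ _ _ _ hP)),
        f₃ _ (Or.inl (seg_subset_tri₁₂ _ _ _ hP))]
  · intro P hP
    simp only [Homeomorph.trans_apply]
    rcases tri_subset_union _ _ _ hP with hP | hP | hP
    · have m := m₁ P hP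
      have n := s₁ m
      rw [f₂ _ (Or.inl (by rwa [sw])), f₃ _ (Or.inr n)]
      rcases m with m | m
      · exact Or.inl (w₁ m)
      · exact Or.inr (Or.inl (w₂' m))
    · rw [f₁ _ (Or.inr hP)]
      have m := m₂ P hP
      have n := s₂ m
      rw [f₃ _ (Or.inl (by rwa [sw]))]
      rcases m with m | m
      · exact Or.inr (Or.inl (w₂ m))
      · exact Or.inr (Or.inr (w₃' m))
    · rw [f₁ _ (Or.inl (by rwa [sw])), f₂ _ (Or.inr hP)]
      rcases m₃ P hP with m | m
      · exact Or.inr (Or.inr (w₃ m))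
      · exact Or.inl (w₁' m)

/-! ### Embeddings in standard position -/

/-- The embedding draws the three edges at `v₀` as the segments which join the centre of the
triangle `y₁ y₂ y₃` to its corners, and has nothing else in this triangle. -/
structure ProjectivePlanarEmbedding.IsStandard {V : Type*} {G : SimpleGraph V}
    (f : ProjectivePlanarEmbedding G) (v₀ v₁ v₂ v₃ : V) (y₁ y₂ y₃ : Vec) : Prop where
  indep : Indep3 y₁ y₂ y₃
  adj_iff : ∀ w, G.Adj v₀ w ↔ w = v₁ ∨ w = v₂ ∨ w = v₃
  ne₁₂ : v₁ ≠ v₂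
  ne₁₃ : v₁ ≠ v₃
  ne₂₃ : v₂ ≠ v₃
  point₀ : f.point v₀ = pt (y₁ + y₂ + y₃)
  point₁ : f.point v₁ = pt y₁
  point₂ : f.point v₂ = pt y₂
  point₃ : f.point v₃ = pt y₃
  arc₁ : f.arc s(v₀, v₁) = seg (y₁ + y₂ + y₃) y₁
  arc₂ : f.arc s(v₀, v₂) = seg (y₁ + y₂ + y₃) y₂
  arc₃ : f.arc s(v₀, v₃) = seg (y₁ + y₂ + y₃) y₃
  arc_inter : ∀ e ∈ G.edgeSet, v₀ ∉ e → ∀ P ∈ f.arc e, P ∈ tri y₁ y₂ y₃ →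
    P = pt y₁ ∨ P = pt y₂ ∨ P = pt y₃
  point_notMem : ∀ v, v ≠ v₀ → v ≠ v₁ → v ≠ v₂ → v ≠ v₃ → f.point v ∉ tri y₁ y₂ y₃

namespace ProjectivePlanarEmbedding
variable {V : Type*} {G : SimpleGraph V} {f : ProjectivePlanarEmbedding G} {v₀ v₁ v₂ v₃ : V}
  {y₁ y₂ y₃ : Vec}

lemma IsStandard.rotate (h : f.IsStandard v₀ v₁ v₂ v₃ y₁ y₂ y₃) :
    f.IsStandard v₀ v₂ v₃ v₁ y₂ y₃ y₁ := by
  have e : y₂ + y₃ + y₁ = y₁ + y₂ + y₃ := by abel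
  exact ⟨h.indep.rotate, fun w => by rw [h.adj_iff]; tauto, h.ne₂₃, h.ne₁₂.symm, h.ne₁₃.symm,
    by rw [e, h.point₀], h.point₂, h.point₃, h.point₁, by rw [e, h.arc₂], by rw [e, h.arc₃],
    by rw [e, h.arc₁], fun e he h0 P hP hP' => by
      have := h.arc_inter e he h0 P hP (by rwa [tri_rotate] at hP')
      tauto,
    fun v a b c d => by rw [tri_rotate]; exact h.point_notMem v a d b c⟩

lemma IsStandard.swap (h : f.IsStandard v₀ v₁ v₂ v₃ y₁ y₂ y₃) :
    f.IsStandard v₀ v₂ v₁ v₃ y₂ y₁ y₃ := by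
  have e : y₂ + y₁ + y₃ = y₁ + y₂ + y₃ := by abel
  exact ⟨h.indep.swap, fun w => by rw [h.adj_iff]; tauto, h.ne₁₂.symm, h.ne₂₃, h.ne₁₃,
    by rw [e, h.point₀], h.point₂, h.point₁, h.point₃, by rw [e, h.arc₂], by rw [e, h.arc₁],
    by rw [e, h.arc₃], fun e he h0 P hP hP' => by
      have := h.arc_inter e he h0 P hP (by rwa [tri_swap] at hP')
      tauto,
    fun v a b c d => by rw [tri_swap]; exact h.point_notMem v a c b d⟩

/-- An edge that does not contain `v₀` meets the thin triangles with apex `v₁` around the edge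
`v₀ v₁` at most in `v₁`. -/
lemma eventually_wedge_arc {z y w : Vec} (hi : Indep3 y z w) (h₀₁ : G.Adj v₀ v₁)
    (h1 : f.point v₁ = pt y) (harc : f.arc s(v₀, v₁) = seg z y) {e : Sym2 V}
    (he : e ∈ G.edgeSet) (h0 : v₀ ∉ e) : ∀ᶠ ε : ℝ in nhdsWithin 0 (Ioi 0),
      f.arc e ∩ tri y (z + ε • w) (z + ε • -w) ⊆ {pt y} := by
  have key : ∀ P ∈ f.arc e ∩ seg z y, P = pt y ∧ v₁ ∈ e := by
    intro P hP
    rw [← harc] at hP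
    obtain ⟨v, hv, hv', rfl⟩ := f.arc_inter_arc e he s(v₀, v₁) h₀₁
      (fun h => h0 (h ▸ Sym2.mem_mk_left _ _)) P hP
    rcases Sym2.mem_iff.1 hv' with rfl | rfl
    · exact absurd hv h0
    · exact ⟨h1, hv⟩
  by_cases hv : v₁ ∈ e
  · obtain ⟨u, rfl⟩ := Sym2.mem_iff_exists.1 hv
    have := f.polyArc he
    rw [h1] at this
    exact eventually_wedge_of_polyArc hi this fun P hP => (key P hP).1
  · filter_upwards [eventually_wedge_of_isClosed hi (f.isClosed_arc he)
      (Set.disjoint_left.2 fun P hP hP' => hv (key P ⟨hP, hP'⟩).2)] with ε hε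
    rw [hε.inter_eq]
    exact empty_subset _

lemma eventually_wedge_point {z y w : Vec} (hi : Indep3 y z w) (h₀₁ : G.Adj v₀ v₁)
    (harc : f.arc s(v₀, v₁) = seg z y) {v : V} (h0 : v ≠ v₀) (hv : v ≠ v₁) :
    ∀ᶠ ε : ℝ in nhdsWithin 0 (Ioi 0), f.point v ∉ tri y (z + ε • w) (z + ε • -w) := by
  filter_upwards [eventually_wedge_of_isClosed hi (isClosed_singleton_pt (f.point v)) (by
    rw [disjoint_singleton_left, ← harc]
    intro hm
    have := f.mem_of_point_mem_arc _ h₀₁ v hm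
    rcases Sym2.mem_iff.1 this with rfl | rfl
    · exact h0 rfl
    · exact hv rfl)] with ε hε
  rwa [disjoint_singleton_left] at hε

/-- Every nonseparating embedding can be brought into standard position at a vertex of degree
three. -/
theorem exists_isStandard [Finite V] (f : ProjectivePlanarEmbedding G) (hf : ¬ f.IsSeparating)
    (hadj : ∀ w, G.Adj v₀ w ↔ w = v₁ ∨ w = v₂ ∨ w = v₃) (h₁₂ : v₁ ≠ v₂) (h₁₃ : v₁ ≠ v₃)
    (h₂₃ : v₂ ≠ v₃) : ∃ (f' : ProjectivePlanarEmbedding G) (y₁ y₂ y₃ : Vec),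
      ¬ f'.IsSeparating ∧ f'.IsStandard v₀ v₁ v₂ v₃ y₁ y₂ y₃ := by
  have a₁ : G.Adj v₀ v₁ := (hadj _).2 (by simp)
  have a₂ : G.Adj v₀ v₂ := (hadj _).2 (by simp)
  have a₃ : G.Adj v₀ v₃ := (hadj _).2 (by simp)
  have inter : ∀ u v, G.Adj v₀ u → G.Adj v₀ v → u ≠ v →
      f.arc s(v₀, u) ∩ f.arc s(v₀, v) ⊆ {f.point v₀} := by
    intro u v hu hv huv P hP
    obtain ⟨w, hw, hw', rfl⟩ := f.arc_inter_arc _ hu _ hv (by simp [huv, hv.ne]) P hP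
    rcases Sym2.mem_iff.1 hw with rfl | rfl
    · rfl
    · rcases Sym2.mem_iff.1 hw' with rfl | rfl
      · rfl
      · exact absurd rfl huv
  obtain ⟨g, y₁, y₂, y₃, hg, hind, p0, p1, p2, p3, m1, m2, m3⟩ :=
    Tripod.exists_standardPosition ⟨f.polyArc a₁, f.polyArc a₂, f.polyArc a₃,
      inter _ _ a₁ a₂ h₁₂, inter _ _ a₁ a₃ h₁₃, inter _ _ a₂ a₃ h₂₃⟩
  set z := y₁ + y₂ + y₃ with hz
  set f₁ := f.map g hg with hf₁
  have i₁ : Indep3 y₁ z y₂ := fun r s t e => by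
    obtain ⟨b1, b2, b3⟩ := hind (r + s) (s + t) s (by rw [← e, hz]; module)
    exact ⟨by linarith, b3, by linarith⟩
  have i₂ : Indep3 y₂ z y₃ := fun r s t e => by
    obtain ⟨b1, b2, b3⟩ := hind s (r + s) (s + t) (by rw [← e, hz]; module)
    exact ⟨by linarith, b1, by linarith⟩
  have i₃ : Indep3 y₃ z y₁ := fun r s t e => by
    obtain ⟨b1, b2, b3⟩ := hind (s + t) s (r + s) (by rw [← e, hz]; module)
    exact ⟨by linarith, b2, by linarith⟩
  have key : ∀ᶠ ε : ℝ in nhdsWithin 0 (Ioi 0),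
      (∀ e : Sym2 V, e ∈ G.edgeSet ∧ v₀ ∉ e →
        f₁.arc e ∩ tri y₁ (z + ε • y₂) (z + ε • -y₂) ⊆ {pt y₁} ∧
        f₁.arc e ∩ tri y₂ (z + ε • y₃) (z + ε • -y₃) ⊆ {pt y₂} ∧
        f₁.arc e ∩ tri y₃ (z + ε • y₁) (z + ε • -y₁) ⊆ {pt y₃}) ∧
      ∀ v : V, v ≠ v₀ ∧ v ≠ v₁ ∧ v ≠ v₂ ∧ v ≠ v₃ →
        f₁.point v ∉ tri y₁ (z + ε • y₂) (z + ε • -y₂) ∧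
        f₁.point v ∉ tri y₂ (z + ε • y₃) (z + ε • -y₃) ∧
        f₁.point v ∉ tri y₃ (z + ε • y₁) (z + ε • -y₁) := by
    refine Filter.Eventually.and (Filter.eventually_all.2 fun e => ?_)
      (Filter.eventually_all.2 fun v => ?_)
    · by_cases he : e ∈ G.edgeSet ∧ v₀ ∉ e
      · filter_upwards [eventually_wedge_arc (f := f₁) i₁ a₁ p1 m1 he.1 he.2,
          eventually_wedge_arc (f := f₁) i₂ a₂ p2 m2 he.1 he.2,
          eventually_wedge_arc (f := f₁) i₃ a₃ p3 m3 he.1 he.2] with ε h1 h2 h3 _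
          using ⟨h1, h2, h3⟩
      · exact Filter.Eventually.of_forall fun ε h => absurd h he
    · by_cases hv : v ≠ v₀ ∧ v ≠ v₁ ∧ v ≠ v₂ ∧ v ≠ v₃
      · filter_upwards [eventually_wedge_point (f := f₁) i₁ a₁ m1 hv.1 hv.2.1,
          eventually_wedge_point (f := f₁) i₂ a₂ m2 hv.1 hv.2.2.1,
          eventually_wedge_point (f := f₁) i₃ a₃ m3 hv.1 hv.2.2.2] with ε h1 h2 h3 _
          using ⟨h1, h2, h3⟩
      · exact Filter.Eventually.of_forall fun ε h => absurd h hv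
  obtain ⟨ε, ⟨hE, hP⟩, (hε : 0 < ε)⟩ := (key.and self_mem_nhdsWithin).exists
  obtain ⟨φ, hφ, fix, hfold⟩ := exists_fold_all hind hε
  have fix' : ∀ P ∈ seg z y₁ ∪ (seg z y₂ ∪ seg z y₃), φ.symm P = P := fun P hP => by
    rw [Homeomorph.symm_apply_eq, fix P hP]
  have z0 : z ≠ 0 := i₁.indep2.right_ne_zero
  refine ⟨f₁.map φ.symm hφ.symm, y₁, y₂, y₃, fun h => hf (f.isSeparating_of_map g hg
    (f₁.isSeparating_of_map _ _ h)), hind, hadj, h₁₂, h₁₃, h₂₃, ?_, ?_, ?_, ?_, ?_, ?_, ?_, ?_, ?_⟩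
  · change φ.symm (g (f.point v₀)) = _
    rw [p0]
    exact fix' _ (Or.inl (left_mem_seg z0))
  · change φ.symm (g (f.point v₁)) = _
    rw [p1]
    exact fix' _ (Or.inl (right_mem_seg i₁.indep2.left_ne_zero))
  · change φ.symm (g (f.point v₂)) = _
    rw [p2]
    exact fix' _ (Or.inr (Or.inl (right_mem_seg i₂.indep2.left_ne_zero)))
  · change φ.symm (g (f.point v₃)) = _
    rw [p3]
    exact fix' _ (Or.inr (Or.inr (right_mem_seg i₃.indep2.left_ne_zero)))
  · change φ.symm '' (g '' f.arc s(v₀, v₁)) = _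
    rw [m1]
    exact image_eq_self fun P hP => fix' P (Or.inl hP)
  · change φ.symm '' (g '' f.arc s(v₀, v₂)) = _
    rw [m2]
    exact image_eq_self fun P hP => fix' P (Or.inr (Or.inl hP))
  · change φ.symm '' (g '' f.arc s(v₀, v₃)) = _
    rw [m3]
    exact image_eq_self fun P hP => fix' P (Or.inr (Or.inr hP))
  · rintro e he h0 _ ⟨Q, hQ, rfl⟩ hP'
    have := hfold _ hP'
    rw [Homeomorph.apply_symm_apply] at this
    obtain ⟨e1, e2, e3⟩ := hE e ⟨he, h0⟩
    rcases this with h | h | h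
    · rw [e1 ⟨hQ, h⟩]
      exact Or.inl (fix' _ (Or.inl (right_mem_seg i₁.indep2.left_ne_zero)))
    · rw [e2 ⟨hQ, h⟩]
      exact Or.inr (Or.inl (fix' _ (Or.inr (Or.inl (right_mem_seg i₂.indep2.left_ne_zero)))))
    · rw [e3 ⟨hQ, h⟩]
      exact Or.inr (Or.inr (fix' _ (Or.inr (Or.inr (right_mem_seg i₃.indep2.left_ne_zero)))))
  · intro v b0 b1 b2 b3 hm
    have := hfold _ hm
    change φ (φ.symm (f₁.point v)) ∈ _ at this
    rw [Homeomorph.apply_symm_apply] at this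
    obtain ⟨e1, e2, e3⟩ := hP v ⟨b0, b1, b2, b3⟩
    rcases this with h | h | h
    · exact e1 h
    · exact e2 h
    · exact e3 h

end ProjectivePlanarEmbedding

/-! ### Redrawing the sides of the triangle -/

/-- A polygonal arc from `y₁` to `y₂` inside the triangle with corners `y₁`, `y₂`, `y₃`. It is
bent away from the side, so that the side itself is left to an edge which is there already. -/
def bend (y₁ y₂ y₃ : Vec) : Set RP2 :=
  seg ((2 : ℝ) • y₁ + (2 : ℝ) • y₂ + y₃) y₁ ∪ seg ((2 : ℝ) • y₁ + (2 : ℝ) • y₂ + y₃) y₂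

lemma bend_comm (y₁ y₂ y₃ : Vec) : bend y₂ y₁ y₃ = bend y₁ y₂ y₃ := by
  rw [bend, bend, union_comm, show (2 : ℝ) • y₂ + (2 : ℝ) • y₁ + y₃ =
    (2 : ℝ) • y₁ + (2 : ℝ) • y₂ + y₃ by module]

lemma exists_of_mem_bend {y₁ y₂ y₃ : Vec} {P : RP2} (hP : P ∈ bend y₁ y₂ y₃) :
    ∃ a b c : ℝ, 0 ≤ c ∧ 2 * c ≤ a ∧ 2 * c ≤ b ∧ a • y₁ + b • y₂ + c • y₃ ≠ 0 ∧
      P = pt (a • y₁ + b • y₂ + c • y₃) := by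
  rcases hP with ⟨v, ⟨s, t, hs, ht, rfl⟩, hv, rfl⟩ | ⟨v, ⟨s, t, hs, ht, rfl⟩, hv, rfl⟩
  · have e : s • ((2 : ℝ) • y₁ + (2 : ℝ) • y₂ + y₃) + t • y₁ =
      (2 * s + t) • y₁ + (2 * s) • y₂ + s • y₃ := by module
    rw [e] at hv ⊢
    exact ⟨_, _, _, hs, by linarith, by linarith, hv, rfl⟩
  · have e : s • ((2 : ℝ) • y₁ + (2 : ℝ) • y₂ + y₃) + t • y₂ =
      (2 * s) • y₁ + (2 * s + t) • y₂ + s • y₃ := by module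
    rw [e] at hv ⊢
    exact ⟨_, _, _, hs, by linarith, by linarith, hv, rfl⟩

lemma bend_subset_tri (y₁ y₂ y₃ : Vec) : bend y₁ y₂ y₃ ⊆ tri y₁ y₂ y₃ := fun P hP => by
  obtain ⟨a, b, c, hc, ha, hb, hv, rfl⟩ := exists_of_mem_bend hP
  exact ⟨_, ⟨a, b, c, by linarith, by linarith, hc, rfl⟩, hv, rfl⟩

lemma Indep3.indep2_bend {y₁ y₂ y₃ : Vec} (h : Indep3 y₁ y₂ y₃) :
    Indep2 ((2 : ℝ) • y₁ + (2 : ℝ) • y₂ + y₃) y₁ := fun s t e => by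
  obtain ⟨h1, h2, h3⟩ := h (2 * s + t) (2 * s) s (by rw [← e]; module)
  exact ⟨h3, by linarith⟩

lemma Indep3.indep2_bend' {y₁ y₂ y₃ : Vec} (h : Indep3 y₁ y₂ y₃) :
    Indep2 ((2 : ℝ) • y₁ + (2 : ℝ) • y₂ + y₃) y₂ := fun s t e => by
  obtain ⟨h1, h2, h3⟩ := h (2 * s) (2 * s + t) s (by rw [← e]; module)
  exact ⟨h3, by linarith⟩

lemma polyArc_bend {y₁ y₂ y₃ : Vec} (h : Indep3 y₁ y₂ y₃) :
    PolyArc (pt y₁) (pt y₂) (bend y₁ y₂ y₃) := by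
  rw [bend, seg_comm _ y₁]
  refine .snoc _ _ _ h.indep2_bend' (.single _ _ h.indep2_bend.symm rfl) ?_
  rintro P ⟨⟨v, ⟨s, t, hs, ht, rfl⟩, hv, rfl⟩, ⟨w, ⟨s', t', hs', ht', rfl⟩, hw, e⟩⟩
  obtain ⟨r, hr, e⟩ := (pt_eq_pt_iff hv hw).1 e
  obtain ⟨e1, e2, e3⟩ := h.eq_of_eq (s := s + 2 * t) (t := 2 * t) (u := t) (s' := r * (2 * s'))
    (t' := r * (2 * s' + t')) (u' := r * s') (by
      rw [show (s + 2 * t) • y₁ + (2 * t) • y₂ + t • y₃ =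
        s • y₁ + t • ((2 : ℝ) • y₁ + (2 : ℝ) • y₂ + y₃) by module, e]
      module)
  have hs0 : s = 0 := by linarith
  subst hs0
  rw [zero_smul, zero_add] at hv ⊢
  exact pt_smul (left_ne_zero_of_smul hv) _

lemma pt_notMem_bend {y₁ y₂ y₃ : Vec} (h : Indep3 y₁ y₂ y₃) : pt y₃ ∉ bend y₁ y₂ y₃ := by
  intro hP
  obtain ⟨a, b, c, hc, ha, hb, hv, e⟩ := exists_of_mem_bend hP
  obtain ⟨r, hr, e⟩ := (pt_eq_pt_iff h.rotate.rotate.indep2.left_ne_zero hv).1 e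
  obtain ⟨e1, e2, e3⟩ := h.eq_of_eq (s := 0) (t := 0) (u := 1) (s' := r * a) (t' := r * b)
    (u' := r * c) ((show (0 : ℝ) • y₁ + (0 : ℝ) • y₂ + (1 : ℝ) • y₃ = y₃ by module).trans
      (e.trans (by module)))
  have ha0 : a = 0 := by simpa [hr] using e1.symm
  have hc0 : c = 0 := by linarith
  simp [hc0] at e3

lemma bend_inter_bend {y₁ y₂ y₃ : Vec} (h : Indep3 y₁ y₂ y₃) :
    bend y₁ y₂ y₃ ∩ bend y₁ y₃ y₂ ⊆ {pt y₁} := by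
  rintro P ⟨h1, h2⟩
  obtain ⟨a, b, c, hc, ha, hb, hv, rfl⟩ := exists_of_mem_bend h1
  obtain ⟨a', c', b', hb', ha', hc', hw, e⟩ := exists_of_mem_bend h2
  obtain ⟨r, hr, e⟩ := (pt_eq_pt_iff hv hw).1 e
  obtain ⟨e1, e2, e3⟩ := h.eq_of_eq (s' := r * a') (t' := r * b') (u' := r * c')
    (e.trans (by module))
  have hbc : b = 0 ∧ c = 0 := by
    rcases lt_or_gt_of_ne hr with h0 | h0
    · constructor <;> nlinarith
    · constructor <;> nlinarith
  obtain ⟨rfl, rfl⟩ := hbc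
  have e0 : a • y₁ + (0 : ℝ) • y₂ + (0 : ℝ) • y₃ = a • y₁ := by module
  rw [e0] at hv ⊢
  exact pt_smul (left_ne_zero_of_smul hv) _

/-- Moving the centre of the tripod towards a side carries two of its legs to the bent side. -/
lemma exists_homeomorph_bend {y₁ y₂ y₃ : Vec} (h : Indep3 y₁ y₂ y₃) {F : Set RP2}
    (hF : F ∩ tri y₁ y₂ y₃ ⊆ {pt y₁, pt y₂, pt y₃}) : ∃ g : RP2 ≃ₜ RP2, (∀ P ∈ F, g P = P) ∧
      g '' (seg (y₁ + y₂ + y₃) y₁ ∪ seg (y₁ + y₂ + y₃) y₂) = bend y₁ y₂ y₃ := by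
  obtain ⟨g, hg⟩ := exists_isConeMove h (p := y₁ + y₂ + y₃)
    (q := (2 : ℝ) • y₁ + (2 : ℝ) • y₂ + y₃) ⟨1, 1, 1, by simp, by simp, by simp, by module⟩
    ⟨2, 2, 1, by simp, by simp, by simp, by module⟩
  have fix : ∀ x y z : ℝ, x • y₁ + y • y₂ + z • y₃ ≠ 0 → (x = 0 ∨ y = 0) ∧ (0 ≤ x ∨ 0 ≤ y) →
      g (pt (x • y₁ + y • y₂ + z • y₃)) = pt (x • y₁ + y • y₂ + z • y₃) := by
    rintro x y z hne ⟨h1, h2⟩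
    refine hg.fix x y z hne ?_ ?_
    · rcases h1 with h1 | h1 <;> simp [h1]
    · rcases h2 with h2 | h2 <;> simp [h2]
  refine ⟨g, fun P hP => ?_, ?_⟩
  · by_cases hPt : P ∈ tri y₁ y₂ y₃
    · rcases hF ⟨hP, hPt⟩ with rfl | rfl | rfl
      · have := fix 1 0 0 (h.ne_zero (by simp)) (by simp)
        simpa using this
      · have := fix 0 1 0 (h.ne_zero (by simp)) (by simp)
        simpa using this
      · have := fix 0 0 1 (h.ne_zero (by simp)) (by simp)
        simpa using this
    · exact hg.fix_of_notMem P hPt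
  · have i₁ : Indep2 (y₁ + y₂ + y₃) y₁ := fun s t e => by
      obtain ⟨h1, h2, h3⟩ := h (s + t) s s (by rw [← e]; module)
      exact ⟨h3, by linarith⟩
    have i₂ : Indep2 (y₁ + y₂ + y₃) y₂ := fun s t e => by
      obtain ⟨h1, h2, h3⟩ := h s (s + t) s (by rw [← e]; module)
      exact ⟨h3, by linarith⟩
    rw [image_union, bend, image_seg_eq i₁ h.indep2_bend, image_seg_eq i₂ h.indep2_bend']
    · intro s t hs ht hne
      have e : ∀ q : Vec, s • q + t • y₂ = (0 : ℝ) • y₁ + t • y₂ + (0 : ℝ) • y₃ + s • q :=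
        fun q => by module
      rw [e] at hne ⊢
      rw [hg.map 0 t 0 s le_rfl ht le_rfl hs (by simp) hne, e]
    · intro s t hs ht hne
      have e : ∀ q : Vec, s • q + t • y₁ = t • y₁ + (0 : ℝ) • y₂ + (0 : ℝ) • y₃ + s • q :=
        fun q => by module
      rw [e] at hne ⊢
      rw [hg.map t 0 0 s ht le_rfl le_rfl hs (by simp) hne, e]

/-- Two legs of the tripod, which avoid the corner `y₂`, can be moved to the two bent sides at
`y₂`, if the set to be kept fixed avoids `y₂`. The legs are first moved close to the two sides; a
second move, in a triangle that sticks out of the given one a little at `y₂`, drags their common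
end to `y₂`. -/
lemma exists_homeomorph_bend_union_bend {y₁ y₂ y₃ : Vec} (h : Indep3 y₁ y₂ y₃) {F : Set RP2}
    (hFc : IsClosed F) (hF : F ∩ tri y₁ y₂ y₃ ⊆ {pt y₁, pt y₃}) :
    ∃ g : RP2 ≃ₜ RP2, (∀ P ∈ F, g P = P) ∧
      g '' (seg (y₁ + y₂ + y₃) y₁ ∪ seg (y₁ + y₂ + y₃) y₃) =
        bend y₁ y₂ y₃ ∪ bend y₂ y₃ y₁ := by
  set m : Vec := y₁ + (2 : ℝ) • y₂ + y₃ with hm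
  set q : Vec := (2 : ℝ) • y₁ + (2 : ℝ) • y₂ + y₃ with hq
  set q' : Vec := y₁ + (2 : ℝ) • y₂ + (2 : ℝ) • y₃ with hq'
  obtain ⟨δ, hδ, hav⟩ := exists_delta_avoid hFc y₂ q q' (by
    intro s t u hs ht hu h1
    have e : s • y₂ + t • q + u • q' =
      (2 * t + u) • y₁ + (s + 2 * t + 2 * u) • y₂ + (t + 2 * u) • y₃ := by module
    have hpos : s + 2 * t + 2 * u ≠ 0 := by intro h0; linarith
    have hne := h.ne_zero (s := 2 * t + u) (u := t + 2 * u) (Or.inr (Or.inl hpos))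
    rw [e]
    refine ⟨hne, fun hP => ?_⟩
    rcases hF ⟨hP, ⟨_, ⟨_, _, _, by positivity, by positivity, by positivity, rfl⟩, hne, rfl⟩⟩
      with h0 | h0
    · obtain ⟨r, hr, e⟩ := (pt_eq_pt_iff hne h.indep2.left_ne_zero).1 h0
      exact hpos (h.eq_of_eq (s' := r) (t' := 0) (u' := 0) (e.trans (by module))).2.1
    · obtain ⟨r, hr, e⟩ := (pt_eq_pt_iff hne h.rotate.rotate.indep2.left_ne_zero).1 h0
      exact hpos (h.eq_of_eq (s' := 0) (t' := 0) (u' := r) (e.trans (by module))).2.1)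
  obtain ⟨η, ⟨hη, hη1⟩, hη0⟩ := (((eventually_dist_lt (-(q + q')) y₂ hδ).and
    (eventually_mul_lt 1 one_pos)).and self_mem_nhdsWithin).exists
  replace hη0 : 0 < η := hη0
  rw [mul_one] at hη1
  set x := y₂ + η • -(q + q') with hx
  -- the triangle `x q q'` contains `y₂` in its interior and misses `F`, since `x` is close to `y₂`
  have hind : Indep3 x q q' := fun s t u e => by
    obtain ⟨h1, h2, h3⟩ := h (2 * (t - s * η) + (u - s * η))
      (s + 2 * (t - s * η) + 2 * (u - s * η)) ((t - s * η) + 2 * (u - s * η))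
      (by rw [← e]; module)
    have hs : s = 0 := by linarith
    subst hs
    exact ⟨rfl, by linarith, by linarith⟩
  have em : m = (2 / 3 : ℝ) • x + (1 / 3 + 2 * η / 3) • q + (1 / 3 + 2 * η / 3) • q' := by
    module
  have ey : y₂ = (1 : ℝ) • x + η • q + η • q' := by module
  obtain ⟨S, hS⟩ := exists_isConeMove hind (p := m) (q := y₂)
    ⟨_, _, _, by norm_num, by positivity, by positivity, em⟩
    ⟨_, _, _, one_pos, hη0, hη0, ey⟩
  obtain ⟨T, hT⟩ := exists_isConeMove h (p := y₁ + y₂ + y₃) (q := m)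
    ⟨1, 1, 1, by simp, by simp, by simp, by module⟩
    ⟨1, 2, 1, by simp, by simp, by simp, by module⟩
  have T₁ : T (pt y₁) = pt y₁ := by
    have := hT.fix 1 0 0 (h.ne_zero (by simp)) (by simp) (by simp)
    simpa using this
  have T₃ : T (pt y₃) = pt y₃ := by
    have := hT.fix 0 0 1 (h.ne_zero (by simp)) (by simp) (by simp)
    simpa using this
  have i₁ : Indep2 (y₁ + y₂ + y₃) y₁ := fun s t e => by
    obtain ⟨h1, h2, h3⟩ := h (s + t) s s (by rw [← e]; module)
    exact ⟨h3, by linarith⟩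
  have i₃ : Indep2 (y₁ + y₂ + y₃) y₃ := fun s t e => by
    obtain ⟨h1, h2, h3⟩ := h s s (s + t) (by rw [← e]; module)
    exact ⟨h2, by linarith⟩
  have j₁ : Indep2 m y₁ := fun s t e => by
    obtain ⟨h1, h2, h3⟩ := h (s + t) (2 * s) s (by rw [← e]; module)
    exact ⟨h3, by linarith⟩
  have j₃ : Indep2 m y₃ := fun s t e => by
    obtain ⟨h1, h2, h3⟩ := h s (2 * s) (s + t) (by rw [← e]; module)
    exact ⟨h1, by linarith⟩
  have t₁ : T '' seg (y₁ + y₂ + y₃) y₁ = seg m y₁ := by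
    refine image_seg_eq i₁ j₁ fun s t hs ht hne => ?_
    have e : ∀ q : Vec, s • q + t • y₁ = t • y₁ + (0 : ℝ) • y₂ + (0 : ℝ) • y₃ + s • q :=
      fun q => by module
    rw [e] at hne ⊢
    rw [hT.map t 0 0 s ht le_rfl le_rfl hs (by simp) hne, e]
  have t₃ : T '' seg (y₁ + y₂ + y₃) y₃ = seg m y₃ := by
    refine image_seg_eq i₃ j₃ fun s t hs ht hne => ?_
    have e : ∀ q : Vec, s • q + t • y₃ = (0 : ℝ) • y₁ + (0 : ℝ) • y₂ + t • y₃ + s • q :=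
      fun q => by module
    rw [e] at hne ⊢
    rw [hT.map 0 0 t s le_rfl le_rfl ht hs (by simp) hne, e]
  have split : ∀ y : Vec, seg m y = seg m (m + y) ∪ seg (m + y) y := fun y => by
    have := seg_split one_pos one_pos (x := m) (y := y)
    rwa [one_smul, one_smul] at this
  have q₁ : m + y₁ = q := by module
  have q₃ : m + y₃ = q' := by module
  have s₁ : S '' seg m q = seg q y₂ := by
    rw [seg_comm q]
    have k : Indep2 m q := fun s t e => by
      obtain ⟨h1, h2, h3⟩ := h (s + 2 * t) (2 * s + 2 * t) (s + t) (by rw [← e]; module)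
      constructor <;> linarith
    refine image_seg_eq k h.indep2_bend'.symm fun s t hs ht hne => ?_
    have e : ∀ p : Vec, s • p + t • q = (0 : ℝ) • x + t • q + (0 : ℝ) • q' + s • p :=
      fun p => by module
    rw [e] at hne ⊢
    rw [hS.map 0 t 0 s le_rfl ht le_rfl hs (by simp) hne, e]
  have s₃ : S '' seg m q' = seg q' y₂ := by
    rw [seg_comm q']
    have k : Indep2 m q' := fun s t e => by
      obtain ⟨h1, h2, h3⟩ := h (s + t) (2 * s + 2 * t) (s + 2 * t) (by rw [← e]; module)
      constructor <;> linarith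
    have k' : Indep2 y₂ q' := fun s t e => by
      obtain ⟨h1, h2, h3⟩ := h t (s + 2 * t) (2 * t) (by rw [← e]; module)
      constructor <;> linarith
    refine image_seg_eq k k' fun s t hs ht hne => ?_
    have e : ∀ p : Vec, s • p + t • q' = (0 : ℝ) • x + (0 : ℝ) • q + t • q' + s • p :=
      fun p => by module
    rw [e] at hne ⊢
    rw [hS.map 0 0 t s le_rfl le_rfl ht hs (by simp) hne, e]
  -- the outer pieces of the legs have a nonpositive coordinate at `x`, so that `S` fixes them
  have f₁ : S '' seg q y₁ = seg q y₁ := by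
    refine image_eq_self ?_
    rintro _ ⟨_, ⟨s, t, hs, ht, rfl⟩, hv, rfl⟩
    have e : s • q + t • y₁ = (-(2 * t / 3)) • x + (s + t * (2 / 3 - 2 * η / 3)) • q +
      (-(t * (1 / 3 + 2 * η / 3))) • q' := by rw [← sub_eq_zero]; module
    rw [e] at hv ⊢
    refine hS.fix _ _ _ hv (Or.inl (by linarith)) (Or.inr (Or.inl ?_))
    have : 0 ≤ t * (2 / 3 - 2 * η / 3) := mul_nonneg ht (by linarith)
    linarith
  have f₃ : S '' seg q' y₃ = seg q' y₃ := by
    refine image_eq_self ?_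
    rintro _ ⟨_, ⟨s, t, hs, ht, rfl⟩, hv, rfl⟩
    have e : s • q' + t • y₃ = (-(2 * t / 3)) • x + (-(t * (1 / 3 + 2 * η / 3))) • q +
      (s + t * (2 / 3 - 2 * η / 3)) • q' := by rw [← sub_eq_zero]; module
    rw [e] at hv ⊢
    refine hS.fix _ _ _ hv (Or.inl (by linarith)) (Or.inr (Or.inr ?_))
    have : 0 ≤ t * (2 / 3 - 2 * η / 3) := mul_nonneg ht (by linarith)
    linarith
  refine ⟨T.trans S, fun P hP => ?_, ?_⟩
  · have hTP : T P = P := by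
      by_cases hPt : P ∈ tri y₁ y₂ y₃
      · rcases hF ⟨hP, hPt⟩ with rfl | rfl
        · exact T₁
        · exact T₃
      · exact hT.fix_of_notMem P hPt
    rw [Homeomorph.trans_apply, hTP]
    refine hS.fix_of_notMem P ?_
    rintro ⟨_, ⟨s, t, u, hs, ht, hu, rfl⟩, hv, rfl⟩
    exact hav x q q' hη (by simpa using hδ) (by simpa using hδ) s t u hs ht hu hv hP
  · rw [image_trans, image_union, t₁, t₃, split y₁, split y₃, q₁, q₃, image_union, image_union,
      image_union, s₁, s₃, f₁, f₃, bend, bend,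
      show (2 : ℝ) • y₂ + (2 : ℝ) • y₃ + y₁ = q' by rw [hq']; module, union_comm (seg q y₂)]

/-- The complement of a projective triangle is connected: it is the union of three open projective
quadrangles, which meet pairwise. -/
lemma isPreconnected_compl_tri {y₁ y₂ y₃ : Vec} (h : Indep3 y₁ y₂ y₃) :
    IsPreconnected (tri y₁ y₂ y₃)ᶜ := by
  have hcont : ContinuousOn pt {v : Vec | v ≠ 0} := by
    rw [continuousOn_iff_continuous_domRestrict]
    have : {v : Vec | v ≠ 0}.domRestrict pt =
        fun v : {v : Vec // v ≠ 0} => Projectivization.mk ℝ v.1 v.2 := by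
      funext v
      exact pt_eq_mk v.2
    rw [this]
    exact continuous_coinduced_rng
  have key : ∀ {x y z : Vec}, Indep3 x y z →
      IsPreconnected {P | ∃ a b c : ℝ, 0 < a ∧ b < 0 ∧ P = pt (a • x + b • y + c • z)} := by
    intro x y z hi
    have hconv : Convex ℝ {w : Fin 3 → ℝ | 0 < w 0 ∧ w 1 < 0} := by
      intro u hu v hv s t hs ht hst
      rcases hs.eq_or_lt with rfl | hs
      · obtain rfl : t = 1 := by linarith
        simpa using hv
      · constructor
        · have h1 := mul_pos hs hu.1
          have h2 := mul_nonneg ht hv.1.le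
          simpa using by linarith
        · have h1 := mul_neg_of_pos_of_neg hs hu.2
          have h2 := mul_nonpos_of_nonneg_of_nonpos ht hv.2.le
          simpa using by linarith
    have := hconv.isPreconnected.image (fun w => pt (w 0 • x + w 1 • y + w 2 • z))
      (hcont.comp (by fun_prop) fun w hw => hi.ne_zero (Or.inl hw.1.ne'))
    convert this using 1
    ext P
    constructor
    · rintro ⟨a, b, c, ha, hb, rfl⟩
      exact ⟨![a, b, c], ⟨ha, hb⟩, rfl⟩
    · rintro ⟨w, hw, rfl⟩
      exact ⟨_, _, _, hw.1, hw.2, rfl⟩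
  have hmem : ∀ {x y z : Vec} {P : RP2} (c : ℝ), P = pt (x - y + c • z) →
      P ∈ {P | ∃ a b c : ℝ, 0 < a ∧ b < 0 ∧ P = pt (a • x + b • y + c • z)} :=
    fun c hP => ⟨1, -1, c, by simp, by simp, hP.trans (by congr 1; module)⟩
  have hu := ((key h).union (pt (y₁ - y₂ - y₃)) (hmem (-1) (by congr 1; module))
    (hmem (-1) (by congr 1; module)) (key h.swap')).union (pt (y₁ - y₂ + y₃))
      (Or.inl (hmem 1 (by congr 1; module)))
      (hmem (-1) (by rw [← pt_neg]; congr 1; module)) (key h.rotate)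
  convert hu using 1
  have hneg : ∀ a b c : ℝ, pt (a • y₁ + b • y₂ + c • y₃) =
      pt ((-a) • y₁ + (-b) • y₂ + (-c) • y₃) := fun a b c => by
    rw [← pt_neg]; congr 1; module
  apply Subset.antisymm
  · intro P hP
    obtain ⟨v, hv, rfl⟩ := exists_eq_pt P
    obtain ⟨a, b, c, rfl⟩ := h.exists_coord v
    have h1 : ¬ (0 ≤ a ∧ 0 ≤ b ∧ 0 ≤ c) := fun ⟨ha, hb, hc⟩ =>
      hP ⟨_, ⟨a, b, c, ha, hb, hc, rfl⟩, hv, rfl⟩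
    have h2 : ¬ (a ≤ 0 ∧ b ≤ 0 ∧ c ≤ 0) := fun ⟨ha, hb, hc⟩ =>
      hP ⟨_, ⟨-a, -b, -c, by linarith, by linarith, by linarith, rfl⟩, by
        intro e; apply hv; rw [← neg_eq_zero, ← e]; module, hneg a b c⟩
    have h12 : ∀ a b c : ℝ, 0 < a → b < 0 → pt (a • y₁ + b • y₂ + c • y₃) ∈
      {P | ∃ a b c : ℝ, 0 < a ∧ b < 0 ∧ P = pt (a • y₁ + b • y₂ + c • y₃)} :=
      fun a b c ha hb => ⟨a, b, c, ha, hb, rfl⟩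
    have h13 : ∀ a b c : ℝ, 0 < a → c < 0 → pt (a • y₁ + b • y₂ + c • y₃) ∈
      {P | ∃ a b c : ℝ, 0 < a ∧ b < 0 ∧ P = pt (a • y₁ + b • y₃ + c • y₂)} :=
      fun a b c ha hc => ⟨a, c, b, ha, hc, by congr 1; module⟩
    have h23 : ∀ a b c : ℝ, 0 < b → c < 0 → pt (a • y₁ + b • y₂ + c • y₃) ∈
      {P | ∃ a b c : ℝ, 0 < a ∧ b < 0 ∧ P = pt (a • y₂ + b • y₃ + c • y₁)} :=
      fun a b c hb hc => ⟨b, c, a, hb, hc, by congr 1; module⟩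
    rcases lt_trichotomy a 0 with ha | rfl | ha
    · rcases lt_or_ge 0 b with hb | hb
      · rw [hneg]
        exact Or.inl (Or.inl (h12 _ _ _ (by linarith) (by linarith)))
      · rw [hneg]
        have hc : 0 < c := by by_contra hc; exact h2 ⟨ha.le, hb, by linarith⟩
        exact Or.inl (Or.inr (h13 _ _ _ (by linarith) (by linarith)))
    · rcases lt_trichotomy b 0 with hb | rfl | hb
      · rw [hneg]
        have hc : 0 < c := by by_contra hc; exact h2 ⟨le_rfl, hb.le, by linarith⟩
        exact Or.inr (h23 _ _ _ (by linarith) (by linarith))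
      · exfalso
        rcases le_total 0 c with hc | hc
        · exact h1 ⟨le_rfl, le_rfl, hc⟩
        · exact h2 ⟨le_rfl, le_rfl, hc⟩
      · have hc : c < 0 := by by_contra hc; exact h1 ⟨le_rfl, hb.le, by linarith⟩
        exact Or.inr (h23 _ _ _ hb hc)
    · rcases lt_or_ge b 0 with hb | hb
      · exact Or.inl (Or.inl (h12 _ _ _ ha hb))
      · have hc : c < 0 := by by_contra hc; exact h1 ⟨ha.le, hb, by linarith⟩
        exact Or.inl (Or.inr (h13 _ _ _ ha hc))
  · have main : ∀ a b c : ℝ, (0 < a ∨ 0 < b ∨ 0 < c) → (a < 0 ∨ b < 0 ∨ c < 0) →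
        pt (a • y₁ + b • y₂ + c • y₃) ∈ (tri y₁ y₂ y₃)ᶜ := by
      rintro a b c hp hn ⟨_, ⟨s, t, u, hs, ht, hu, rfl⟩, hv, e⟩
      have hne := h.ne_zero (s := a) (t := b) (u := c) (by
        rcases hp with hp | hp | hp <;> simp [hp.ne'])
      obtain ⟨r, hr, e⟩ := (pt_eq_pt_iff hne hv).1 e
      obtain ⟨rfl, rfl, rfl⟩ := h.eq_of_eq (s' := r * s) (t' := r * t) (u' := r * u)
        (e.trans (by module))
      rcases lt_or_gt_of_ne hr with h0 | h0
      · have := mul_nonpos_of_nonpos_of_nonneg h0.le hs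
        have := mul_nonpos_of_nonpos_of_nonneg h0.le ht
        have := mul_nonpos_of_nonpos_of_nonneg h0.le hu
        rcases hp with hp | hp | hp <;> linarith
      · have := mul_nonneg h0.le hs
        have := mul_nonneg h0.le ht
        have := mul_nonneg h0.le hu
        rcases hn with hn | hn | hn <;> linarith
    rintro P ((⟨a, b, c, ha, hb, rfl⟩ | ⟨a, b, c, ha, hb, rfl⟩) | ⟨a, b, c, ha, hb, rfl⟩)
    · exact main a b c (by simp [ha]) (by simp [hb])
    · rw [show a • y₁ + b • y₃ + c • y₂ = a • y₁ + c • y₂ + b • y₃ by module]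
      exact main a c b (by simp [ha]) (by simp [hb])
    · rw [show a • y₂ + b • y₃ + c • y₁ = c • y₁ + a • y₂ + b • y₃ by module]
      exact main c a b (by simp [ha]) (by simp [hb])

/-! ### The embedding after the exchange -/

namespace ProjectivePlanarEmbedding
variable {V : Type*} {G : SimpleGraph V} {f : ProjectivePlanarEmbedding G} {v₀ : V}

section
variable {v₁ v₂ v₃ : V} {y₁ y₂ y₃ : Vec}

lemma IsStandard.exists_of_mem_bend (h : f.IsStandard v₀ v₁ v₂ v₃ y₁ y₂ y₃) {e : Sym2 V}
    (he : e ∈ G.edgeSet) (h0 : v₀ ∉ e) {P : RP2} (hP : P ∈ f.arc e) (hb : P ∈ bend y₁ y₂ y₃) :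
    ∃ v ∈ e, v ∈ s(v₁, v₂) ∧ P = f.point v := by
  rcases h.arc_inter e he h0 P hP (bend_subset_tri _ _ _ hb) with rfl | rfl | rfl
  · rw [← h.point₁] at hP ⊢
    exact ⟨v₁, f.mem_of_point_mem_arc e he v₁ hP, by simp, rfl⟩
  · rw [← h.point₂] at hP ⊢
    exact ⟨v₂, f.mem_of_point_mem_arc e he v₂ hP, by simp, rfl⟩
  · exact absurd hb (pt_notMem_bend h.indep)

lemma IsStandard.mem_of_point_mem_bend (h : f.IsStandard v₀ v₁ v₂ v₃ y₁ y₂ y₃) {v : V}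
    (h0 : v ≠ v₀) (hb : f.point v ∈ bend y₁ y₂ y₃) : v ∈ s(v₁, v₂) := by
  by_contra hv
  rw [Sym2.mem_iff, not_or] at hv
  by_cases h3 : v = v₃
  · rw [h3, h.point₃] at hb
    exact pt_notMem_bend h.indep hb
  · exact h.point_notMem v h0 hv.1 hv.2 h3 (bend_subset_tri _ _ _ hb)

variable (f v₁ v₂ v₃ y₁ y₂ y₃) in
open Classical in
/-- The arcs of the embedding after the exchange. All three sides are drawn as bent sides, also
those which are edges before the exchange; the other edges keep their arcs. -/
noncomputable def deltaArc (e : Sym2 V) : Set RP2 :=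
  if e = s(v₁, v₂) then bend y₁ y₂ y₃
  else if e = s(v₁, v₃) then bend y₁ y₃ y₂
  else if e = s(v₂, v₃) then bend y₂ y₃ y₁
  else f.arc e

lemma deltaArc_cases {e : Sym2 V}
    (he : e = s(v₁, v₂) ∨ e = s(v₁, v₃) ∨ e = s(v₂, v₃) ∨ e ∈ G.edgeSet) :
    (e = s(v₁, v₂) ∧ f.deltaArc v₁ v₂ v₃ y₁ y₂ y₃ e = bend y₁ y₂ y₃) ∨
    (e = s(v₁, v₃) ∧ f.deltaArc v₁ v₂ v₃ y₁ y₂ y₃ e = bend y₁ y₃ y₂) ∨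
    (e = s(v₂, v₃) ∧ f.deltaArc v₁ v₂ v₃ y₁ y₂ y₃ e = bend y₂ y₃ y₁) ∨
    (e ∈ G.edgeSet ∧ f.deltaArc v₁ v₂ v₃ y₁ y₂ y₃ e = f.arc e) := by
  unfold deltaArc
  split_ifs <;> tauto

lemma IsStandard.mem_of_point_mem_deltaArc (h : f.IsStandard v₀ v₁ v₂ v₃ y₁ y₂ y₃) {e : Sym2 V}
    (he : e = s(v₁, v₂) ∨ e = s(v₁, v₃) ∨ e = s(v₂, v₃) ∨ e ∈ G.edgeSet) {v : V} (h0 : v ≠ v₀)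
    (hv : f.point v ∈ f.deltaArc v₁ v₂ v₃ y₁ y₂ y₃ e) : v ∈ e := by
  rcases deltaArc_cases (f := f) (y₁ := y₁) (y₂ := y₂) (y₃ := y₃) he with
    ⟨rfl, e1⟩ | ⟨rfl, e1⟩ | ⟨rfl, e1⟩ | ⟨he, e1⟩ <;> rw [e1] at hv
  · exact h.mem_of_point_mem_bend h0 hv
  · rw [← bend_comm] at hv
    rw [Sym2.eq_swap]
    exact h.rotate.rotate.mem_of_point_mem_bend h0 hv
  · exact h.rotate.mem_of_point_mem_bend h0 hv
  · exact f.mem_of_point_mem_arc e he v hv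

lemma IsStandard.deltaArc_inter_deltaArc (h : f.IsStandard v₀ v₁ v₂ v₃ y₁ y₂ y₃) {e e' : Sym2 V}
    (he : e = s(v₁, v₂) ∨ e = s(v₁, v₃) ∨ e = s(v₂, v₃) ∨ e ∈ G.edgeSet) (h0 : v₀ ∉ e)
    (he' : e' = s(v₁, v₂) ∨ e' = s(v₁, v₃) ∨ e' = s(v₂, v₃) ∨ e' ∈ G.edgeSet) (h0' : v₀ ∉ e')
    (hne : e ≠ e') {P : RP2} (hP : P ∈ f.deltaArc v₁ v₂ v₃ y₁ y₂ y₃ e)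
    (hP' : P ∈ f.deltaArc v₁ v₂ v₃ y₁ y₂ y₃ e') : ∃ v, v ∈ e ∧ v ∈ e' ∧ P = f.point v := by
  have k₁ : ∀ P ∈ bend y₁ y₂ y₃, P ∈ bend y₁ y₃ y₂ → P = f.point v₁ := fun P a b => by
    rw [h.point₁]; exact bend_inter_bend h.indep ⟨a, b⟩
  have k₂ : ∀ P ∈ bend y₁ y₂ y₃, P ∈ bend y₂ y₃ y₁ → P = f.point v₂ := fun P a b => by
    rw [h.point₂]; rw [← bend_comm] at a; exact bend_inter_bend h.indep.rotate ⟨b, a⟩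
  have k₃ : ∀ P ∈ bend y₁ y₃ y₂, P ∈ bend y₂ y₃ y₁ → P = f.point v₃ := fun P a b => by
    rw [h.point₃]; rw [← bend_comm] at a b; exact bend_inter_bend h.indep.rotate.rotate ⟨a, b⟩
  have m₁₂ : ∀ e ∈ G.edgeSet, v₀ ∉ e → ∀ P ∈ f.arc e, P ∈ bend y₁ y₂ y₃ →
      ∃ v ∈ e, v ∈ s(v₁, v₂) ∧ P = f.point v :=
    fun e he h0 P a b => h.exists_of_mem_bend he h0 a b
  have m₁₃ : ∀ e ∈ G.edgeSet, v₀ ∉ e → ∀ P ∈ f.arc e, P ∈ bend y₁ y₃ y₂ →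
      ∃ v ∈ e, v ∈ s(v₁, v₃) ∧ P = f.point v := fun e he h0 P a b => by
    rw [Sym2.eq_swap]
    exact h.rotate.rotate.exists_of_mem_bend he h0 a (by rwa [bend_comm])
  have m₂₃ : ∀ e ∈ G.edgeSet, v₀ ∉ e → ∀ P ∈ f.arc e, P ∈ bend y₂ y₃ y₁ →
      ∃ v ∈ e, v ∈ s(v₂, v₃) ∧ P = f.point v :=
    fun e he h0 P a b => h.rotate.exists_of_mem_bend he h0 a b
  rcases deltaArc_cases (f := f) (y₁ := y₁) (y₂ := y₂) (y₃ := y₃) he with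
    ⟨rfl, e1⟩ | ⟨rfl, e1⟩ | ⟨rfl, e1⟩ | ⟨he, e1⟩ <;> rw [e1] at hP <;>
  rcases deltaArc_cases (f := f) (y₁ := y₁) (y₂ := y₂) (y₃ := y₃) he' with
    ⟨rfl, e2⟩ | ⟨rfl, e2⟩ | ⟨rfl, e2⟩ | ⟨he', e2⟩ <;> rw [e2] at hP'
  · exact absurd rfl hne
  · exact ⟨v₁, by simp, by simp, k₁ P hP hP'⟩
  · exact ⟨v₂, by simp, by simp, k₂ P hP hP'⟩
  · obtain ⟨v, a, b, c⟩ := m₁₂ e' he' h0' P hP' hP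
    exact ⟨v, b, a, c⟩
  · exact ⟨v₁, by simp, by simp, k₁ P hP' hP⟩
  · exact absurd rfl hne
  · exact ⟨v₃, by simp, by simp, k₃ P hP hP'⟩
  · obtain ⟨v, a, b, c⟩ := m₁₃ e' he' h0' P hP' hP
    exact ⟨v, b, a, c⟩
  · exact ⟨v₂, by simp, by simp, k₂ P hP' hP⟩
  · exact ⟨v₃, by simp, by simp, k₃ P hP' hP⟩
  · exact absurd rfl hne
  · obtain ⟨v, a, b, c⟩ := m₂₃ e' he' h0' P hP' hP
    exact ⟨v, b, a, c⟩
  · obtain ⟨v, a, b, c⟩ := m₁₂ e he h0 P hP hP'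
    exact ⟨v, a, b, c⟩
  · obtain ⟨v, a, b, c⟩ := m₁₃ e he h0 P hP hP'
    exact ⟨v, a, b, c⟩
  · obtain ⟨v, a, b, c⟩ := m₂₃ e he h0 P hP hP'
    exact ⟨v, a, b, c⟩
  · exact f.arc_inter_arc e he e' he' hne P ⟨hP, hP'⟩

end

variable {v₁ v₂ v₃ : {v : V // v ≠ v₀}} {y₁ y₂ y₃ : Vec}

lemma IsStandard.adj_cases (h : f.IsStandard v₀ v₁ v₂ v₃ y₁ y₂ y₃) {a b : {v : V // v ≠ v₀}}
    (hab : (yDeltaExchange G v₀).Adj a b) :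
    s(a, b) = s(v₁, v₂) ∨ s(a, b) = s(v₁, v₃) ∨ s(a, b) = s(v₂, v₃) ∨ G.Adj a b := by
  rcases hab with hab | ⟨hne, ha, hb⟩
  · exact Or.inr (Or.inr (Or.inr hab))
  · rw [h.adj_iff] at ha hb
    simp only [Subtype.coe_inj] at ha hb
    rcases ha with rfl | rfl | rfl <;> rcases hb with rfl | rfl | rfl <;>
      first | exact absurd rfl hne | simp [Sym2.eq_swap]

lemma IsStandard.map_val_cases (h : f.IsStandard v₀ v₁ v₂ v₃ y₁ y₂ y₃)
    {e : Sym2 {v : V // v ≠ v₀}} (he : e ∈ (yDeltaExchange G v₀).edgeSet) :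
    e.map Subtype.val = s(v₁.1, v₂.1) ∨ e.map Subtype.val = s(v₁.1, v₃.1) ∨
      e.map Subtype.val = s(v₂.1, v₃.1) ∨ e.map Subtype.val ∈ G.edgeSet := by
  induction e with
  | h a b =>
    rcases h.adj_cases he with h | h | h | h
    · rw [h]; simp
    · rw [h]; simp
    · rw [h]; simp
    · exact Or.inr (Or.inr (Or.inr h))

lemma notMem_map_val (e : Sym2 {v : V // v ≠ v₀}) : v₀ ∉ e.map Subtype.val := by
  rw [Sym2.mem_map]
  rintro ⟨v, -, hv⟩
  exact v.2 hv

/-- The embedding after the exchange. -/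
noncomputable def deltaEmbedding (h : f.IsStandard v₀ v₁ v₂ v₃ y₁ y₂ y₃) :
    ProjectivePlanarEmbedding (yDeltaExchange G v₀) where
  point v := f.point v
  arc e := f.deltaArc v₁ v₂ v₃ y₁ y₂ y₃ (e.map Subtype.val)
  point_injective := f.point_injective.comp Subtype.val_injective
  isPLArc u v huv := by
    rw [isPLArc_iff_polyArc (f.point_injective.ne fun e => huv.ne (Subtype.ext e))]
    have key : ∀ {a b : {v : V // v ≠ v₀}} {x y z : Vec}, Indep3 x y z → f.point a = pt x →
        f.point b = pt y → s(u, v) = s(a, b) →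
        PolyArc (f.point u) (f.point v) (bend x y z) := by
      intro a b x y z hi ha hb e
      rcases Sym2.eq_iff.1 e with ⟨rfl, rfl⟩ | ⟨rfl, rfl⟩
      · rw [ha, hb]
        exact polyArc_bend hi
      · rw [ha, hb, ← bend_comm]
        exact polyArc_bend hi.swap
    have inj := Sym2.map.injective (Subtype.val_injective (p := fun v => v ≠ v₀))
    rcases deltaArc_cases (f := f) (y₁ := y₁) (y₂ := y₂) (y₃ := y₃)
      (h.map_val_cases (e := s(u, v)) huv) with ⟨e, e1⟩ | ⟨e, e1⟩ | ⟨e, e1⟩ | ⟨e, e1⟩ <;> rw [e1]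
    · exact key h.indep h.point₁ h.point₂ (inj e)
    · exact key h.indep.swap' h.point₁ h.point₃ (inj e)
    · exact key h.indep.rotate h.point₂ h.point₃ (inj e)
    · exact f.polyArc e
  mem_of_point_mem_arc e he v hv := by
    have := h.mem_of_point_mem_deltaArc (h.map_val_cases he) v.2 hv
    obtain ⟨w, hw, e⟩ := Sym2.mem_map.1 this
    rwa [← Subtype.ext e]
  arc_inter_arc e he e' he' hne P hP := by
    obtain ⟨v, h1, h2, rfl⟩ := h.deltaArc_inter_deltaArc (h.map_val_cases he) (notMem_map_val e)
      (h.map_val_cases he') (notMem_map_val e')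
      ((Sym2.map.injective Subtype.val_injective).ne hne) hP.1 hP.2
    obtain ⟨w, hw, rfl⟩ := Sym2.mem_map.1 h1
    obtain ⟨w', hw', e⟩ := Sym2.mem_map.1 h2
    obtain rfl := Subtype.ext e
    exact ⟨w', hw, hw', rfl⟩

/-- `g` is the embedding after the exchange which arises from the standard embedding `f`. In this
form the data can be permuted. -/
structure IsDelta (f : ProjectivePlanarEmbedding G)
    (g : ProjectivePlanarEmbedding (yDeltaExchange G v₀)) (v₁ v₂ v₃ : {v : V // v ≠ v₀})
    (y₁ y₂ y₃ : Vec) : Prop where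
  std : f.IsStandard v₀ v₁ v₂ v₃ y₁ y₂ y₃
  point : ∀ v, g.point v = f.point v
  arc₁₂ : g.arc s(v₁, v₂) = bend y₁ y₂ y₃
  arc₁₃ : g.arc s(v₁, v₃) = bend y₁ y₃ y₂
  arc₂₃ : g.arc s(v₂, v₃) = bend y₂ y₃ y₁
  arc_other : ∀ e, e ≠ s(v₁, v₂) → e ≠ s(v₁, v₃) → e ≠ s(v₂, v₃) →
    g.arc e = f.arc (e.map Subtype.val)

namespace IsDelta
variable {g : ProjectivePlanarEmbedding (yDeltaExchange G v₀)}

lemma rotate (h : IsDelta f g v₁ v₂ v₃ y₁ y₂ y₃) : IsDelta f g v₂ v₃ v₁ y₂ y₃ y₁ :=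
  ⟨h.std.rotate, h.point, h.arc₂₃, by rw [Sym2.eq_swap, h.arc₁₂, bend_comm],
    by rw [Sym2.eq_swap, h.arc₁₃, bend_comm], fun e a b c =>
      h.arc_other e (by rwa [Sym2.eq_swap]) (by rwa [Sym2.eq_swap]) a⟩

lemma swap (h : IsDelta f g v₁ v₂ v₃ y₁ y₂ y₃) : IsDelta f g v₂ v₁ v₃ y₂ y₁ y₃ :=
  ⟨h.std.swap, h.point, by rw [Sym2.eq_swap, h.arc₁₂, bend_comm], h.arc₂₃, h.arc₁₃,
    fun e a b c => h.arc_other e (by rwa [Sym2.eq_swap]) c b⟩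

end IsDelta

lemma isDelta_deltaEmbedding (h : f.IsStandard v₀ v₁ v₂ v₃ y₁ y₂ y₃) :
    IsDelta f (deltaEmbedding h) v₁ v₂ v₃ y₁ y₂ y₃ := by
  have inj := Sym2.map.injective (Subtype.val_injective (p := fun v => v ≠ v₀))
  have n₁ : s(v₁.1, v₃.1) ≠ s(v₁.1, v₂.1) := by simp [h.ne₁₂, h.ne₂₃.symm]
  have n₂ : s(v₂.1, v₃.1) ≠ s(v₁.1, v₂.1) := by simp [h.ne₁₂.symm, h.ne₁₃.symm]
  have n₃ : s(v₂.1, v₃.1) ≠ s(v₁.1, v₃.1) := by simp [h.ne₁₂.symm, h.ne₂₃]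
  refine ⟨h, fun v => rfl, ?_, ?_, ?_, fun e a b c => ?_⟩
  · exact if_pos rfl
  · exact (if_neg n₁).trans (if_pos rfl)
  · exact (if_neg n₂).trans ((if_neg n₃).trans (if_pos rfl))
  · exact (if_neg (inj.ne a)).trans ((if_neg (inj.ne b)).trans (if_neg (inj.ne c)))

end ProjectivePlanarEmbedding

/-! ### Opening cycles and moving them between the graphs -/

namespace SimpleGraph.Walk
variable {V : Type*} {G : SimpleGraph V}

/-- A path that uses an edge at its start starts with this edge. -/
lemma IsPath.exists_eq_cons {a b d : V} {P : G.Walk a d} (hP : P.IsPath) (h : s(a, b) ∈ P.edges) :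
    ∃ (hab : G.Adj a b) (Q : G.Walk b d), P = cons hab Q ∧ Q.IsPath ∧ a ∉ Q.support := by
  cases P with
  | nil => simp at h
  | cons hab Q =>
    rw [cons_isPath_iff] at hP
    rcases List.mem_cons.1 (edges_cons hab Q ▸ h) with e | e
    · obtain rfl := Sym2.congr_right.1 e
      exact ⟨hab, Q, rfl, hP⟩
    · exact absurd (Q.fst_mem_support_of_mem_edges e) hP.2

/-- A cycle consists of any of its edges and a path that joins the ends of the edge. -/
lemma IsCycle.exists_path {u a b : V} {C : G.Walk u u} (hC : C.IsCycle) (h : s(a, b) ∈ C.edges) :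
    ∃ P : G.Walk b a, P.IsPath ∧ s(a, b) ∉ P.edges ∧
      (∀ e, e ∈ C.edges ↔ e = s(a, b) ∨ e ∈ P.edges) ∧ ∀ v ∈ P.support, v ∈ C.support := by
  classical
  have ha : a ∈ C.support := C.fst_mem_support_of_mem_edges h
  have hE : ∀ e, e ∈ (C.rotate a ha).edges ↔ e ∈ C.edges := fun e => (C.rotate_edges a ha).mem_iff
  have hS : ∀ v, v ∈ (C.rotate a ha).support ↔ v ∈ C.support := fun v =>
    C.mem_support_rotate_iff a ha
  have hC' := hC.rotate ha
  rw [← hE] at h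
  simp only [← hE, ← hS]
  generalize C.rotate a ha = C at *
  cases C with
  | nil => simp at h
  | @cons _ w _ haw p =>
    rw [cons_isCycle_iff] at hC'
    obtain ⟨hp, hw⟩ := hC'
    by_cases hbw : b = w
    · subst hbw
      exact ⟨p, hp, hw, by simp, fun v hv => by simp [hv]⟩
    · have hb : s(a, b) ∈ p.reverse.edges := by
        rw [edges_reverse, List.mem_reverse]
        rcases List.mem_cons.1 (edges_cons haw p ▸ h) with e | e
        · exact absurd (Sym2.congr_right.1 e) hbw
        · exact e
      obtain ⟨hab, q, e, hq, haq⟩ := hp.reverse.exists_eq_cons hb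
      have e1 : ∀ e, e ∈ p.edges ↔ e = s(a, b) ∨ e ∈ q.edges := fun e' => by
        rw [← List.mem_reverse, ← edges_reverse, e, edges_cons, List.mem_cons]
      have e2 : ∀ v, v ∈ p.support ↔ v = a ∨ v ∈ q.support := fun v => by
        rw [← List.mem_reverse, ← support_reverse, e, support_cons, List.mem_cons]
      refine ⟨q.concat haw.symm, hq.concat haq _, ?_, fun e' => ?_, fun v hv => ?_⟩
      · rw [edges_concat, List.concat_eq_append, List.mem_append, List.mem_singleton, not_or]
        refine ⟨fun hm => haq (q.fst_mem_support_of_mem_edges hm), fun hm => hbw ?_⟩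
        rw [Sym2.eq_swap] at hm
        exact Sym2.congr_left.1 hm
      · rw [edges_concat, List.concat_eq_append, List.mem_append, List.mem_singleton, edges_cons,
          List.mem_cons, e1, Sym2.eq_swap (a := w)]
        tauto
      · rw [support_concat, List.mem_append, List.mem_singleton] at hv
        rw [support_cons, List.mem_cons, e2]
        tauto

end SimpleGraph.Walk

lemma ProjectivePlanarEmbedding.isClosed_carrier {V : Type*} {G : SimpleGraph V}
    (f : ProjectivePlanarEmbedding G) {u v : V} (w : G.Walk u v) : IsClosed (f.carrier w) := by
  have e : f.carrier w = ⋃ e ∈ {e | e ∈ w.edges}, f.arc e := by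
    ext p
    simp [carrier]
  rw [e]
  exact w.edges.finite_toSet.isClosed_biUnion fun e he =>
    f.isClosed_arc (w.edges_subset_edgeSet he)

namespace ProjectivePlanarEmbedding.IsDelta
variable {V : Type*} {G : SimpleGraph V} {f : ProjectivePlanarEmbedding G} {v₀ : V}
  {g : ProjectivePlanarEmbedding (yDeltaExchange G v₀)} {v₁ v₂ v₃ : {v : V // v ≠ v₀}}
  {y₁ y₂ y₃ : Vec}

/-- A walk without the three sides is a walk in the graph before the exchange. -/
lemma exists_walk (h : IsDelta f g v₁ v₂ v₃ y₁ y₂ y₃) {a b : {v : V // v ≠ v₀}}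
    (P : (yDeltaExchange G v₀).Walk a b)
    (hP : ∀ e ∈ P.edges, e ≠ s(v₁, v₂) ∧ e ≠ s(v₁, v₃) ∧ e ≠ s(v₂, v₃)) :
    ∃ Q : G.Walk a.1 b.1, (P.IsPath → Q.IsPath) ∧ Q.edges = P.edges.map (Sym2.map Subtype.val) ∧
      Q.support = P.support.map Subtype.val ∧ f.carrier Q = g.carrier P := by
  have hE : ∀ e ∈ P.edges, e ∈ (G.comap (Function.Embedding.subtype (· ≠ v₀))).edgeSet := by
    intro e he
    have he' := P.edges_subset_edgeSet he
    have := hP e he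
    induction e with
    | h u v =>
      rcases h.std.adj_cases he' with h | h | h | h
      · exact absurd h this.1
      · exact absurd h this.2.1
      · exact absurd h this.2.2
      · exact h
  let φ := (SimpleGraph.Embedding.comap (Function.Embedding.subtype (· ≠ v₀)) G).toHom
  obtain ⟨Q, hp, he, hs⟩ : ∃ Q : G.Walk a.1 b.1, (P.IsPath → Q.IsPath) ∧
      Q.edges = P.edges.map (Sym2.map Subtype.val) ∧ Q.support = P.support.map Subtype.val := by
    have e₁ : ((P.transfer _ hE).map φ).edges = P.edges.map (Sym2.map Subtype.val) := by
      rw [SimpleGraph.Walk.edges_map, SimpleGraph.Walk.edges_transfer]; rfl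
    have e₂ : ((P.transfer _ hE).map φ).support = P.support.map Subtype.val := by
      rw [SimpleGraph.Walk.support_map, SimpleGraph.Walk.support_transfer]; rfl
    exact ⟨(P.transfer _ hE).map φ, fun hp => (hp.transfer hE).map Subtype.val_injective, e₁, e₂⟩
  refine ⟨Q, hp, he, hs, ?_⟩
  ext p
  simp only [carrier, he]
  constructor
  · rintro ⟨_, hm, hp⟩
    obtain ⟨e, he', rfl⟩ := List.mem_map.1 hm
    obtain ⟨a, b, c⟩ := hP e he'
    exact ⟨e, he', by rwa [h.arc_other e a b c]⟩
  · rintro ⟨e, he, hp⟩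
    obtain ⟨a, b, c⟩ := hP e he
    exact ⟨_, List.mem_map_of_mem he, by rwa [h.arc_other e a b c] at hp⟩

/-- The way in which the hypothesis is used: if a homeomorphism carries a cycle through `v₀` of the
graph before the exchange to a curve `K` that bounds a disk, and fixes two vertices, then `K` does
not separate these vertices, since the cycle bounds a disk as well and does not separate them. -/
lemma component_eq (h : IsDelta f g v₁ v₂ v₃ y₁ y₂ y₃) (hf : ¬ f.IsSeparating)
    {x y : {v : V // v ≠ v₀}} (hx : G.Adj v₀ x) (hy : G.Adj v₀ y) (hxy : x ≠ y)
    {P : (yDeltaExchange G v₀).Walk x y} (hP : P.IsPath)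
    (hPe : ∀ e ∈ P.edges, e ≠ s(v₁, v₂) ∧ e ≠ s(v₁, v₃) ∧ e ≠ s(v₂, v₃))
    {K : Set RP2} (hK : BoundsDisk K) {φ : RP2 ≃ₜ RP2}
    (hφ : φ '' (f.arc s(v₀, x.1) ∪ f.arc s(v₀, y.1) ∪ g.carrier P) = K)
    {a b : {v : V // v ≠ v₀}} (ha : a ∉ P.support) (hb : b ∉ P.support)
    (fa : φ (g.point a) = g.point a) (fb : φ (g.point b) = g.point b) :
    connectedComponentIn Kᶜ (g.point a) = connectedComponentIn Kᶜ (g.point b) := by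
  obtain ⟨Q, hQ, hQe, hQs, hQc⟩ := h.exists_walk P hPe
  have h0 : v₀ ∉ Q.support := by
    rw [hQs, List.mem_map]
    rintro ⟨v, -, hv⟩
    exact v.2 hv
  set D : G.Walk y.1 y.1 := .cons hy.symm (.cons hx Q) with hD
  have hDc : f.carrier D = f.arc s(v₀, x.1) ∪ f.arc s(v₀, y.1) ∪ g.carrier P := by
    rw [← hQc]
    ext p
    simp only [carrier, hD, SimpleGraph.Walk.edges_cons, List.mem_cons, mem_union, mem_ofPred_eq,
      or_and_right, exists_or, exists_eq_left]
    rw [Sym2.eq_swap (a := y.1)]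
    tauto
  have hDs : ∀ v : {v : V // v ≠ v₀}, v ∉ P.support → v.1 ∉ D.support := by
    intro v hv hm
    simp only [hD, SimpleGraph.Walk.support_cons, List.mem_cons, hQs, List.mem_map] at hm
    rcases hm with hm | hm | ⟨w, hw, e⟩
    · exact hv (Subtype.ext hm ▸ P.end_mem_support)
    · exact v.2 hm
    · exact hv (Subtype.ext e ▸ hw)
  have hcyc : D.IsCycle := by
    rw [hD, SimpleGraph.Walk.cons_isCycle_iff, SimpleGraph.Walk.cons_isPath_iff]
    refine ⟨⟨hQ hP, h0⟩, ?_⟩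
    rw [SimpleGraph.Walk.edges_cons, List.mem_cons, not_or]
    refine ⟨fun e => hxy (Subtype.ext ?_), fun hm => h0 (Q.snd_mem_support_of_mem_edges hm)⟩
    rw [Sym2.eq_swap] at e
    exact (Sym2.congr_right.1 e).symm
  rw [← hDc] at hφ
  by_contra hne
  refine hf ⟨_, D, hcyc, ?_, a, b, hDs a ha, hDs b hb, fun e => hne ?_⟩
  · have := hK.image φ.symm
    rwa [← hφ, ← image_comp, φ.symm_comp_self, image_id] at this
  · have := connectedComponentIn_compl_image_eq
      (fun hm => hDs a ha (f.mem_support_of_point_mem_carrier D hm))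
      (fun hm => hDs b hb (f.mem_support_of_point_mem_carrier D hm)) e φ
    rwa [hφ, ← h.point, ← h.point, fa, fb] at this

/-- What a walk without the three sides has in the triangle. -/
lemma eq_of_mem_carrier (h : IsDelta f g v₁ v₂ v₃ y₁ y₂ y₃) {u v : {v : V // v ≠ v₀}}
    {P : (yDeltaExchange G v₀).Walk u v}
    (hPe : ∀ e ∈ P.edges, e ≠ s(v₁, v₂) ∧ e ≠ s(v₁, v₃) ∧ e ≠ s(v₂, v₃)) {p : RP2}
    (hp : p ∈ g.carrier P) (ht : p ∈ tri y₁ y₂ y₃) : p = pt y₁ ∨ p = pt y₂ ∨ p = pt y₃ := by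
  obtain ⟨Q, -, hQe, -, hQc⟩ := h.exists_walk P hPe
  rw [← hQc] at hp
  obtain ⟨e, he, hpe⟩ := hp
  have hG := Q.edges_subset_edgeSet he
  rw [hQe, List.mem_map] at he
  obtain ⟨e, -, rfl⟩ := he
  exact h.std.arc_inter _ hG (notMem_map_val e) p hpe ht

lemma eq_of_point_mem_tri (h : IsDelta f g v₁ v₂ v₃ y₁ y₂ y₃) {v : {v : V // v ≠ v₀}}
    (ht : g.point v ∈ tri y₁ y₂ y₃) : v = v₁ ∨ v = v₂ ∨ v = v₃ := by
  by_contra! hc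
  rw [h.point] at ht
  exact h.std.point_notMem v v.2 (fun e => hc.1 (Subtype.ext e)) (fun e => hc.2.1 (Subtype.ext e))
    (fun e => hc.2.2 (Subtype.ext e)) ht

/-- A cycle with one of the sides: the side `v₁ v₂` is replaced by the path `v₁ v₀ v₂`, whose arc is
moved to the bent side within the triangle, where there is nothing else of the cycle. -/
lemma component_eq_of_one (h : IsDelta f g v₁ v₂ v₃ y₁ y₂ y₃) (hf : ¬ f.IsSeparating)
    {u : {v : V // v ≠ v₀}} {C : (yDeltaExchange G v₀).Walk u u} (hC : C.IsCycle)
    (hK : BoundsDisk (g.carrier C)) (h₁₂ : s(v₁, v₂) ∈ C.edges) (h₁₃ : s(v₁, v₃) ∉ C.edges)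
    (h₂₃ : s(v₂, v₃) ∉ C.edges) {a b : {v : V // v ≠ v₀}} (ha : a ∉ C.support)
    (hb : b ∉ C.support) : connectedComponentIn (g.carrier C)ᶜ (g.point a) =
      connectedComponentIn (g.carrier C)ᶜ (g.point b) := by
  obtain ⟨P, hP, hPn, hPe, hPs⟩ := hC.exists_path h₁₂
  have old : ∀ e ∈ P.edges, e ≠ s(v₁, v₂) ∧ e ≠ s(v₁, v₃) ∧ e ≠ s(v₂, v₃) := fun e he =>
    ⟨fun e' => hPn (e' ▸ he), fun e' => h₁₃ (e' ▸ (hPe e).2 (Or.inr he)),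
      fun e' => h₂₃ (e' ▸ (hPe e).2 (Or.inr he))⟩
  have hpt : ∀ v, g.point v ∈ tri y₁ y₂ y₃ → g.point v ∈ ({pt y₁, pt y₂, pt y₃} : Set RP2) := by
    intro v hv
    rw [h.point]
    rcases h.eq_of_point_mem_tri hv with rfl | rfl | rfl
    · exact Or.inl h.std.point₁
    · exact Or.inr (Or.inl h.std.point₂)
    · exact Or.inr (Or.inr h.std.point₃)
  obtain ⟨φ, fix, hφ⟩ := exists_homeomorph_bend h.std.indep
    (F := g.carrier P ∪ {g.point a, g.point b}) (by
      rintro p ⟨hp | rfl | rfl, ht⟩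
      · exact h.eq_of_mem_carrier old hp ht
      · exact hpt _ ht
      · exact hpt _ ht)
  refine h.component_eq hf ((h.std.adj_iff _).2 (by simp)) ((h.std.adj_iff _).2 (by simp))
    (fun e => h.std.ne₁₂ (congrArg Subtype.val e).symm) hP old hK (φ := φ) ?_
    (fun hm => ha (hPs a hm)) (fun hm => hb (hPs b hm)) (fix _ (by simp)) (fix _ (by simp))
  rw [h.std.arc₁, h.std.arc₂, union_comm (seg _ y₂), image_union, hφ,
    image_eq_self fun p hp => fix p (Or.inl hp), ← h.arc₁₂]
  ext p
  simp only [carrier, hPe, mem_union, mem_ofPred_eq, or_and_right, exists_or, exists_eq_left]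

/-- A cycle with two of the sides: the path `v₁ v₂ v₃` is replaced by `v₁ v₀ v₃`. The vertex `v₂` is
on the cycle after the exchange, so it is neither one of the two given vertices nor an end of
another edge of the cycle, and the arc may be moved over its point. -/
lemma component_eq_of_two (h : IsDelta f g v₁ v₂ v₃ y₁ y₂ y₃) (hf : ¬ f.IsSeparating)
    {u : {v : V // v ≠ v₀}} {C : (yDeltaExchange G v₀).Walk u u} (hC : C.IsCycle)
    (hK : BoundsDisk (g.carrier C)) (h₁₂ : s(v₁, v₂) ∈ C.edges) (h₁₃ : s(v₁, v₃) ∉ C.edges)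
    (h₂₃ : s(v₂, v₃) ∈ C.edges) {a b : {v : V // v ≠ v₀}} (ha : a ∉ C.support)
    (hb : b ∉ C.support) : connectedComponentIn (g.carrier C)ᶜ (g.point a) =
      connectedComponentIn (g.carrier C)ᶜ (g.point b) := by
  have hne : v₁ ≠ v₃ := fun e => h.std.ne₁₃ (congrArg Subtype.val e)
  obtain ⟨P, hP, hPn, hPe, hPs⟩ := hC.exists_path h₁₂
  -- the rest of the cycle starts with the other side
  have hP₂ : s(v₂, v₃) ∈ P.edges := by
    refine ((hPe _).1 h₂₃).resolve_left fun e => hne ?_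
    rw [Sym2.eq_swap (a := v₁)] at e
    exact (Sym2.congr_right.1 e).symm
  obtain ⟨h', Q, rfl, hQ, h₂⟩ := hP.exists_eq_cons hP₂
  simp only [SimpleGraph.Walk.edges_cons, SimpleGraph.Walk.support_cons, List.mem_cons] at *
  have old : ∀ e ∈ Q.edges, e ≠ s(v₁, v₂) ∧ e ≠ s(v₁, v₃) ∧ e ≠ s(v₂, v₃) := fun e he =>
    ⟨fun e' => hPn (Or.inr (e' ▸ he)), fun e' => h₁₃ (e' ▸ (hPe e).2 (Or.inr (Or.inr he))),
      fun e' => h₂ (Q.fst_mem_support_of_mem_edges (e' ▸ he))⟩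
  have hpt : ∀ v, v ∉ C.support → g.point v ∈ tri y₁ y₂ y₃ →
      g.point v ∈ ({pt y₁, pt y₃} : Set RP2) := by
    intro v hv ht
    rw [h.point]
    rcases h.eq_of_point_mem_tri ht with rfl | rfl | rfl
    · exact Or.inl h.std.point₁
    · exact absurd (hPs _ (Or.inl rfl)) hv
    · exact Or.inr h.std.point₃
  obtain ⟨φ, fix, hφ⟩ := exists_homeomorph_bend_union_bend h.std.indep
    (F := g.carrier Q ∪ {g.point a, g.point b})
    ((g.isClosed_carrier Q).union ((isClosed_singleton_pt _).union (isClosed_singleton_pt _))) (by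
      rintro p ⟨hp | rfl | rfl, ht⟩
      · rcases h.eq_of_mem_carrier old hp ht with rfl | rfl | rfl
        · exact Or.inl rfl
        · rw [← h.std.point₂, ← h.point] at hp
          exact absurd (g.mem_support_of_point_mem_carrier Q hp) h₂
        · exact Or.inr rfl
      · exact hpt _ ha ht
      · exact hpt _ hb ht)
  refine h.component_eq hf ((h.std.adj_iff _).2 (by simp)) ((h.std.adj_iff _).2 (by simp))
    hne.symm hQ old hK (φ := φ) ?_ (fun hm => ha (hPs a (Or.inr hm)))
    (fun hm => hb (hPs b (Or.inr hm))) (fix _ (by simp)) (fix _ (by simp))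
  rw [h.std.arc₁, h.std.arc₃, union_comm (seg _ y₃), image_union, hφ,
    image_eq_self fun p hp => fix p (Or.inl hp), ← h.arc₁₂, ← h.arc₂₃]
  ext p
  simp only [carrier, hPe, mem_union, mem_ofPred_eq, or_and_right, exists_or, exists_eq_left,
    or_assoc]

/-- A cycle with all three sides: it is the triangle `v₁ v₂ v₃` itself, and every other vertex lies
outside of the triangle `y₁ y₂ y₃`, whose complement is connected. -/
lemma component_eq_of_three (h : IsDelta f g v₁ v₂ v₃ y₁ y₂ y₃)
    {u : {v : V // v ≠ v₀}} {C : (yDeltaExchange G v₀).Walk u u} (hC : C.IsCycle)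
    (h₁₂ : s(v₁, v₂) ∈ C.edges) (h₁₃ : s(v₁, v₃) ∈ C.edges)
    (h₂₃ : s(v₂, v₃) ∈ C.edges) {a b : {v : V // v ≠ v₀}} (ha : a ∉ C.support)
    (hb : b ∉ C.support) : connectedComponentIn (g.carrier C)ᶜ (g.point a) =
      connectedComponentIn (g.carrier C)ᶜ (g.point b) := by
  have n₁₂ : v₁ ≠ v₂ := fun e => h.std.ne₁₂ (congrArg Subtype.val e)
  have n₁₃ : v₁ ≠ v₃ := fun e => h.std.ne₁₃ (congrArg Subtype.val e)
  have n₂₃ : v₂ ≠ v₃ := fun e => h.std.ne₂₃ (congrArg Subtype.val e)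
  have hsub : g.carrier C ⊆ tri y₁ y₂ y₃ := by
    obtain ⟨P, hP, hPn, hPe, -⟩ := hC.exists_path h₁₂
    have hP₂ : s(v₂, v₃) ∈ P.edges :=
      ((hPe _).1 h₂₃).resolve_left (by simp [n₁₂.symm, n₁₃.symm])
    obtain ⟨h', Q, rfl, hQ, h₂⟩ := hP.exists_eq_cons hP₂
    simp only [SimpleGraph.Walk.edges_cons, List.mem_cons] at hPe
    have hQ₃ : s(v₃, v₁) ∈ Q.edges := by
      rw [Sym2.eq_swap]
      exact (((hPe _).1 h₁₃).resolve_left (by simp [n₂₃.symm, n₁₂])).resolve_left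
        (by simp [n₁₂, n₁₃])
    obtain ⟨h'', R, rfl, hR, -⟩ := hQ.exists_eq_cons hQ₃
    obtain rfl := (SimpleGraph.Walk.isPath_iff_nil.1 hR).eq_nil
    rintro p ⟨e, he, hp⟩
    rw [hPe] at he
    simp only [SimpleGraph.Walk.edges_cons, SimpleGraph.Walk.edges_nil, List.mem_singleton] at he
    rcases he with rfl | rfl | rfl
    · rw [h.arc₁₂] at hp
      exact bend_subset_tri _ _ _ hp
    · rw [h.arc₂₃] at hp
      rw [← tri_rotate]
      exact bend_subset_tri _ _ _ hp
    · rw [Sym2.eq_swap, h.arc₁₃, ← bend_comm] at hp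
      rw [← tri_rotate, ← tri_rotate]
      exact bend_subset_tri _ _ _ hp
  have hout : ∀ v, v ∉ C.support → g.point v ∈ (tri y₁ y₂ y₃)ᶜ := by
    intro v hv ht
    rcases h.eq_of_point_mem_tri ht with rfl | rfl | rfl
    · exact hv (C.fst_mem_support_of_mem_edges h₁₂)
    · exact hv (C.snd_mem_support_of_mem_edges h₁₂)
    · exact hv (C.snd_mem_support_of_mem_edges h₁₃)
  exact connectedComponentIn_eq ((isPreconnected_compl_tri h.std.indep).subset_connectedComponentIn
    (hout a ha) (compl_subset_compl.2 hsub) (hout b hb))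

/-- A cycle without the three sides is a cycle before the exchange, with the same carrier. -/
lemma component_eq_of_none (h : IsDelta f g v₁ v₂ v₃ y₁ y₂ y₃) (hf : ¬ f.IsSeparating)
    {u : {v : V // v ≠ v₀}} {C : (yDeltaExchange G v₀).Walk u u} (hC : C.IsCycle)
    (hK : BoundsDisk (g.carrier C)) (h₁₂ : s(v₁, v₂) ∉ C.edges) (h₁₃ : s(v₁, v₃) ∉ C.edges)
    (h₂₃ : s(v₂, v₃) ∉ C.edges) {a b : {v : V // v ≠ v₀}} (ha : a ∉ C.support)
    (hb : b ∉ C.support) : connectedComponentIn (g.carrier C)ᶜ (g.point a) =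
      connectedComponentIn (g.carrier C)ᶜ (g.point b) := by
  obtain ⟨Q, -, hQe, hQs, hQ⟩ := h.exists_walk C fun e he =>
    ⟨fun e' => h₁₂ (e' ▸ he), fun e' => h₁₃ (e' ▸ he), fun e' => h₂₃ (e' ▸ he)⟩
  have hs : ∀ v : {v : V // v ≠ v₀}, v ∉ C.support → v.1 ∉ Q.support := by
    intro v hv hm
    rw [hQs, List.mem_map] at hm
    obtain ⟨w, hw, e⟩ := hm
    exact hv (Subtype.ext e ▸ hw)
  have hQc : Q.IsCycle := by
    rw [SimpleGraph.Walk.isCycle_def, SimpleGraph.Walk.isTrail_def] at hC ⊢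
    refine ⟨?_, ?_, ?_⟩
    · rw [hQe]
      exact hC.1.map (Sym2.map.injective Subtype.val_injective)
    · rintro rfl
      have := List.map_eq_nil_iff.1 hQe.symm
      exact hC.2.1 (SimpleGraph.Walk.edges_eq_nil.1 this).eq_nil
    · rw [hQs, ← List.map_tail]
      exact hC.2.2.map Subtype.val_injective
  by_contra hne
  rw [← hQ] at hK hne
  rw [h.point, h.point] at hne
  exact hf ⟨_, Q, hQc, hK, a, b, hs a ha, hs b hb, hne⟩

theorem not_isSeparating (h : IsDelta f g v₁ v₂ v₃ y₁ y₂ y₃) (hf : ¬ f.IsSeparating) :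
    ¬ g.IsSeparating := by
  rintro ⟨u, C, hC, hK, a, b, ha, hb, hne⟩
  refine hne ?_
  have e₁₂ := Sym2.eq_swap (a := v₁) (b := v₂)
  have e₁₃ := Sym2.eq_swap (a := v₁) (b := v₃)
  have e₂₃ := Sym2.eq_swap (a := v₂) (b := v₃)
  by_cases h₁₂ : s(v₁, v₂) ∈ C.edges <;> by_cases h₁₃ : s(v₁, v₃) ∈ C.edges <;>
    by_cases h₂₃ : s(v₂, v₃) ∈ C.edges
  · exact h.component_eq_of_three hC h₁₂ h₁₃ h₂₃ ha hb
  · exact h.swap.component_eq_of_two hf hC hK (e₁₂ ▸ h₁₂) h₂₃ h₁₃ ha hb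
  · exact h.component_eq_of_two hf hC hK h₁₂ h₁₃ h₂₃ ha hb
  · exact h.component_eq_of_one hf hC hK h₁₂ h₁₃ h₂₃ ha hb
  · exact h.rotate.component_eq_of_two hf hC hK h₂₃ (e₁₂ ▸ h₁₂) (e₁₃ ▸ h₁₃) ha hb
  · exact h.rotate.rotate.component_eq_of_one hf hC hK (e₁₃ ▸ h₁₃) (e₂₃ ▸ h₂₃) h₁₂ ha hb
  · exact h.rotate.component_eq_of_one hf hC hK h₂₃ (e₁₂ ▸ h₁₂) (e₁₃ ▸ h₁₃) ha hb
  · exact h.component_eq_of_none hf hC hK h₁₂ h₁₃ h₂₃ ha hb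

end ProjectivePlanarEmbedding.IsDelta

theorem mainTheorem7 {V : Type*} [Finite V] (G : SimpleGraph V) (v₀ : V)
    (hY : (G.neighborSet v₀).ncard = 3) (hG : IsNonseparatingProjectivePlanar G) :
    IsNonseparatingProjectivePlanar (yDeltaExchange G v₀) := by
  obtain ⟨f, hf⟩ := hG
  obtain ⟨v₁, v₂, v₃, h₁₂, h₁₃, h₂₃, e⟩ := Set.ncard_eq_three.1 hY
  have hadj : ∀ w, G.Adj v₀ w ↔ w = v₁ ∨ w = v₂ ∨ w = v₃ := fun w => by
    rw [← SimpleGraph.mem_neighborSet, e]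
    rfl
  obtain ⟨f', y₁, y₂, y₃, hf', std⟩ := f.exists_isStandard hf hadj h₁₂ h₁₃ h₂₃
  have hne : ∀ w, w = v₁ ∨ w = v₂ ∨ w = v₃ → w ≠ v₀ := fun w hw => ((hadj w).2 hw).ne'
  exact ⟨_, (ProjectivePlanarEmbedding.isDelta_deltaEmbedding (v₁ := ⟨v₁, hne _ (by simp)⟩)
    (v₂ := ⟨v₂, hne _ (by simp)⟩) (v₃ := ⟨v₃, hne _ (by simp)⟩) std).not_isSeparating hf'⟩
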